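/- **Setting.** For a bounded smooth function $m$ on $\mathbb R^2$ let $M$ be the operator $\widehat{Mf}=m\hat f$ on $L^2(\mathbb R^2)$. For $c>0$ we say that $m$ is a Calderón–Zygmund symbol with constant $c$ if $m\in C^\infty(\mathbb R^2;\mathbb C)$ and $|\partial^\alpha m(\xi)|\le c\,(1+|\xi|)^{-|\alpha|}$ for all $\xi\in\mathbb R^2$ and all multi-indices with $|\alpha|\le 8$. Fix a smooth radial function $\chi$ supported in $\{1/2\le|\xi|\le2\}$ with $\sum_{k\in\mathbb Z}\chi(2^{-k}\xi)=1$ for $\xi\ne0$, let $P_k$ ($k\ge1$) be the multiplier operator with symbol $\chi(2^{-k}\xi)$ and $P_{\le0}$ the one with symbol $1-\sum_{k\ge1}\chi(2^{-k}\xi)$, and put $$\|a\|_{B^1_{2,1}}=\|P_{\le0}a\|_{L^2}+\sum_{k\ge1}2^k\|P_ka\|_{L^2}$$ (equal to $\infty$ if $a\notin L^2$). For functions $f$ on $\mathbb R^2$ put $$N(f)=\|f\|_{L^1}\,\log\bigl(2+\|\langle x\rangle^3f\|_{L^\infty}\bigr)+1,\qquad \langle x\rangle=(1+|x|^2)^{1/2}.$$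 **Proposition.** For every $c>0$ there is a constant $C>0$, depending only on $c$ (and on the choice of $\chi$), such that the following hold for every $A\ge0$, every integer $n\ge1$ and every measurable $f:\mathbb R^2\to\mathbb C$ with $\langle x\rangle^3f\in L^\infty$ (in particular for every smooth compactly supported $f$). 1. If $m$ is a Calderón–Zygmund symbol with constant $c$ and $a:\mathbb R^2\to\mathbb C$ is smooth with $\|a\|_{B^1_{2,1}}\le A$, then $(aM)^nf$ is well defined, with $(aM)^nf\in L^2$, and $$\|(aM)^nf\|_{L^1(\mathbb R^2)}\le C^nA^nN(f).$$ 2. More generally, if $m_1,\dots,m_n$ are Calderón–Zygmund symbols with the same constant $c$, with operators $M_1,\dots,M_n$, and $a_1,\dots,a_n$ are smooth with $\|a_i\|_{B^1_{2,1}}\le A$ for all $i$, then $a_1M_1a_2M_2\cdots a_nM_nf\in L^2$ and $$\|a_1M_1a_2M_2\cdots a_nM_nf\|_{L^1(\mathbb R^2)}\le C^nA^nN(f).$$ -/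

import Mathlib

open MeasureTheory
open scoped FourierTransform ENNReal ContDiff

/-- The plane `ℝ²` with its Euclidean norm and Lebesgue measure. -/
abbrev Plane : Type := EuclideanSpace ℝ (Fin 2)

open Classical in
/-- The translation-invariant operator `T` with multiplier `m`, `(T f)^ = m f^`, on its natural
`L²` domain; `𝓕` is the Fourier transform on `L²`. The value is a function representing the
`L²` class. Outside the domain (`f ∉ L²` or `m f^ ∉ L²`) the value is `0`; for bounded measurable
`m` the domain is all of `L²`. -/
noncomputable def fourierMultiplier (m f : Plane → ℂ) : Plane → ℂ :=
  if hf : MemLp f 2 (volume : Measure Plane) then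
    if hm : MemLp (fun ξ => m ξ * (𝓕 (hf.toLp f) : Lp (α := Plane) ℂ 2 volume) ξ) 2
        (volume : Measure Plane) then
      ((𝓕⁻ (hm.toLp _) : Lp (α := Plane) ℂ 2 volume) : Plane → ℂ)
    else 0
  else 0

/-- The operator `a M`: first the multiplier operator `M` with symbol `m`, then multiplication by
the coefficient `a`. -/
noncomputable def coeffMultiplier (a m f : Plane → ℂ) : Plane → ℂ :=
  fun x => a x * fourierMultiplier m f x

/-- `m` is the symbol of a Calderon-Zygmund operator on `ℝ²`, smooth at the origin, with
constant `c`: it is smooth and `|∂^α m(ξ)| ≤ c (1 + |ξ|)^(-|α|)` for all multi-indices of order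
`|α| ≤ 2 + 6`. The partial derivative of order `k` in the coordinate directions `i 0, …, i (k-1)`
is the `k`-th Fréchet derivative evaluated at the corresponding standard basis vectors. -/
def IsCZSymbol (c : ℝ) (m : Plane → ℂ) : Prop :=
  ContDiff ℝ ∞ m ∧
    ∀ k : ℕ, k ≤ 2 + 6 → ∀ (i : Fin k → Fin 2) (ξ : Plane),
      ‖iteratedFDeriv ℝ k m ξ (fun j => EuclideanSpace.single (i j) (1 : ℝ))‖
        ≤ c * ((1 + ‖ξ‖) ^ k)⁻¹

/-- A Littlewood-Paley cut-off function: a smooth radial function `χ` supported in the annulus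
`1/2 ≤ |ξ| ≤ 2` with `∑_{k ∈ ℤ} χ(2^{-k} ξ) = 1` for all `ξ ≠ 0`. -/
structure IsLittlewoodPaleyCutoff (χ : Plane → ℝ) : Prop where
  smooth : ContDiff ℝ ∞ χ
  radial : ∀ ξ η : Plane, ‖ξ‖ = ‖η‖ → χ ξ = χ η
  support : ∀ ξ : Plane, χ ξ ≠ 0 → 1 / 2 ≤ ‖ξ‖ ∧ ‖ξ‖ ≤ 2
  partition : ∀ ξ : Plane, ξ ≠ 0 → HasSum (fun k : ℤ => χ ((2 : ℝ) ^ (-k) • ξ)) 1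

/-- The Littlewood-Paley projection `P_k`, with multiplier `χ(2^{-k} ξ)` (used for `k ≥ 1`). -/
noncomputable def lpProj (χ : Plane → ℝ) (k : ℕ) (f : Plane → ℂ) : Plane → ℂ :=
  fourierMultiplier (fun ξ => ((χ ((2 : ℝ) ^ (-(k : ℤ)) • ξ) : ℝ) : ℂ)) f

/-- The low-frequency projection `P_{≤ 0}`, with multiplier `1 - ∑_{k ≥ 1} χ(2^{-k} ξ)`. -/
noncomputable def lpLow (χ : Plane → ℝ) (f : Plane → ℂ) : Plane → ℂ :=
  fourierMultiplier
    (fun ξ => ((1 - ∑' k : ℕ, χ ((2 : ℝ) ^ (-((k : ℤ) + 1)) • ξ) : ℝ) : ℂ)) f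

open Classical in
/-- The inhomogeneous Besov norm of `B^1_{2,1}(ℝ²)`:
`‖P_{≤ 0} a‖_{L²} + ∑_{k ≥ 1} 2^k ‖P_k a‖_{L²}`, with value `∞` for functions that are not in
`L²` (every tempered distribution with finite norm is an `L²` function). -/
noncomputable def besovNorm (χ : Plane → ℝ) (a : Plane → ℂ) : ℝ≥0∞ :=
  if MemLp a 2 (volume : Measure Plane) then
    eLpNorm (lpLow χ a) 2 volume + ∑' k : ℕ, 2 ^ (k + 1) * eLpNorm (lpProj χ (k + 1) a) 2 volume
  else ∞

/-- The weighted function `<x>³ f(x)`, where `<x> = (1 + |x|²)^{1/2}`. -/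
noncomputable def cubicWeight (f : Plane → ℂ) : Plane → ℂ :=
  fun x => ((√(1 + ‖x‖ ^ 2) ^ 3 : ℝ) : ℂ) * f x

/-- `N(f) = ‖f‖_{L¹} log⁺(‖<x>³ f‖_{L^∞}) + 1`, where `log⁺ y = log (2 + |y|)`. -/
noncomputable def logLossNorm (f : Plane → ℂ) : ℝ :=
  (eLpNorm f 1 volume).toReal * Real.log (2 + |(eLpNorm (cubicWeight f) ∞ volume).toReal|) + 1

open Filter Topology

/-! An order zero multiplier is not bounded on `L¹`; it loses a logarithm there. Estimating the
factors one after another would accumulate a power of the logarithm. The remedy is to move all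
coefficients to the left of all multipliers, and to measure the errors in a norm on which neither
operation loses anything.

That norm is sup_j ‖P_j h‖_{L¹}, the norm of B^0_{1,∞}, expressed by `BandBound`. Multipliers
preserve it because their frequency-localized kernels are uniformly in `L¹`
(`IsKernelConstant.bandBound_multOp`). The commutation formula `CoeffDecomp.commute` reads M(a h) =
a M h + V + M U, with U and V bounded in `L¹` by A sup_j ‖P_j h‖_{L¹}. To see it, take a piece of a
at frequency 2^k, of size α in `L^∞`, α 2^{-k} in `L²`, and with Lipschitz constant α 2^k. The part
of h below frequency 2^k has `L²` norm O(2^k) by Bernstein, so its product with the piece is in `L¹`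
by Cauchy–Schwarz. On a band 2^j with j > k, the commutator with a localized kernel gains 2^{-j}
against the Lipschitz constant, and the sum over j converges. Taking M = P_j in the same formula
shows that multiplication by a preserves the norm as well (`CoeffDecomp.bandBound_mulOp`), so along
the composition it grows only geometrically.

The logarithm enters through `IsKernelConstant.endpoint`, which bounds b M u in `L¹` when ‖u‖_{L¹} ≤
DF and ‖u‖_{L²} ≤ DG. Calderón–Zygmund decompositions of u at heights D 2^i, with good parts g_i,
give u = g_0 + Σ_{i<N} (g_{i+1} - g_i) + (u - g_N). On the exceptional sets one uses Cauchy–Schwarz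
and the `L²` bound of M; elsewhere one uses the cancellation of the bad parts. Each difference costs
O(DF) whatever i is, and N ~ log(2 + G) steps suffice to make the last term harmless. Only the ratio
G enters the logarithm, not the size D.

`IsKernelConstant.chain_endpoint` combines the two by induction on the number of factors, for b M
a₁M₁⋯aₙMₙ f with arbitrary b in L² ∩ L^∞ and arbitrary M. Commuting a₁ past M gives (b a₁)(M M₁)
a₂M₂⋯ + b V + b M U. The first term has one factor fewer, the second is in `L¹`, and the third is an
endpoint term in which U has `L¹` and `L²` bounds with a common geometric factor. Hence every term
carries a single log(2 + G), where G bounds ‖f‖_{L²}, and the sum over the steps is absorbed into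
the geometric constant. -/

/-- The Hilbert space `L²(ℝ²; ℂ)`. -/
abbrev L2Plane : Type := Lp (α := Plane) ℂ 2 volume

namespace L2Plane

/-! ### Multiplication operators and Fourier multipliers on `L²` -/

open Classical in
/-- Multiplication by an essentially bounded function, as an operator on `L²`. -/
noncomputable def mulOp (a : Plane → ℂ) : L2Plane →L[ℂ] L2Plane :=
  if ha : MemLp a ∞ (volume : Measure Plane) then
    (ContinuousLinearMap.mul ℂ ℂ).holderL volume ∞ 2 2 (ha.toLp a)
  else 0

/-- The Fourier multiplier with an essentially bounded symbol, as an operator on `L²`. -/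
noncomputable def multOp (m : Plane → ℂ) : L2Plane →L[ℂ] L2Plane :=
  ((Lp.fourierTransformₗᵢ Plane ℂ).symm.toContinuousLinearEquiv : L2Plane →L[ℂ] L2Plane) ∘L
    mulOp m ∘L ((Lp.fourierTransformₗᵢ Plane ℂ).toContinuousLinearEquiv : L2Plane →L[ℂ] L2Plane)

lemma multOp_apply (m : Plane → ℂ) (h : L2Plane) : multOp m h = 𝓕⁻ (mulOp m (𝓕 h)) := rfl

lemma memLp_mul {a : Plane → ℂ} (ha : MemLp a ∞ (volume : Measure Plane)) {f : Plane → ℂ}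
    (hf : MemLp f 2 (volume : Measure Plane)) :
    MemLp (fun x => a x * f x) 2 (volume : Measure Plane) :=
  (ContinuousLinearMap.mul ℂ ℂ).memLp_of_bilin 2 ha hf

lemma coeFn_mulOp {a : Plane → ℂ} (ha : MemLp a ∞ (volume : Measure Plane)) (h : L2Plane) :
    mulOp a h =ᵐ[volume] fun x => a x * h x := by
  rw [mulOp, dif_pos ha]
  change ((ContinuousLinearMap.mul ℂ ℂ).holder 2 (ha.toLp a) h : Plane → ℂ) =ᵐ[volume] _
  filter_upwards [(ContinuousLinearMap.mul ℂ ℂ).coeFn_holder (r := 2) (ha.toLp a) h,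
    ha.coeFn_toLp] with x h1 h2
  rw [h1, h2]; rfl

lemma mulOp_eq_toLp {a : Plane → ℂ} (ha : MemLp a ∞ (volume : Measure Plane)) (h : L2Plane) :
    mulOp a h = (memLp_mul ha (Lp.memLp h)).toLp _ :=
  Lp.ext ((coeFn_mulOp ha h).trans (MemLp.coeFn_toLp _).symm)

lemma norm_le_of_ae_le {c : ℝ} {f h : L2Plane} (hfh : ∀ᵐ x, ‖f x‖ ≤ c * ‖h x‖) :
    ‖f‖ ≤ c * ‖h‖ :=
  Lp.norm_le_mul_norm_of_ae_le_mul hfh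

lemma memLp_top_of_le {c : ℝ} {a : Plane → ℂ} (hm : AEStronglyMeasurable a volume)
    (ha : ∀ x, ‖a x‖ ≤ c) : MemLp a ∞ (volume : Measure Plane) :=
  memLp_top_of_bound hm c (ae_of_all _ ha)

lemma norm_mulOp_apply_le {c : ℝ} {a : Plane → ℂ} (hm : AEStronglyMeasurable a volume)
    (ha : ∀ x, ‖a x‖ ≤ c) (h : L2Plane) : ‖mulOp a h‖ ≤ c * ‖h‖ := by
  refine norm_le_of_ae_le ?_
  filter_upwards [coeFn_mulOp (memLp_top_of_le hm ha) h] with x hx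
  rw [hx, norm_mul]
  exact mul_le_mul_of_nonneg_right (ha x) (norm_nonneg _)

lemma norm_multOp_apply_le {c : ℝ} {m : Plane → ℂ} (hm : AEStronglyMeasurable m volume)
    (hc : ∀ x, ‖m x‖ ≤ c) (h : L2Plane) : ‖multOp m h‖ ≤ c * ‖h‖ := by
  have h1 : ‖multOp m h‖ = ‖mulOp m (𝓕 h)‖ :=
    (Lp.fourierTransformₗᵢ Plane ℂ).symm.norm_map _
  rw [h1, ← Lp.norm_fourier_eq h]
  exact norm_mulOp_apply_le hm hc _

lemma fourier_multOp (m : Plane → ℂ) (h : L2Plane) : 𝓕 (multOp m h) = mulOp m (𝓕 h) := by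
  rw [multOp_apply, FourierTransform.fourier_fourierInv_eq]

lemma mulOp_congr {a b : Plane → ℂ} (hab : a =ᵐ[volume] b) : mulOp a = mulOp b := by
  by_cases ha : MemLp a ∞ (volume : Measure Plane)
  · have hb := (memLp_congr_ae hab).1 ha
    ext1 h
    refine Lp.ext ?_
    filter_upwards [coeFn_mulOp ha h, coeFn_mulOp hb h, hab] with x h1 h2 h3
    rw [h1, h2, h3]
  · have hb : ¬ MemLp b ∞ (volume : Measure Plane) := fun hb => ha ((memLp_congr_ae hab).2 hb)
    rw [mulOp, mulOp, dif_neg ha, dif_neg hb]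

lemma mulOp_mul {a b : Plane → ℂ} (ha : MemLp a ∞ (volume : Measure Plane))
    (hb : MemLp b ∞ (volume : Measure Plane)) (h : L2Plane) :
    mulOp (fun x => a x * b x) h = mulOp a (mulOp b h) := by
  have hab : MemLp (fun x => a x * b x) ∞ (volume : Measure Plane) :=
    (ContinuousLinearMap.mul ℂ ℂ).memLp_of_bilin ∞ ha hb
  refine Lp.ext ?_
  filter_upwards [coeFn_mulOp hab h, coeFn_mulOp ha (mulOp b h), coeFn_mulOp hb h] with x h1 h2 h3
  rw [h1, h2, h3, mul_assoc]

lemma mulOp_sub {a b : Plane → ℂ} (ha : MemLp a ∞ (volume : Measure Plane))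
    (hb : MemLp b ∞ (volume : Measure Plane)) (h : L2Plane) :
    mulOp (fun x => a x - b x) h = mulOp a h - mulOp b h := by
  refine Lp.ext ?_
  filter_upwards [coeFn_mulOp (ha.sub hb) h, coeFn_mulOp ha h, coeFn_mulOp hb h,
    Lp.coeFn_sub (mulOp a h) (mulOp b h)] with x h1 h2 h3 h4
  have h1' : mulOp (fun x => a x - b x) h x = (a x - b x) * h x := h1
  rw [h1', h4, Pi.sub_apply, h2, h3, sub_mul]

lemma multOp_mul {a b : Plane → ℂ} (ha : MemLp a ∞ (volume : Measure Plane))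
    (hb : MemLp b ∞ (volume : Measure Plane)) (h : L2Plane) :
    multOp (fun x => a x * b x) h = multOp a (multOp b h) := by
  rw [multOp_apply, mulOp_mul ha hb, multOp_apply a, fourier_multOp]

lemma multOp_comm {a b : Plane → ℂ} (ha : MemLp a ∞ (volume : Measure Plane))
    (hb : MemLp b ∞ (volume : Measure Plane)) (h : L2Plane) :
    multOp a (multOp b h) = multOp b (multOp a h) := by
  rw [← multOp_mul ha hb, ← multOp_mul hb ha]
  simp only [mul_comm]

lemma multOp_sub {a b : Plane → ℂ} (ha : MemLp a ∞ (volume : Measure Plane))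
    (hb : MemLp b ∞ (volume : Measure Plane)) (h : L2Plane) :
    multOp (fun x => a x - b x) h = multOp a h - multOp b h := by
  rw [multOp_apply, mulOp_sub ha hb]
  exact (Lp.fourierTransformₗᵢ Plane ℂ).symm.map_sub _ _

lemma multOp_one (h : L2Plane) : multOp (fun _ => 1) h = h := by
  have h1 : mulOp (fun _ => 1) (𝓕 h) = 𝓕 h := by
    refine Lp.ext ?_
    filter_upwards [coeFn_mulOp (a := fun _ => (1 : ℂ))
      (memLp_top_of_le (c := 1) aestronglyMeasurable_const (by simp)) (𝓕 h)] with x hx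
    rw [hx, one_mul]
  rw [multOp_apply, h1, FourierTransform.fourierInv_fourier_eq]

/-- Multipliers that are uniformly bounded and converge pointwise converge strongly. -/
lemma tendsto_mulOp {c : ℝ} {a : ℕ → Plane → ℂ} {b : Plane → ℂ}
    (ha : ∀ n, AEStronglyMeasurable (a n) volume) (hc : ∀ n x, ‖a n x‖ ≤ c)
    (hlim : ∀ x, Tendsto (fun n => a n x) atTop (𝓝 (b x))) (h : L2Plane) :
    Tendsto (fun n => mulOp (a n) h) atTop (𝓝 (mulOp b h)) := by
  have hbm : AEStronglyMeasurable b volume :=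
    aestronglyMeasurable_of_tendsto_ae atTop ha (ae_of_all _ hlim)
  have hbc : ∀ x, ‖b x‖ ≤ c := fun x =>
    le_of_tendsto ((hlim x).norm) (Eventually.of_forall fun n => hc n x)
  have hA := fun n => memLp_top_of_le (ha n) (hc n)
  have hB := memLp_top_of_le hbm hbc
  rw [tendsto_iff_norm_sub_tendsto_zero]
  have key : ∀ n, ‖mulOp (a n) h - mulOp b h‖ ^ 2 = ∫ x, ‖(a n x - b x) * h x‖ ^ 2 := by
    intro n
    rw [← mulOp_sub (hA n) hB, ← inner_self_eq_norm_sq (𝕜 := ℂ)]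
    rw [L2.inner_def, ← integral_re (L2.integrable_inner _ _)]
    refine integral_congr_ae ?_
    filter_upwards [coeFn_mulOp ((hA n).sub hB) h] with x hx
    have hx' : mulOp (fun x => a n x - b x) h x = (a n x - b x) * h x := hx
    rw [hx', inner_self_eq_norm_sq_to_K]
    norm_cast
  have h2 : Tendsto (fun n => ‖mulOp (a n) h - mulOp b h‖ ^ 2) atTop (𝓝 0) := by
    simp_rw [key]
    have h0 : (0 : ℝ) = ∫ x : Plane, (0 : ℝ) := by simp
    rw [h0]
    refine tendsto_integral_of_dominated_convergence (fun x => (2 * c * ‖h x‖) ^ 2) ?_ ?_ ?_ ?_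
    · intro n
      exact ((((ha n).sub hbm).mul (Lp.aestronglyMeasurable h)).norm.pow 2)
    · have := (Lp.memLp h).integrable_norm_pow (p := 2) (by norm_num)
      simp_rw [mul_pow]
      exact this.const_mul _
    · intro n
      refine ae_of_all _ fun x => ?_
      rw [norm_pow, norm_norm, norm_mul]
      refine pow_le_pow_left₀ (by positivity) (mul_le_mul_of_nonneg_right ?_ (norm_nonneg _)) 2
      linarith [norm_sub_le (a n x) (b x), hc n x, hbc x]
    · refine ae_of_all _ fun x => ?_
      have : Tendsto (fun n => ‖(a n x - b x) * h x‖ ^ 2) atTop (𝓝 (‖(b x - b x) * h x‖ ^ 2)) :=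
        ((((hlim x).sub_const _).mul_const _).norm.pow 2)
      simpa using this
  have h3 := (Real.continuous_sqrt.tendsto 0).comp h2
  simpa [Function.comp_def, Real.sqrt_sq] using h3

lemma tendsto_multOp {c : ℝ} {a : ℕ → Plane → ℂ} {b : Plane → ℂ}
    (ha : ∀ n, AEStronglyMeasurable (a n) volume) (hc : ∀ n x, ‖a n x‖ ≤ c)
    (hlim : ∀ x, Tendsto (fun n => a n x) atTop (𝓝 (b x))) (h : L2Plane) :
    Tendsto (fun n => multOp (a n) h) atTop (𝓝 (multOp b h)) :=
  ((Lp.fourierTransformₗᵢ Plane ℂ).symm.continuous.tendsto _).comp (tendsto_mulOp ha hc hlim (𝓕 h))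

lemma memLp_fourierMultiplier_symbol {m f : Plane → ℂ} (hm : MemLp m ∞ (volume : Measure Plane))
    (hf : MemLp f 2 (volume : Measure Plane)) :
    MemLp (fun ξ => m ξ * (𝓕 (hf.toLp f) : Lp (α := Plane) ℂ 2 volume) ξ) 2
      (volume : Measure Plane) :=
  memLp_mul hm (Lp.memLp _)

lemma fourierMultiplier_eq {m f : Plane → ℂ} (hm : MemLp m ∞ (volume : Measure Plane))
    (hf : MemLp f 2 (volume : Measure Plane)) :
    fourierMultiplier m f = (multOp m (hf.toLp f) : Plane → ℂ) := by
  rw [fourierMultiplier, dif_pos hf, dif_pos (memLp_fourierMultiplier_symbol hm hf), multOp_apply,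
    mulOp_eq_toLp hm]

lemma memLp_coeffMultiplier {a m f : Plane → ℂ} (ha : MemLp a ∞ (volume : Measure Plane))
    (hm : MemLp m ∞ (volume : Measure Plane)) (hf : MemLp f 2 (volume : Measure Plane)) :
    MemLp (coeffMultiplier a m f) 2 (volume : Measure Plane) := by
  have h := memLp_mul ha (Lp.memLp (multOp m (hf.toLp f)))
  rwa [← fourierMultiplier_eq hm hf] at h

lemma toLp_coeffMultiplier {a m f : Plane → ℂ} (ha : MemLp a ∞ (volume : Measure Plane))
    (hm : MemLp m ∞ (volume : Measure Plane)) (hf : MemLp f 2 (volume : Measure Plane)) :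
    (memLp_coeffMultiplier ha hm hf).toLp _ = mulOp a (multOp m (hf.toLp f)) := by
  rw [mulOp_eq_toLp ha]
  refine MemLp.toLp_congr _ _ (ae_of_all _ fun x => ?_)
  change a x * fourierMultiplier m f x = _
  rw [fourierMultiplier_eq hm hf]

/-! ### `L¹` norms of `L²` functions -/

/-- Fatou's lemma for `L²` limits: `L¹` norms over a set are lower semicontinuous. -/
lemma setLIntegral_enorm_le_of_tendsto {F : ℕ → L2Plane} {g : L2Plane}
    (hF : Tendsto F atTop (𝓝 g)) {S : Set Plane} {B : ℝ≥0∞}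
    (hB : ∀ n, ∫⁻ x in S, ‖F n x‖ₑ ≤ B) : ∫⁻ x in S, ‖g x‖ₑ ≤ B := by
  obtain ⟨ns, -, hns⟩ := (tendstoInMeasure_of_tendsto_Lp hF).exists_seq_tendsto_ae
  have h1 := Lp.eLpNorm_lim_le_liminf_eLpNorm (p := 1) (μ := volume.restrict S)
    (f := fun n => F (ns n)) (fun n => (Lp.aestronglyMeasurable _).restrict) g
    (ae_restrict_of_ae hns)
  simp only [eLpNorm_one_eq_lintegral_enorm] at h1
  refine h1.trans (liminf_le_of_le (by isBoundedDefault) fun b hb => ?_)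
  obtain ⟨n, hn⟩ := hb.exists
  exact hn.trans (hB _)

lemma lintegral_enorm_le_of_tendsto {F : ℕ → L2Plane} {g : L2Plane}
    (hF : Tendsto F atTop (𝓝 g)) {B : ℝ≥0∞}
    (hB : ∀ n, ∫⁻ x, ‖F n x‖ₑ ≤ B) : ∫⁻ x, ‖g x‖ₑ ≤ B := by
  have := setLIntegral_enorm_le_of_tendsto (S := Set.univ) hF (B := B)
  simp only [Measure.restrict_univ] at this
  exact this hB

lemma setLIntegral_enorm_add_le (f g : L2Plane) (S : Set Plane) :
    ∫⁻ x in S, ‖(f + g) x‖ₑ ≤ (∫⁻ x in S, ‖f x‖ₑ) + ∫⁻ x in S, ‖g x‖ₑ := by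
  rw [← lintegral_add_left' ((Lp.aestronglyMeasurable f).enorm.restrict)]
  refine lintegral_mono_ae (ae_restrict_of_ae ?_)
  filter_upwards [Lp.coeFn_add f g] with x hx
  rw [hx]; exact enorm_add_le _ _

lemma setLIntegral_enorm_sub_le (f g : L2Plane) (S : Set Plane) :
    ∫⁻ x in S, ‖(f - g) x‖ₑ ≤ (∫⁻ x in S, ‖f x‖ₑ) + ∫⁻ x in S, ‖g x‖ₑ := by
  rw [← lintegral_add_left' ((Lp.aestronglyMeasurable f).enorm.restrict)]
  refine lintegral_mono_ae (ae_restrict_of_ae ?_)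
  filter_upwards [Lp.coeFn_sub f g] with x hx
  rw [hx]; exact enorm_sub_le

lemma lintegral_enorm_add_le (f g : L2Plane) :
    ∫⁻ x, ‖(f + g) x‖ₑ ≤ (∫⁻ x, ‖f x‖ₑ) + ∫⁻ x, ‖g x‖ₑ := by
  simpa using setLIntegral_enorm_add_le f g Set.univ

lemma lintegral_enorm_sub_le (f g : L2Plane) :
    ∫⁻ x, ‖(f - g) x‖ₑ ≤ (∫⁻ x, ‖f x‖ₑ) + ∫⁻ x, ‖g x‖ₑ := by
  simpa using setLIntegral_enorm_sub_le f g Set.univ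

lemma lintegral_enorm_sum_le {ι : Type*} (s : Finset ι) (F : ι → L2Plane) :
    ∫⁻ x, ‖(∑ i ∈ s, F i : L2Plane) x‖ₑ ≤ ∑ i ∈ s, ∫⁻ x, ‖F i x‖ₑ := by
  classical
  induction s using Finset.induction_on with
  | empty =>
    simp only [Finset.sum_empty, nonpos_iff_eq_zero]
    rw [lintegral_congr_ae (g := fun _ => 0)]
    · simp
    filter_upwards [Lp.coeFn_zero ℂ 2 (volume : Measure Plane)] with x hx
    rw [hx]; simp
  | insert i s hi ih =>
    rw [Finset.sum_insert hi, Finset.sum_insert hi]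
    exact (lintegral_enorm_add_le _ _).trans (by gcongr)

/-- If the `L²` limit of `∑ F i` is `g`, then the `L¹` norm of `g` is at most the sum of the
`L¹` norms. -/
lemma lintegral_enorm_tsum_le {F : ℕ → L2Plane} {g : L2Plane} (hF : HasSum F g) {B : ℕ → ℝ}
    (hB0 : ∀ n, 0 ≤ B n) {S : ℝ} (hBS : HasSum B S)
    (hB : ∀ n, ∫⁻ x, ‖F n x‖ₑ ≤ ENNReal.ofReal (B n)) :
    ∫⁻ x, ‖g x‖ₑ ≤ ENNReal.ofReal S := by
  refine lintegral_enorm_le_of_tendsto hF.tendsto_sum_nat fun n => ?_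
  refine (lintegral_enorm_sum_le _ _).trans ((Finset.sum_le_sum fun i _ => hB i).trans ?_)
  rw [← ENNReal.ofReal_sum_of_nonneg fun i _ => hB0 i]
  exact ENNReal.ofReal_le_ofReal (sum_le_hasSum _ (fun i _ => hB0 i) hBS)

lemma enorm_sq_eq_lintegral (h : L2Plane) : ‖h‖ₑ ^ 2 = ∫⁻ x, ‖h x‖ₑ ^ 2 := by
  rw [Lp.enorm_def, eLpNorm_eq_lintegral_rpow_enorm_toReal (by norm_num) (by norm_num)]
  rw [← ENNReal.rpow_natCast, ← ENNReal.rpow_mul]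
  norm_num

lemma lintegral_mul_enorm_le {b : Plane → ℂ} (hb : MemLp b 2 (volume : Measure Plane))
    (h : L2Plane) : ∫⁻ x, ‖b x * h x‖ₑ ≤ eLpNorm b 2 volume * ‖h‖ₑ := by
  have := eLpNorm_smul_le_mul_eLpNorm (p := 2) (q := 2) (r := 1) (Lp.aestronglyMeasurable h) hb.1
  rw [eLpNorm_one_eq_lintegral_enorm, ← Lp.enorm_def] at this
  exact this

open scoped SchwartzMap

/-! ### Convolution inequalities -/

/-- Cauchy–Schwarz for the measure with density `p`, applied to 1 and `q`; both forms of Young's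
inequality below come from it. -/
lemma lintegral_mul_sq_le {p q : Plane → ℝ≥0∞} (hp : AEMeasurable p volume)
    (hq : AEMeasurable q volume) :
    (∫⁻ x, p x * q x) ^ 2 ≤ (∫⁻ x, p x) * ∫⁻ x, p x * q x ^ 2 := by
  have h := ENNReal.lintegral_mul_le_Lp_mul_Lq (volume : Measure Plane)
    (p := 2) (q := 2) (by constructor <;> norm_num)
    (f := fun x => p x ^ (1 / 2 : ℝ)) (g := fun x => p x ^ (1 / 2 : ℝ) * q x)
    (hp.pow_const _) ((hp.pow_const _).mul hq)
  have e1 : ∀ x, ((fun x => p x ^ (1 / 2 : ℝ)) * fun x => p x ^ (1 / 2 : ℝ) * q x) x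
      = p x * q x := by
    intro x
    simp only [Pi.mul_apply]
    rw [← mul_assoc, ← ENNReal.rpow_add_of_nonneg _ _ (by norm_num) (by norm_num)]
    norm_num
  have e2 : ∀ x, (p x ^ (1 / 2 : ℝ)) ^ (2 : ℝ) = p x := by
    intro x; rw [← ENNReal.rpow_mul]; norm_num
  have e3 : ∀ x, (p x ^ (1 / 2 : ℝ) * q x) ^ (2 : ℝ) = p x * q x ^ 2 := by
    intro x; rw [ENNReal.mul_rpow_of_nonneg _ _ (by norm_num), e2]; norm_num
  simp only [e1, e2, e3] at h
  calc _ ≤ ((∫⁻ x, p x) ^ (1 / 2 : ℝ) * (∫⁻ x, p x * q x ^ 2) ^ (1 / 2 : ℝ)) ^ 2 := by gcongr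
    _ = _ := by
      rw [mul_pow, ← ENNReal.rpow_natCast, ← ENNReal.rpow_natCast, ← ENNReal.rpow_mul,
        ← ENNReal.rpow_mul]
      norm_num

lemma lintegral_sub_const (g : Plane → ℝ≥0∞) (y : Plane) :
    ∫⁻ x, g (x - y) = ∫⁻ x, g x :=
  lintegral_sub_right_eq_self g y

lemma aemeasurable_conv_integrand {G w : Plane → ℝ≥0∞} (hG : Measurable G)
    (hw : AEMeasurable w volume) :
    AEMeasurable (fun z : Plane × Plane => G (z.1 - z.2) * w z.2)
      ((volume : Measure Plane).prod volume) :=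
  (hG.comp (measurable_fst.sub measurable_snd)).aemeasurable.mul
    (hw.comp_quasiMeasurePreserving Measure.quasiMeasurePreserving_snd)

lemma lintegral_conv {G w : Plane → ℝ≥0∞} (hG : Measurable G) (hw : AEMeasurable w volume) :
    ∫⁻ x, ∫⁻ y, G (x - y) * w y = (∫⁻ x, G x) * ∫⁻ y, w y := by
  rw [lintegral_lintegral_swap (aemeasurable_conv_integrand hG hw)]
  have h1 : ∀ y, ∫⁻ x, G (x - y) * w y = (∫⁻ x, G x) * w y := by
    intro y
    have hm : Measurable fun x => G (x - y) := hG.comp (measurable_id.sub measurable_const)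
    rw [lintegral_mul_const _ hm, lintegral_sub_const]
  simp_rw [h1]
  rw [lintegral_const_mul'' _ hw]

lemma lintegral_conv_sq_le {G w : Plane → ℝ≥0∞} (hG : Measurable G)
    (hw : AEMeasurable w volume) :
    ∫⁻ x, (∫⁻ y, G (x - y) * w y) ^ 2 ≤ (∫⁻ x, G x) ^ 2 * ∫⁻ y, w y ^ 2 := by
  have h0 : ∀ x, ∫⁻ y, G (x - y) = ∫⁻ y, G y := fun x => lintegral_sub_left_eq_self G x
  calc _ ≤ ∫⁻ x, (∫⁻ y, G y) * ∫⁻ y, G (x - y) * w y ^ 2 := by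
        refine lintegral_mono fun x => ?_
        refine (lintegral_mul_sq_le
          (hG.comp (measurable_const.sub measurable_id)).aemeasurable hw).trans_eq ?_
        rw [← h0 x]; rfl
    _ = (∫⁻ y, G y) * ∫⁻ x, ∫⁻ y, G (x - y) * w y ^ 2 := by
        rw [lintegral_const_mul'']
        exact (aemeasurable_conv_integrand hG (hw.pow_const 2)).lintegral_prod_right'
    _ = _ := by
        rw [lintegral_conv hG (hw.pow_const 2), sq, mul_assoc]

/-- Here the weight in Cauchy–Schwarz is `w` instead of the kernel, so that the kernel is measured
in `L²` and the function in `L¹`. This is the source of the `L¹` to `L²` Bernstein inequality. -/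
lemma lintegral_conv_sq_le' {G w : Plane → ℝ≥0∞} (hG : Measurable G)
    (hw : AEMeasurable w volume) :
    ∫⁻ x, (∫⁻ y, G (x - y) * w y) ^ 2 ≤ (∫⁻ x, G x ^ 2) * (∫⁻ y, w y) ^ 2 := by
  calc _ ≤ ∫⁻ x, (∫⁻ y, w y) * ∫⁻ y, G (x - y) ^ 2 * w y := by
        refine lintegral_mono fun x => ?_
        have := lintegral_mul_sq_le hw (hG.comp (measurable_const.sub measurable_id)
          (g := G) (f := fun y : Plane => x - y)).aemeasurable
        simpa only [Function.comp_apply, mul_comm] using this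
    _ = (∫⁻ y, w y) * ∫⁻ x, ∫⁻ y, G (x - y) ^ 2 * w y := by
        rw [lintegral_const_mul'']
        exact (aemeasurable_conv_integrand (G := fun x => G x ^ 2)
          (hG.pow_const 2) hw).lintegral_prod_right'
    _ = _ := by
        rw [lintegral_conv (G := fun x => G x ^ 2) (hG.pow_const 2) hw]
        ring

/-! ### Multipliers with Schwartz symbols as convolution operators -/

lemma memLp_kernel (K : 𝓢(Plane, ℂ)) (x : Plane) :
    MemLp (fun y => K (x - y)) 2 (volume : Measure Plane) :=
  (K.memLp 2).comp_measurePreserving (Measure.measurePreserving_sub_left volume x)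

/-- For Schwartz data this is the convolution theorem; general `L²` data are reached by density in
`multOp_eq_convolution`. -/
lemma multOp_toLp (s f : 𝓢(Plane, ℂ)) :
    ∃ g : 𝓢(Plane, ℂ), multOp s (f.toLp 2) = g.toLp 2 ∧
      ∀ x, g x = ∫ y, (𝓕⁻ s : 𝓢(Plane, ℂ)) (x - y) * f y := by
  refine ⟨SchwartzMap.convolution (ContinuousLinearMap.mul ℂ ℂ) (𝓕⁻ s) f, ?_, fun x => ?_⟩
  · have h1 : mulOp s (𝓕 (f.toLp 2)) =
        (SchwartzMap.pairing (ContinuousLinearMap.mul ℂ ℂ) s (𝓕 f)).toLp 2 := by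
      rw [SchwartzMap.toLp_fourier_eq]
      refine Lp.ext ?_
      filter_upwards [coeFn_mulOp (s.memLp_top volume) ((𝓕 f : 𝓢(Plane, ℂ)).toLp 2),
        (𝓕 f : 𝓢(Plane, ℂ)).coeFn_toLp 2,
        (SchwartzMap.pairing (ContinuousLinearMap.mul ℂ ℂ) s (𝓕 f)).coeFn_toLp 2] with y h1 h2 h3
      rw [h1, h2, h3]; rfl
    rw [multOp_apply, h1, SchwartzMap.toLp_fourierInv_eq]
    simp [SchwartzMap.convolution]
  · rw [SchwartzMap.convolution_apply, convolution_eq_swap]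
    rfl

/-- A Fourier multiplier with Schwartz symbol `s` is convolution with `𝓕⁻ s`. -/
lemma multOp_eq_convolution (s : 𝓢(Plane, ℂ)) (h : L2Plane) :
    multOp s h =ᵐ[volume] fun x => ∫ y, (𝓕⁻ s : 𝓢(Plane, ℂ)) (x - y) * h y := by
  set K : 𝓢(Plane, ℂ) := 𝓕⁻ s with hK
  have hdense : DenseRange (SchwartzMap.toLpCLM ℂ (E := Plane) ℂ 2 volume) :=
    SchwartzMap.denseRange_toLpCLM ENNReal.ofNat_ne_top
  obtain ⟨F, hF, hFlim⟩ := mem_closure_iff_seq_limit.1 (hdense h)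
  choose f hf using hF
  have hlim2 : Tendsto (fun n => multOp s (F n)) atTop (𝓝 (multOp s h)) :=
    ((multOp s).continuous.tendsto h).comp hFlim
  obtain ⟨ns, hns, hae⟩ := (tendstoInMeasure_of_tendsto_Lp hlim2).exists_seq_tendsto_ae
  have hrep : ∀ᵐ x, ∀ n, multOp s (F n) x = ∫ y, K (x - y) * F n y := by
    rw [ae_all_iff]
    intro n
    obtain ⟨g, hg1, hg2⟩ := multOp_toLp s (f n)
    have hFn : F n = (f n).toLp 2 := (hf n).symm
    rw [hFn, hg1]
    filter_upwards [g.coeFn_toLp 2] with x hx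
    rw [hx, hg2]
    refine integral_congr_ae ?_
    filter_upwards [(f n).coeFn_toLp 2] with y hy
    rw [hy]
  have hint : ∀ (x : Plane) (u : L2Plane), Integrable (fun y => K (x - y) * u y) := fun x u =>
    (Lp.memLp u).integrable_mul (memLp_kernel K x) |>.congr
      (ae_of_all _ fun _ => mul_comm _ _)
  filter_upwards [hae, hrep] with x hx1 hx2
  -- At a fixed `x` the convolution integral is a continuous functional on `L²`, since the kernel is
  -- in `L²`; so it has the limit that the multiplier has almost everywhere along the subsequence.
  refine tendsto_nhds_unique hx1 ?_
  simp_rw [hx2]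
  have hbound : ∀ n, ‖(∫ y, K (x - y) * F n y) - ∫ y, K (x - y) * h y‖ₑ
      ≤ eLpNorm (fun y => K (x - y)) 2 volume * ‖F n - h‖ₑ := by
    intro n
    rw [← integral_sub (hint x _) (hint x _)]
    refine (enorm_integral_le_lintegral_enorm _).trans ?_
    refine le_trans (le_of_eq ?_) (lintegral_mul_enorm_le (memLp_kernel K x) (F n - h))
    refine lintegral_congr_ae ?_
    filter_upwards [Lp.coeFn_sub (F n) h] with y hy
    rw [hy, Pi.sub_apply, mul_sub]
  have hlim0 : Tendsto (fun n => eLpNorm (fun y => K (x - y)) 2 volume * ‖F (ns n) - h‖ₑ) atTop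
      (𝓝 0) := by
    have h1 : Tendsto (fun n => ‖F (ns n) - h‖ₑ) atTop (𝓝 0) := by
      have h2 := (hFlim.comp hns.tendsto_atTop).sub_const h
      have h3 := h2.enorm
      simpa using h3
    have h4 := ENNReal.Tendsto.const_mul h1 (Or.inr (memLp_kernel K x).2.ne)
    simpa using h4
  rw [tendsto_iff_edist_tendsto_0]
  refine tendsto_of_tendsto_of_tendsto_of_le_of_le tendsto_const_nhds hlim0
    (fun n => zero_le) fun n => ?_
  rw [edist_eq_enorm_sub]
  exact hbound (ns n)

lemma measurable_enorm_schwartz (K : 𝓢(Plane, ℂ)) : Measurable fun x => ‖K x‖ₑ :=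
  K.continuous.enorm.measurable

lemma integrable_kernel_mul (K : 𝓢(Plane, ℂ)) (x : Plane) (u : L2Plane) :
    Integrable (fun y => K (x - y) * u y) :=
  (Lp.memLp u).integrable_mul (memLp_kernel K x) |>.congr (ae_of_all _ fun _ => mul_comm _ _)

lemma enorm_multOp_le (s : 𝓢(Plane, ℂ)) (h : L2Plane) :
    ∀ᵐ x, ‖multOp s h x‖ₑ ≤ ∫⁻ y, ‖(𝓕⁻ s : 𝓢(Plane, ℂ)) (x - y)‖ₑ * ‖h y‖ₑ := by
  filter_upwards [multOp_eq_convolution s h] with x hx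
  rw [hx]
  refine (enorm_integral_le_lintegral_enorm _).trans_eq ?_
  simp_rw [enorm_mul]

lemma lintegral_multOp_le (s : 𝓢(Plane, ℂ)) (h : L2Plane) :
    ∫⁻ x, ‖multOp s h x‖ₑ ≤ (∫⁻ x, ‖(𝓕⁻ s : 𝓢(Plane, ℂ)) x‖ₑ) * ∫⁻ y, ‖h y‖ₑ :=
  (lintegral_mono_ae (enorm_multOp_le s h)).trans_eq
    (lintegral_conv (measurable_enorm_schwartz _) (Lp.aestronglyMeasurable h).enorm)

lemma enorm_multOp_sq_le (s : 𝓢(Plane, ℂ)) (h : L2Plane) :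
    ‖multOp s h‖ₑ ^ 2 ≤ (∫⁻ x, ‖(𝓕⁻ s : 𝓢(Plane, ℂ)) x‖ₑ ^ 2) * (∫⁻ y, ‖h y‖ₑ) ^ 2 := by
  rw [enorm_sq_eq_lintegral]
  refine (lintegral_mono_ae ?_).trans
    (lintegral_conv_sq_le' (measurable_enorm_schwartz (𝓕⁻ s)) (Lp.aestronglyMeasurable h).enorm)
  filter_upwards [enorm_multOp_le s h] with x hx
  gcongr

/-- Pointwise bound for the commutator of a convolution operator with a Lipschitz function. -/
lemma enorm_commutator_le (s : 𝓢(Plane, ℂ)) {a : Plane → ℂ}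
    (ha : MemLp a ∞ (volume : Measure Plane)) {L : ℝ}
    (hL : ∀ x y, ‖a x - a y‖ ≤ L * ‖x - y‖) (h : L2Plane) :
    ∀ᵐ x, ‖(multOp s (mulOp a h) - mulOp a (multOp s h)) x‖ₑ ≤
      ENNReal.ofReal L *
        ∫⁻ y, (‖x - y‖ₑ * ‖(𝓕⁻ s : 𝓢(Plane, ℂ)) (x - y)‖ₑ) * ‖h y‖ₑ := by
  filter_upwards [multOp_eq_convolution s h, multOp_eq_convolution s (mulOp a h),
    Lp.coeFn_sub (multOp s (mulOp a h)) (mulOp a (multOp s h)),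
    coeFn_mulOp ha (multOp s h)] with x h1 h2 h3 h4
  rw [h3, Pi.sub_apply, h2, h4, h1, ← integral_const_mul,
    ← integral_sub (integrable_kernel_mul _ _ _) ((integrable_kernel_mul _ _ _).const_mul _)]
  refine (enorm_integral_le_lintegral_enorm _).trans ?_
  rw [← lintegral_const_mul' _ _ ENNReal.ofReal_ne_top]
  refine lintegral_mono_ae ?_
  filter_upwards [coeFn_mulOp ha h] with y hy
  rw [hy]
  have e : (𝓕⁻ s : 𝓢(Plane, ℂ)) (x - y) * (a y * h y) - a x * ((𝓕⁻ s : 𝓢(Plane, ℂ)) (x - y) * h y)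
      = (a y - a x) * (𝓕⁻ s : 𝓢(Plane, ℂ)) (x - y) * h y := by ring
  rw [e, enorm_mul, enorm_mul]
  have hb : ‖a y - a x‖ₑ ≤ ENNReal.ofReal L * ‖x - y‖ₑ := by
    have hle := hL y x
    rw [norm_sub_rev y x] at hle
    rw [← ofReal_norm, ← ofReal_norm (x - y)]
    rcases le_total 0 L with hL0 | hL0
    · rw [← ENNReal.ofReal_mul hL0]
      exact ENNReal.ofReal_le_ofReal hle
    · have : ‖a y - a x‖ ≤ 0 := hle.trans (mul_nonpos_of_nonpos_of_nonneg hL0 (norm_nonneg _))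
      rw [ENNReal.ofReal_of_nonpos this]
      exact zero_le
  calc _ ≤ (ENNReal.ofReal L * ‖x - y‖ₑ) * ‖(𝓕⁻ s : 𝓢(Plane, ℂ)) (x - y)‖ₑ * ‖h y‖ₑ := by gcongr
    _ = _ := by ring

lemma measurable_weighted_kernel (K : 𝓢(Plane, ℂ)) :
    Measurable fun x : Plane => ‖x‖ₑ * ‖K x‖ₑ :=
  (continuous_enorm.measurable).mul (measurable_enorm_schwartz K)

/-- The weight |x - y| from the Lipschitz bound is given to the kernel, so the first moment appears;
at scale t it is of size 1/t, which is the gain from commuting. -/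
lemma lintegral_commutator_le (s : 𝓢(Plane, ℂ)) {a : Plane → ℂ}
    (ha : MemLp a ∞ (volume : Measure Plane)) {L : ℝ}
    (hL : ∀ x y, ‖a x - a y‖ ≤ L * ‖x - y‖) (h : L2Plane) :
    ∫⁻ x, ‖(multOp s (mulOp a h) - mulOp a (multOp s h)) x‖ₑ ≤
      ENNReal.ofReal L * (∫⁻ x, ‖x‖ₑ * ‖(𝓕⁻ s : 𝓢(Plane, ℂ)) x‖ₑ) * ∫⁻ y, ‖h y‖ₑ := by
  refine (lintegral_mono_ae (enorm_commutator_le s ha hL h)).trans_eq ?_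
  rw [lintegral_const_mul' _ _ ENNReal.ofReal_ne_top,
    lintegral_conv (G := fun x => ‖x‖ₑ * ‖(𝓕⁻ s : 𝓢(Plane, ℂ)) x‖ₑ)
      (measurable_weighted_kernel _) (Lp.aestronglyMeasurable h).enorm, mul_assoc]

lemma enorm_commutator_apply_le (s : 𝓢(Plane, ℂ)) {a : Plane → ℂ}
    (ha : MemLp a ∞ (volume : Measure Plane)) {L : ℝ}
    (hL : ∀ x y, ‖a x - a y‖ ≤ L * ‖x - y‖) (h : L2Plane) :
    ‖multOp s (mulOp a h) - mulOp a (multOp s h)‖ₑ ≤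
      ENNReal.ofReal L * (∫⁻ x, ‖x‖ₑ * ‖(𝓕⁻ s : 𝓢(Plane, ℂ)) x‖ₑ) * ‖h‖ₑ := by
  rw [← ENNReal.pow_le_pow_left_iff two_ne_zero, enorm_sq_eq_lintegral]
  calc _ ≤ ∫⁻ x, (ENNReal.ofReal L) ^ 2 *
        (∫⁻ y, (‖x - y‖ₑ * ‖(𝓕⁻ s : 𝓢(Plane, ℂ)) (x - y)‖ₑ) * ‖h y‖ₑ) ^ 2 := by
        refine lintegral_mono_ae ?_
        filter_upwards [enorm_commutator_le s ha hL h] with x hx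
        rw [← mul_pow]
        gcongr
    _ ≤ _ := by
        rw [lintegral_const_mul' _ _ (by finiteness), mul_pow, mul_pow, mul_assoc,
          enorm_sq_eq_lintegral h]
        gcongr
        exact lintegral_conv_sq_le (G := fun x => ‖x‖ₑ * ‖(𝓕⁻ s : 𝓢(Plane, ℂ)) x‖ₑ)
          (measurable_weighted_kernel _) (Lp.aestronglyMeasurable h).enorm

/-! ### Decay profiles -/

/-- The profile `t² (1 + t|x|)⁻⁴` of a kernel at frequency scale `t`. -/
noncomputable def kernelProfile (t : ℝ) (x : Plane) : ℝ := t ^ 2 * ((1 + t * ‖x‖) ^ 4)⁻¹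

lemma kernelProfile_le {t : ℝ} (ht : 0 < t) (x : Plane) : kernelProfile t x ≤ t ^ 2 := by
  rw [kernelProfile]
  have : ((1 + t * ‖x‖) ^ 4)⁻¹ ≤ 1 := inv_le_one_of_one_le₀ (one_le_pow₀ (by
    have : 0 ≤ t * ‖x‖ := by positivity
    linarith))
  nlinarith [sq_nonneg t]

lemma continuous_kernelProfile {t : ℝ} (ht : 0 < t) : Continuous (kernelProfile t) := by
  unfold kernelProfile
  refine continuous_const.mul (Continuous.inv₀ (by fun_prop) fun x => ?_)
  positivity

lemma finrank_plane : Module.finrank ℝ Plane = 2 := by simp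

lemma integrable_inv_one_add_norm_pow {n : ℕ} (hn : 3 ≤ n) :
    Integrable (fun x : Plane => ((1 + ‖x‖) ^ n)⁻¹) := by
  have h := integrable_one_add_norm (E := Plane) (μ := volume) (r := n)
    (by rw [finrank_plane]; exact_mod_cast hn)
  refine h.congr (ae_of_all _ fun x => ?_)
  simp only
  rw [Real.rpow_neg (by positivity), Real.rpow_natCast]

lemma integral_comp_scale {t : ℝ} (ht : 0 < t) (g : Plane → ℝ) :
    ∫ x, g (t • x) = (t ^ 2)⁻¹ * ∫ x, g x := by
  rw [Measure.integral_comp_smul, finrank_plane, abs_of_pos (by positivity), smul_eq_mul]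

/-- The fourth power of decay leaves one power to spend on |x|: both integrands are dominated by a
rescaled (1 + |x|)⁻³, integrable in dimension two. -/
lemma exists_lintegral_kernelProfile_le : ∃ C : ℝ, 0 < C ∧ ∀ t : ℝ, 0 < t →
    ∫⁻ x, ENNReal.ofReal (kernelProfile t x) ≤ ENNReal.ofReal C ∧
    ∫⁻ x, ‖x‖ₑ * ENNReal.ofReal (kernelProfile t x) ≤ ENNReal.ofReal (C / t) := by
  set g : Plane → ℝ := fun x => ((1 + ‖x‖) ^ 3)⁻¹ with hg
  have hgi : Integrable g := integrable_inv_one_add_norm_pow le_rfl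
  have hg0 : ∀ x, 0 ≤ g x := fun x => by simp only [hg]; positivity
  refine ⟨(∫ x, g x) + 1, by
    have := integral_nonneg (μ := volume) (f := g) hg0
    linarith, fun t ht => ?_⟩
  have key : ∀ c : ℝ, 0 ≤ c → ∫⁻ x : Plane, ENNReal.ofReal (c * t ^ 2 * g (t • x)) ≤
      ENNReal.ofReal (c * ((∫ x, g x) + 1)) := by
    intro c hc
    rw [← ofReal_integral_eq_lintegral_ofReal ((hgi.comp_smul ht.ne').const_mul _)
      (ae_of_all _ fun x => mul_nonneg (by positivity) (hg0 _)), integral_const_mul,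
      integral_comp_scale ht]
    refine ENNReal.ofReal_le_ofReal (le_of_eq_of_le (b := c * ∫ x, g x) (by field_simp) ?_)
    nlinarith
  have hn : ∀ x : Plane, ‖t • x‖ = t * ‖x‖ := fun x => by
    rw [norm_smul, Real.norm_of_nonneg ht.le]
  constructor
  · refine (lintegral_mono fun x => ENNReal.ofReal_le_ofReal ?_).trans
      ((key 1 zero_le_one).trans_eq (by rw [one_mul]))
    simp only [hg, kernelProfile, one_mul, hn]
    have h1 : 1 ≤ 1 + t * ‖x‖ := by have : 0 ≤ t * ‖x‖ := by positivity
                                    linarith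
    gcongr
    · norm_num
  · refine (lintegral_mono fun x => ?_).trans ((key (1 / t) (by positivity)).trans_eq (by
      rw [one_div, inv_mul_eq_div]))
    rw [← ofReal_norm, ← ENNReal.ofReal_mul (norm_nonneg _)]
    refine ENNReal.ofReal_le_ofReal ?_
    simp only [hg, kernelProfile, hn]
    have h0 : 0 ≤ t * ‖x‖ := by positivity
    have h2 : ‖x‖ ≤ 1 / t * (1 + t * ‖x‖) := by
      have : 1 / t * (1 + t * ‖x‖) = 1 / t + ‖x‖ := by field_simp
      rw [this]
      have : 0 < 1 / t := by positivity
      linarith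
    calc ‖x‖ * (t ^ 2 * ((1 + t * ‖x‖) ^ 4)⁻¹)
        ≤ (1 / t * (1 + t * ‖x‖)) * (t ^ 2 * ((1 + t * ‖x‖) ^ 4)⁻¹) := by gcongr
      _ = 1 / t * t ^ 2 * ((1 + t * ‖x‖) ^ 3)⁻¹ := by field_simp

/-! ### Kernel bounds -/

/-- Inverse Fourier transform of a function at frequency scale `t`, in terms of its rescaling. -/
lemma fourierInv_scale {t : ℝ} (ht : 0 < t) (s : Plane → ℂ) (x : Plane) :
    𝓕⁻ s x = (t ^ 2 : ℝ) • 𝓕 (fun ξ => s (t • ξ)) (-(t • x)) := by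
  have h := Measure.integral_comp_smul (volume : Measure Plane)
    (fun ξ => Real.fourierChar (inner ℝ ξ x) • s ξ) t
  rw [finrank_plane, abs_of_pos (by positivity)] at h
  rw [Real.fourierInv_eq, Real.fourier_eq]
  have e : ∀ ξ : Plane, -inner ℝ ξ (-(t • x)) = inner ℝ (t • ξ) x := by
    intro ξ; rw [inner_neg_right, neg_neg, real_inner_smul_left, real_inner_smul_right]
  simp_rw [e]
  rw [h, smul_smul, mul_inv_cancel₀ (by positivity), one_smul]

lemma one_add_pow_four_le {w : ℝ} : (1 + w) ^ 4 ≤ 8 * (1 + w ^ 4) := by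
  nlinarith [sq_nonneg (w - 1), sq_nonneg (w ^ 2 - 1), sq_nonneg (w * (w - 1)),
    sq_nonneg (w ^ 2 - w), sq_nonneg (w^2 - 2 * w + 1)]

/-- Derivatives of a function supported in the ball of radius `4` have controlled moments. -/
lemma integral_pow_mul_iteratedFDeriv_le (s : 𝓢(Plane, ℂ)) {c : ℝ}
    (hs : ∀ k ≤ 4, ∀ ξ, ‖iteratedFDeriv ℝ k s ξ‖ ≤ c) (hsupp : ∀ ξ, s ξ ≠ 0 → ‖ξ‖ ≤ 4)
    {p q : ℕ} (hp : p ≤ 1) (hq : q ≤ 4) :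
    ∫ v, ‖v‖ ^ p * ‖iteratedFDeriv ℝ q s v‖ ≤
      4 * c * (volume (Metric.closedBall (0 : Plane) 4)).toReal := by
  have hts : tsupport s ⊆ Metric.closedBall (0 : Plane) 4 :=
    closure_minimal (fun ξ hξ => by simpa using hsupp ξ hξ) Metric.isClosed_closedBall
  have hzero : ∀ v, v ∉ Metric.closedBall (0 : Plane) 4 →
      ‖v‖ ^ p * ‖iteratedFDeriv ℝ q s v‖ = 0 := by
    intro v hv
    have : iteratedFDeriv ℝ q s v = 0 := by
      by_contra hne
      exact hv (hts (support_iteratedFDeriv_subset q hne))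
    rw [this, norm_zero, mul_zero]
  rw [← setIntegral_eq_integral_of_forall_compl_eq_zero hzero]
  have hfin : volume (Metric.closedBall (0 : Plane) 4) < (⊤ : ℝ≥0∞) := measure_closedBall_lt_top
  refine (Real.le_norm_self _).trans
    (norm_setIntegral_le_of_norm_le_const (C := 4 * c) hfin fun v hv => ?_)
  have hv4 : ‖v‖ ≤ 4 := by simpa using hv
  rw [norm_mul, norm_pow, norm_norm, norm_norm]
  have h1 : ‖v‖ ^ p ≤ 4 := by
    interval_cases p
    · simp
    · simpa using hv4
  exact mul_le_mul h1 (hs q hq v) (norm_nonneg _) (by norm_num)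

/-- Four integrations by parts at unit scale. The case `k = 1` gives the gradient of the kernel, at
the cost of a factor |v| that is bounded on the support. -/
lemma exists_fourier_decay : ∃ C : ℝ, 0 < C ∧ ∀ (s : 𝓢(Plane, ℂ)) (c : ℝ),
    (∀ k ≤ 4, ∀ ξ, ‖iteratedFDeriv ℝ k s ξ‖ ≤ c) → (∀ ξ, s ξ ≠ 0 → ‖ξ‖ ≤ 4) →
    ∀ k ≤ 1, ∀ w, ‖iteratedFDeriv ℝ k (𝓕 (s : Plane → ℂ)) w‖ ≤
      C * c * ((1 + ‖w‖) ^ 4)⁻¹ := by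
  set V := (volume (Metric.closedBall (0 : Plane) 4)).toReal with hV
  have hV0 : 0 ≤ V := ENNReal.toReal_nonneg
  -- The factors 2π and 4⁴ bound (2π)^k and (2k+2)^n, 10 bounds the number of terms (k+1)(n+1), and
  -- 4(V+1) bounds each moment. The outer 16 is 8 from `one_add_pow_four_le` times 2 for adding the
  -- cases n = 0 and n = 4.
  refine ⟨16 * ((2 * Real.pi) * 4 ^ 4 * (10 * (4 * (V + 1)))), by positivity,
    fun s c hs hsupp k hk w => ?_⟩
  have hc : 0 ≤ c := (norm_nonneg _).trans (hs 0 (by norm_num) 0)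
  have hint : ∀ (k n : ℕ), ((k : ℕ∞)) ≤ ⊤ → ((n : ℕ∞)) ≤ ⊤ →
      Integrable (fun v => ‖v‖ ^ k * ‖iteratedFDeriv ℝ n s v‖) := fun k n _ _ =>
    s.integrable_pow_mul_iteratedFDeriv volume k n
  have hbd : ∀ n ≤ 4, ‖w‖ ^ n * ‖iteratedFDeriv ℝ k (𝓕 (s : Plane → ℂ)) w‖ ≤
      ((2 * Real.pi) * 4 ^ 4 * (10 * (4 * (V + 1)))) * c := by
    intro n hn
    have h := Real.pow_mul_norm_iteratedFDeriv_fourier_le (f := (s : Plane → ℂ)) (K := ⊤) (N := ⊤)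
      (s.smooth ⊤) hint (k := k) (n := n) le_top le_top w
    refine h.trans ?_
    have hsum : ∑ p ∈ Finset.range (k + 1) ×ˢ Finset.range (n + 1),
        ∫ v, ‖v‖ ^ p.1 * ‖iteratedFDeriv ℝ p.2 s v‖ ≤ 10 * (4 * c * V) := by
      refine (Finset.sum_le_card_nsmul _ _ (4 * c * V) fun p hp => ?_).trans ?_
      · rw [Finset.mem_product, Finset.mem_range, Finset.mem_range] at hp
        exact integral_pow_mul_iteratedFDeriv_le s hs hsupp (by omega) (by omega)
      · rw [Finset.card_product, Finset.card_range, Finset.card_range, nsmul_eq_mul]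
        have : ((k + 1) * (n + 1) : ℕ) ≤ 10 := by nlinarith
        gcongr
        exact_mod_cast this
    have hk1 : (2 * Real.pi) ^ k ≤ 2 * Real.pi := by
      interval_cases k
      · simpa using by linarith [Real.pi_gt_three]
      · simp
    have hn1 : (2 * (k : ℝ) + 2) ^ n ≤ 4 ^ 4 := by
      have : (2 * (k : ℝ) + 2) ≤ 4 := by
        have : (k : ℝ) ≤ 1 := by exact_mod_cast hk
        linarith
      calc (2 * (k : ℝ) + 2) ^ n ≤ 4 ^ n := by gcongr
        _ ≤ 4 ^ 4 := pow_le_pow_right₀ (by norm_num) hn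
    calc _ ≤ (2 * Real.pi) * 4 ^ 4 * (10 * (4 * c * V)) := by
          gcongr
      _ ≤ (2 * Real.pi) * 4 ^ 4 * (10 * (4 * c * (V + 1))) := by gcongr; linarith
      _ = _ := by ring
  have h0 := hbd 0 (by norm_num)
  have h4 := hbd 4 le_rfl
  rw [pow_zero, one_mul] at h0
  rw [← div_eq_mul_inv, le_div_iff₀ (by positivity)]
  calc _ ≤ ‖iteratedFDeriv ℝ k (𝓕 (s : Plane → ℂ)) w‖ * (8 * (1 + ‖w‖ ^ 4)) := by
        gcongr; exact one_add_pow_four_le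
    _ = 8 * (‖iteratedFDeriv ℝ k (𝓕 (s : Plane → ℂ)) w‖ +
        ‖w‖ ^ 4 * ‖iteratedFDeriv ℝ k (𝓕 (s : Plane → ℂ)) w‖) := by ring
    _ ≤ _ := by linarith

/-- `s` is a symbol at frequency scale `t`, with constant `c`. -/
structure SymbolAtScale (t c : ℝ) (s : 𝓢(Plane, ℂ)) : Prop where
  deriv_le : ∀ k ≤ 4, ∀ ξ, ‖iteratedFDeriv ℝ k s ξ‖ ≤ c * (t ^ k)⁻¹
  support : ∀ ξ, s ξ ≠ 0 → ‖ξ‖ ≤ 4 * t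

/-- Replacing s(ξ) by s(tξ) reduces to unit scale with the same constant `c`. Undoing the dilation
gives t² for the kernel and one more t for its gradient. -/
lemma exists_kernel_decay : ∃ C : ℝ, 0 < C ∧ ∀ (t c : ℝ) (s : 𝓢(Plane, ℂ)), 0 < t →
    SymbolAtScale t c s →
    (∀ x, ‖(𝓕⁻ s : 𝓢(Plane, ℂ)) x‖ ≤ C * c * kernelProfile t x) ∧
    (∀ x, ‖fderiv ℝ (𝓕⁻ s : 𝓢(Plane, ℂ)) x‖ ≤ C * c * t * kernelProfile t x) := by
  obtain ⟨C, hC, H⟩ := exists_fourier_decay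
  refine ⟨C, hC, fun t c s ht hs => ?_⟩
  set st : 𝓢(Plane, ℂ) := SchwartzMap.compCLMOfContinuousLinearEquiv ℂ
    (ContinuousLinearEquiv.smulLeft (R₁ := ℝ) (M₁ := Plane) (Units.mk0 t ht.ne')) s with hst
  have hst' : ∀ ξ, st ξ = s (t • ξ) := fun ξ => rfl
  have hstf : (st : Plane → ℂ) = fun ξ => s (t • ξ) := rfl
  have H1 := H st c (fun k hk ξ => by
      rw [hstf, iteratedFDeriv_comp_const_smul t ((s.smooth ⊤).of_le (mod_cast le_top)), norm_smul,
        norm_pow, Real.norm_of_nonneg ht.le]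
      calc _ ≤ t ^ k * (c * (t ^ k)⁻¹) := by gcongr; exact hs.deriv_le k hk _
        _ = c := by field_simp)
    (fun ξ hξ => by
      have := hs.support (t • ξ) hξ
      rw [norm_smul, Real.norm_of_nonneg ht.le, mul_comm] at this
      exact le_of_mul_le_mul_right this ht)
  have hK : ((𝓕⁻ s : 𝓢(Plane, ℂ)) : Plane → ℂ) =
      fun x => (t ^ 2 : ℝ) • 𝓕 (st : Plane → ℂ) ((-t) • x) := by
    funext x
    rw [SchwartzMap.fourierInv_coe, fourierInv_scale ht, hstf, neg_smul]
  have hnorm : ∀ x : Plane, ‖(-t) • x‖ = t * ‖x‖ := fun x => by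
    rw [norm_smul, norm_neg, Real.norm_of_nonneg ht.le]
  constructor
  · intro x
    have h0 := H1 0 (by norm_num) ((-t) • x)
    rw [norm_iteratedFDeriv_zero, hnorm] at h0
    rw [hK, norm_smul, Real.norm_of_nonneg (by positivity), kernelProfile]
    calc _ ≤ t ^ 2 * (C * c * ((1 + t * ‖x‖) ^ 4)⁻¹) := by gcongr
      _ = _ := by ring
  · intro x
    have h1 := H1 1 le_rfl ((-t) • x)
    rw [norm_iteratedFDeriv_one, hnorm] at h1
    have hd : DifferentiableAt ℝ (𝓕 (st : Plane → ℂ)) ((-t) • x) := by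
      rw [← SchwartzMap.fourier_coe]
      exact (𝓕 st : 𝓢(Plane, ℂ)).differentiableAt
    have hd' : DifferentiableAt ℝ (fun y : Plane => 𝓕 (st : Plane → ℂ) ((-t) • y)) x :=
      hd.comp x (f := fun y : Plane => (-t) • y) (differentiableAt_id.const_smul (-t))
    rw [hK, fderiv_fun_const_smul hd', fderiv_comp_smul, smul_smul, norm_smul,
      Real.norm_eq_abs, abs_mul, abs_neg, abs_of_pos ht, abs_of_pos (by positivity), kernelProfile]
    calc _ ≤ t ^ 2 * t * (C * c * ((1 + t * ‖x‖) ^ 4)⁻¹) := by gcongr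
      _ = _ := by ring

/-- Integral bounds for the kernel of a symbol at a given frequency scale. -/
structure KernelBounds (t B : ℝ) (K : Plane → ℂ) : Prop where
  l1 : ∫⁻ x, ‖K x‖ₑ ≤ ENNReal.ofReal B
  moment : ∫⁻ x, ‖x‖ₑ * ‖K x‖ₑ ≤ ENNReal.ofReal (B / t)
  l2 : ∫⁻ x, ‖K x‖ₑ ^ 2 ≤ ENNReal.ofReal ((B * t) ^ 2)
  shift : ∀ y, ∫⁻ x, ‖K (x - y) - K x‖ₑ ≤ ENNReal.ofReal (B * t * ‖y‖)
  shift_l2 : ∀ y, ∫⁻ x, ‖K (x - y) - K x‖ₑ ^ 2 ≤ ENNReal.ofReal ((B * t ^ 2 * ‖y‖) ^ 2)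

/-- The `L²` bounds follow by multiplying a supremum bound with an `L¹` bound; the supremum of a
shift difference comes from the gradient bound. -/
lemma kernelBounds_of_decay {C₀ : ℝ} (hC₀ : 0 < C₀) (H₀ : ∀ t : ℝ, 0 < t →
    ∫⁻ x, ENNReal.ofReal (kernelProfile t x) ≤ ENNReal.ofReal C₀ ∧
    ∫⁻ x, ‖x‖ₑ * ENNReal.ofReal (kernelProfile t x) ≤ ENNReal.ofReal (C₀ / t))
    {t D : ℝ} (ht : 0 < t) (hD : 0 ≤ D) (K : 𝓢(Plane, ℂ))
    (h1 : ∀ x, ‖K x‖ ≤ D * kernelProfile t x)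
    (h2 : ∀ x, ‖fderiv ℝ K x‖ ≤ D * t * kernelProfile t x) :
    KernelBounds t (16 * (1 + C₀) * D) K := by
  obtain ⟨H1, H2⟩ := H₀ t ht
  have hprof := continuous_kernelProfile ht
  have hDm : ∀ B : ℝ, 0 ≤ B → ∫⁻ x, ENNReal.ofReal (B * kernelProfile t x) ≤
      ENNReal.ofReal (B * C₀) := by
    intro B hB
    simp_rw [ENNReal.ofReal_mul hB]
    rw [lintegral_const_mul' _ _ ENNReal.ofReal_ne_top]
    gcongr
  have hL1 : ∫⁻ x, ‖K x‖ₑ ≤ ENNReal.ofReal (D * C₀) := by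
    refine (lintegral_mono fun x => ?_).trans (hDm D hD)
    rw [← ofReal_norm]
    exact ENNReal.ofReal_le_ofReal (h1 x)
  have hsup : ∀ x, ‖K x‖ ≤ D * t ^ 2 := fun x =>
    (h1 x).trans (by gcongr; exact kernelProfile_le ht x)
  have hlip : ∀ x y, ‖K (x - y) - K x‖ ≤ D * t ^ 3 * ‖y‖ := by
    intro x y
    have := Convex.norm_image_sub_le_of_norm_fderiv_le (𝕜 := ℝ) (f := K) (s := Set.univ)
      (C := D * t ^ 3) (fun x _ => K.differentiableAt)
      (fun x _ => (h2 x).trans (by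
        calc _ ≤ D * t * t ^ 2 := by gcongr; exact kernelProfile_le ht x
          _ = _ := by ring)) convex_univ (Set.mem_univ x) (Set.mem_univ (x - y))
    simpa using this
  have hshift : ∀ y, ∫⁻ x, ‖K (x - y) - K x‖ₑ ≤ ENNReal.ofReal (16 * C₀ * D * t * ‖y‖) := by
    intro y
    -- A shift shorter than the wavelength changes the profile along the segment by at most 2⁴, and
    -- the mean value inequality applies. For a longer shift t|y| ≥ 1, so the triangle inequality is
    -- enough.
    rcases le_total (t * ‖y‖) 1 with hty | hty
    · have hpt : ∀ x, ‖K (x - y) - K x‖ ≤ (16 * D * t * ‖y‖) * kernelProfile t x := by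
        intro x
        have hb : ∀ z ∈ segment ℝ x (x - y), ‖fderiv ℝ K z‖ ≤
            D * t * (16 * kernelProfile t x) := by
          intro z hz
          refine (h2 z).trans ?_
          have hzx : ‖x‖ ≤ ‖z‖ + ‖y‖ := by
            have : dist x z ≤ ‖y‖ := by
              obtain ⟨a, b, ha, hb, hab, rfl⟩ := hz
              have e : x - (a • x + b • (x - y)) = b • y := by
                rw [← eq_sub_iff_add_eq] at hab
                rw [hab]; module
              rw [dist_eq_norm, e, norm_smul, Real.norm_of_nonneg hb]
              exact mul_le_of_le_one_left (norm_nonneg _) (by linarith)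
            calc ‖x‖ = ‖z + (x - z)‖ := by congr 1; abel
              _ ≤ ‖z‖ + ‖x - z‖ := norm_add_le _ _
              _ ≤ ‖z‖ + ‖y‖ := by rw [← dist_eq_norm]; linarith
          have h5 : 1 + t * ‖x‖ ≤ 2 * (1 + t * ‖z‖) := by
            have : t * ‖x‖ ≤ t * ‖z‖ + t * ‖y‖ := by rw [← mul_add]; gcongr
            have : 0 ≤ t * ‖z‖ := by positivity
            linarith
          have h6 : kernelProfile t z ≤ 16 * kernelProfile t x := by
            rw [kernelProfile, kernelProfile]
            have h7 : ((1 + t * ‖z‖) ^ 4)⁻¹ ≤ 16 * ((1 + t * ‖x‖) ^ 4)⁻¹ := by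
              rw [← div_eq_mul_inv, inv_eq_one_div, div_le_div_iff₀ (by positivity) (by positivity)]
              calc 1 * (1 + t * ‖x‖) ^ 4 ≤ (2 * (1 + t * ‖z‖)) ^ 4 := by rw [one_mul]; gcongr
                _ = _ := by ring
            calc _ ≤ t ^ 2 * (16 * ((1 + t * ‖x‖) ^ 4)⁻¹) := by gcongr
              _ = _ := by ring
          gcongr
        have := Convex.norm_image_sub_le_of_norm_fderiv_le (𝕜 := ℝ) (f := K)
          (fun x _ => K.differentiableAt) hb (convex_segment _ _) (left_mem_segment ℝ _ _)
          (right_mem_segment ℝ _ _)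
        refine this.trans_eq ?_
        rw [sub_sub_cancel_left, norm_neg]; ring
      refine (lintegral_mono fun x => ?_).trans ((hDm (16 * D * t * ‖y‖) (by positivity)).trans_eq
        (by congr 1; ring))
      rw [← ofReal_norm]
      exact ENNReal.ofReal_le_ofReal (hpt x)
    · calc ∫⁻ x, ‖K (x - y) - K x‖ₑ ≤ ∫⁻ x, (‖K (x - y)‖ₑ + ‖K x‖ₑ) :=
            lintegral_mono fun x => enorm_sub_le
        _ = (∫⁻ x, ‖K x‖ₑ) + ∫⁻ x, ‖K x‖ₑ := by
            rw [lintegral_add_right _ (measurable_enorm_schwartz K),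
              lintegral_sub_const (fun x => ‖K x‖ₑ)]
        _ ≤ ENNReal.ofReal (D * C₀) + ENNReal.ofReal (D * C₀) := by gcongr
        _ = ENNReal.ofReal (2 * (D * C₀)) := by
            rw [← ENNReal.ofReal_add (by positivity) (by positivity)]; congr 1; ring
        _ ≤ _ := by
            refine ENNReal.ofReal_le_ofReal ?_
            have : 0 ≤ C₀ * D := by positivity
            nlinarith
  refine ⟨hL1.trans (ENNReal.ofReal_le_ofReal ?_), ?_, ?_, fun y => (hshift y).trans
    (ENNReal.ofReal_le_ofReal ?_), fun y => ?_⟩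
  · nlinarith [mul_nonneg hD hC₀.le]
  · calc ∫⁻ x, ‖x‖ₑ * ‖K x‖ₑ ≤
          ∫⁻ x, ENNReal.ofReal D * (‖x‖ₑ * ENNReal.ofReal (kernelProfile t x)) := by
          refine lintegral_mono fun x => ?_
          rw [mul_left_comm, ← ENNReal.ofReal_mul hD, ← ofReal_norm (K x)]
          gcongr
          exact h1 x
      _ ≤ ENNReal.ofReal D * ENNReal.ofReal (C₀ / t) := by
          rw [lintegral_const_mul' _ _ ENNReal.ofReal_ne_top]
          gcongr
      _ ≤ _ := by
          rw [← ENNReal.ofReal_mul hD]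
          refine ENNReal.ofReal_le_ofReal ?_
          rw [← mul_div_assoc]
          refine div_le_div_of_nonneg_right ?_ ht.le
          nlinarith [mul_nonneg hD hC₀.le]
  · calc ∫⁻ x, ‖K x‖ₑ ^ 2 ≤ ∫⁻ x, ENNReal.ofReal (D * t ^ 2) * ‖K x‖ₑ := by
          refine lintegral_mono fun x => ?_
          rw [sq]
          gcongr
          rw [← ofReal_norm]
          exact ENNReal.ofReal_le_ofReal (hsup x)
      _ ≤ ENNReal.ofReal (D * t ^ 2) * ENNReal.ofReal (D * C₀) := by
          rw [lintegral_const_mul' _ _ ENNReal.ofReal_ne_top]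
          gcongr
      _ ≤ _ := by
          rw [← ENNReal.ofReal_mul (by positivity)]
          refine ENNReal.ofReal_le_ofReal ?_
          have h3 : C₀ ≤ (16 * (1 + C₀)) ^ 2 := by nlinarith
          calc D * t ^ 2 * (D * C₀) = (D * t) ^ 2 * C₀ := by ring
            _ ≤ (D * t) ^ 2 * (16 * (1 + C₀)) ^ 2 := by gcongr
            _ = _ := by ring
  · have : 0 ≤ D * t * ‖y‖ := by positivity
    nlinarith
  · calc ∫⁻ x, ‖K (x - y) - K x‖ₑ ^ 2 ≤
          ∫⁻ x, ENNReal.ofReal (D * t ^ 3 * ‖y‖) * ‖K (x - y) - K x‖ₑ := by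
          refine lintegral_mono fun x => ?_
          rw [sq]
          gcongr
          rw [← ofReal_norm]
          exact ENNReal.ofReal_le_ofReal (hlip x y)
      _ ≤ ENNReal.ofReal (D * t ^ 3 * ‖y‖) * ENNReal.ofReal (16 * C₀ * D * t * ‖y‖) := by
          rw [lintegral_const_mul' _ _ ENNReal.ofReal_ne_top]
          gcongr
          exact hshift y
      _ ≤ _ := by
          rw [← ENNReal.ofReal_mul (by positivity)]
          refine ENNReal.ofReal_le_ofReal ?_
          have h3 : 16 * C₀ ≤ (16 * (1 + C₀)) ^ 2 := by nlinarith
          calc _ = (D * t ^ 2 * ‖y‖) ^ 2 * (16 * C₀) := by ring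
            _ ≤ (D * t ^ 2 * ‖y‖) ^ 2 * (16 * (1 + C₀)) ^ 2 := by gcongr
            _ = _ := by ring

theorem exists_kernelBounds : ∃ C : ℝ, 0 < C ∧ ∀ (t c : ℝ) (s : 𝓢(Plane, ℂ)), 0 < t →
    SymbolAtScale t c s → KernelBounds t (C * c) (𝓕⁻ s : 𝓢(Plane, ℂ)) := by
  obtain ⟨C₀, hC₀, H₀⟩ := exists_lintegral_kernelProfile_le
  obtain ⟨C, hC, H⟩ := exists_kernel_decay
  refine ⟨16 * (1 + C₀) * C, by positivity, fun t c s ht hs => ?_⟩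
  have hc : 0 ≤ c := by
    have := (norm_nonneg _).trans (hs.deriv_le 0 (by norm_num) 0)
    simpa using this
  obtain ⟨h1, h2⟩ := H t c s ht hs
  rw [mul_assoc]
  exact kernelBounds_of_decay hC₀ H₀ ht (by positivity) _ h1 h2

/-! ### Symbols of order zero -/

/-- Symbols of order zero, with four controlled derivatives measured in operator norm. -/
structure OrderZeroSymbol (c : ℝ) (m : Plane → ℂ) : Prop where
  smooth : ContDiff ℝ ∞ m
  deriv_le : ∀ k ≤ 4, ∀ ξ, ‖iteratedFDeriv ℝ k m ξ‖ ≤ c * ((1 + ‖ξ‖) ^ k)⁻¹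

lemma OrderZeroSymbol.norm_le {c : ℝ} {m : Plane → ℂ} (hm : OrderZeroSymbol c m) (ξ : Plane) :
    ‖m ξ‖ ≤ c := by
  have := hm.deriv_le 0 (by norm_num) ξ
  simpa using this

lemma OrderZeroSymbol.nonneg {c : ℝ} {m : Plane → ℂ} (hm : OrderZeroSymbol c m) : 0 ≤ c :=
  (norm_nonneg _).trans (hm.norm_le 0)

lemma OrderZeroSymbol.measurable {c : ℝ} {m : Plane → ℂ} (hm : OrderZeroSymbol c m) :
    AEStronglyMeasurable m volume := hm.smooth.continuous.aestronglyMeasurable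

lemma OrderZeroSymbol.memLp_top {c : ℝ} {m : Plane → ℂ} (hm : OrderZeroSymbol c m) :
    MemLp m ∞ (volume : Measure Plane) := memLp_top_of_le hm.measurable hm.norm_le

/-- Expanding every argument in the standard basis gives 2^k terms. This turns bounds on partial
derivatives into operator norm bounds. -/
lemma norm_multilinear_le_of_basis {k : ℕ}
    (T : ContinuousMultilinearMap ℝ (fun _ : Fin k => Plane) ℂ) {B : ℝ} (hB : 0 ≤ B)
    (h : ∀ i : Fin k → Fin 2, ‖T (fun j => EuclideanSpace.single (i j) (1 : ℝ))‖ ≤ B) :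
    ‖T‖ ≤ 2 ^ k * B := by
  refine ContinuousMultilinearMap.opNorm_le_bound (by positivity) fun v => ?_
  have hv : v = fun j => ∑ i : Fin 2, v j i • EuclideanSpace.single i (1 : ℝ) := by
    funext j
    ext l
    simp [Fin.sum_univ_two]
    fin_cases l <;> simp
  rw [hv, ContinuousMultilinearMap.map_sum, ← hv]
  refine (norm_sum_le _ _).trans ?_
  have hterm : ∀ r : Fin k → Fin 2,
      ‖T fun j => v j (r j) • EuclideanSpace.single (r j) (1 : ℝ)‖ ≤ B * ∏ j, ‖v j‖ := by
    intro r
    rw [T.map_smul_univ, norm_smul, norm_prod, mul_comm]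
    refine mul_le_mul (h r) (Finset.prod_le_prod (fun _ _ => norm_nonneg _) fun j _ => ?_)
      (Finset.prod_nonneg fun _ _ => norm_nonneg _) hB
    exact PiLp.norm_apply_le (v j) (r j)
  refine (Finset.sum_le_card_nsmul _ _ _ fun r _ => hterm r).trans_eq ?_
  rw [Finset.card_univ, Fintype.card_fun, Fintype.card_fin, Fintype.card_fin, nsmul_eq_mul,
    mul_assoc]
  push_cast
  ring

lemma OrderZeroSymbol.of_isCZSymbol {c : ℝ} {m : Plane → ℂ} (hc : 0 ≤ c) (hm : IsCZSymbol c m) :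
    OrderZeroSymbol (16 * c) m := by
  refine ⟨hm.1, fun k hk ξ => ?_⟩
  refine (norm_multilinear_le_of_basis _ (by positivity)
    fun i => hm.2 k (by omega) i ξ).trans ?_
  rw [← mul_assoc]
  gcongr
  calc (2 : ℝ) ^ k ≤ 2 ^ 4 := pow_le_pow_right₀ (by norm_num) hk
    _ = 16 := by norm_num

/-- Leibniz: the binomial coefficients add up to 2^k, at most 16 for the four derivatives in
question. -/
lemma OrderZeroSymbol.mul {c d : ℝ} {m n : Plane → ℂ} (hm : OrderZeroSymbol c m)
    (hn : OrderZeroSymbol d n) : OrderZeroSymbol (16 * c * d) (fun ξ => m ξ * n ξ) := by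
  refine ⟨hm.smooth.mul hn.smooth, fun k hk ξ => ?_⟩
  refine (norm_iteratedFDeriv_mul_le hm.smooth hn.smooth ξ (mod_cast le_top)).trans ?_
  have hc := hm.nonneg
  have hd := hn.nonneg
  have hterm : ∀ i ∈ Finset.range (k + 1), (k.choose i : ℝ) * ‖iteratedFDeriv ℝ i m ξ‖ *
      ‖iteratedFDeriv ℝ (k - i) n ξ‖ ≤ (k.choose i : ℝ) * (c * d * ((1 + ‖ξ‖) ^ k)⁻¹) := by
    intro i hi
    have hik : i ≤ k := by simpa [Nat.lt_succ_iff] using hi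
    calc _ ≤ (k.choose i : ℝ) * (c * ((1 + ‖ξ‖) ^ i)⁻¹) * (d * ((1 + ‖ξ‖) ^ (k - i))⁻¹) := by
          gcongr
          · exact hm.deriv_le i (by omega) ξ
          · exact hn.deriv_le (k - i) (by omega) ξ
      _ = (k.choose i : ℝ) * (c * d * (((1 + ‖ξ‖) ^ i) * ((1 + ‖ξ‖) ^ (k - i)))⁻¹) := by
          rw [mul_inv]; ring
      _ = _ := by rw [← pow_add, Nat.add_sub_cancel' hik]
  refine (Finset.sum_le_sum hterm).trans ?_
  rw [← Finset.sum_mul]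
  have hs : ∑ i ∈ Finset.range (k + 1), (k.choose i : ℝ) = 2 ^ k := by
    exact_mod_cast Nat.sum_range_choose k
  have h16 : (2 : ℝ) ^ k ≤ 16 := by
    calc (2 : ℝ) ^ k ≤ 2 ^ 4 := pow_le_pow_right₀ (by norm_num) hk
      _ = 16 := by norm_num
  rw [hs, mul_assoc 16 c d, mul_assoc 16 (c * d)]
  gcongr

lemma OrderZeroSymbol.sub {c d : ℝ} {m n : Plane → ℂ} (hm : OrderZeroSymbol c m)
    (hn : OrderZeroSymbol d n) : OrderZeroSymbol (c + d) (fun ξ => m ξ - n ξ) := by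
  refine ⟨hm.smooth.sub hn.smooth, fun k hk ξ => ?_⟩
  have e : iteratedFDeriv ℝ k (fun ξ => m ξ - n ξ) ξ =
      iteratedFDeriv ℝ k m ξ - iteratedFDeriv ℝ k n ξ :=
    iteratedFDeriv_sub_apply (hm.smooth.of_le (mod_cast le_top)).contDiffAt
      (hn.smooth.of_le (mod_cast le_top)).contDiffAt
  rw [e, add_mul]
  exact (norm_sub_le _ _).trans (add_le_add (hm.deriv_le k hk ξ) (hn.deriv_le k hk ξ))

lemma OrderZeroSymbol.mono {c d : ℝ} {m : Plane → ℂ} (hm : OrderZeroSymbol c m) (h : c ≤ d) :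
    OrderZeroSymbol d m :=
  ⟨hm.smooth, fun k hk ξ => (hm.deriv_le k hk ξ).trans (by gcongr)⟩

/-! ### Frequency cut-offs -/

/-- A smooth bump function equal to `1` on the unit ball and supported in the ball of radius `2`. -/
noncomputable def freqBump : ContDiffBump (0 : Plane) := ⟨1, 2, by norm_num, by norm_num⟩

/-- The symbol of the projection to frequencies of size at most about `2 ^ k`. -/
noncomputable def lowSymbol (k : ℕ) (ξ : Plane) : ℂ := (freqBump (((2 : ℝ) ^ k)⁻¹ • ξ) : ℝ)

/-- The symbol of the projection to frequencies of size about `2 ^ k` (at most `1`, if `k = 0`). -/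
noncomputable def bandSymbol : ℕ → Plane → ℂ
  | 0 => lowSymbol 0
  | k + 1 => fun ξ => lowSymbol (k + 1) ξ - lowSymbol k ξ

/-- A cut-off equal to `1` on the support of `bandSymbol k`. -/
noncomputable def fatSymbol : ℕ → Plane → ℂ
  | 0 => lowSymbol 1
  | 1 => lowSymbol 2
  | k + 2 => fun ξ => lowSymbol (k + 3) ξ - lowSymbol k ξ

lemma norm_inv_two_pow_smul (k : ℕ) (ξ : Plane) : ‖((2 : ℝ) ^ k)⁻¹ • ξ‖ = ‖ξ‖ / 2 ^ k := by
  rw [norm_smul, norm_inv, Real.norm_of_nonneg (by positivity), inv_mul_eq_div]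

lemma lowSymbol_eq_one {k : ℕ} {ξ : Plane} (h : ‖ξ‖ ≤ 2 ^ k) : lowSymbol k ξ = 1 := by
  have : ((2 : ℝ) ^ k)⁻¹ • ξ ∈ Metric.closedBall (0 : Plane) freqBump.rIn := by
    rw [mem_closedBall_zero_iff, norm_inv_two_pow_smul]
    exact (div_le_one (by positivity)).2 h
  rw [lowSymbol, freqBump.one_of_mem_closedBall this, Complex.ofReal_one]

lemma lowSymbol_eq_zero {k : ℕ} {ξ : Plane} (h : 2 ^ (k + 1) ≤ ‖ξ‖) : lowSymbol k ξ = 0 := by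
  have : freqBump.rOut ≤ dist (((2 : ℝ) ^ k)⁻¹ • ξ) 0 := by
    rw [dist_zero_right, norm_inv_two_pow_smul, le_div_iff₀ (by positivity)]
    calc (2 : ℝ) * 2 ^ k = 2 ^ (k + 1) := by ring
      _ ≤ _ := h
  rw [lowSymbol, freqBump.zero_of_le_dist this, Complex.ofReal_zero]

lemma norm_lowSymbol_le (k : ℕ) (ξ : Plane) : ‖lowSymbol k ξ‖ ≤ 1 := by
  rw [lowSymbol, Complex.norm_real, Real.norm_of_nonneg freqBump.nonneg]
  exact freqBump.le_one

lemma contDiff_ofReal_comp {f : Plane → ℝ} (hf : ContDiff ℝ ∞ f) :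
    ContDiff ℝ ∞ (fun x => (f x : ℂ)) :=
  Complex.ofRealCLM.contDiff.comp hf

lemma contDiff_lowSymbol (k : ℕ) : ContDiff ℝ ∞ (lowSymbol k) :=
  contDiff_ofReal_comp (freqBump.contDiff.comp (contDiff_const_smul _))

lemma exists_iteratedFDeriv_bound {f : Plane → ℂ} (hf : ContDiff ℝ ∞ f)
    (hc : HasCompactSupport f) : ∃ B : ℝ, 0 < B ∧ ∀ k ≤ 4, ∀ ξ, ‖iteratedFDeriv ℝ k f ξ‖ ≤ B := by
  have h : ∀ k : ℕ, ∃ B : ℝ, ∀ ξ, ‖iteratedFDeriv ℝ k f ξ‖ ≤ B := fun k => by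
    have hcont : Continuous (iteratedFDeriv ℝ k f) :=
      (hf.of_le (mod_cast le_top)).continuous_iteratedFDeriv'
    obtain ⟨B, hB⟩ := hcont.bounded_above_of_compact_support (hc.iteratedFDeriv k)
    exact ⟨B, hB⟩
  choose B hB using h
  have hB0 : ∀ k, 0 ≤ B k := fun k => (norm_nonneg _).trans (hB k 0)
  refine ⟨1 + ∑ k ∈ Finset.range 5, B k, ?_, fun k hk ξ => (hB k ξ).trans ?_⟩
  · have := Finset.sum_nonneg fun k (_ : k ∈ Finset.range 5) => hB0 k
    linarith
  · have := Finset.single_le_sum (fun k _ => hB0 k) (Finset.mem_range.2 (by omega : k < 5))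
    linarith

lemma hasCompactSupport_freqBump : HasCompactSupport fun ξ => ((freqBump ξ : ℝ) : ℂ) :=
  freqBump.hasCompactSupport.comp_left (g := fun x : ℝ => (x : ℂ)) Complex.ofReal_zero

lemma hasCompactSupport_of_norm_le {f : Plane → ℂ} {R : ℝ} (h : ∀ ξ, f ξ ≠ 0 → ‖ξ‖ ≤ R) :
    HasCompactSupport f :=
  HasCompactSupport.intro (isCompact_closedBall (0 : Plane) R) fun ξ hξ => by
    by_contra hne
    exact hξ (by simpa using h ξ hne)

/-- Dilates `f(t ξ)`, `t ≤ 1`, of a compactly supported function are uniformly symbols. -/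
lemma norm_iteratedFDeriv_dilate_le {f : Plane → ℂ} (hf : ContDiff ℝ ∞ f) {B : ℝ}
    (hB : ∀ k ≤ 4, ∀ ξ, ‖iteratedFDeriv ℝ k f ξ‖ ≤ B) (t : ℝ) (ht : 0 < t) {k : ℕ} (hk : k ≤ 4)
    (ξ : Plane) : ‖iteratedFDeriv ℝ k (fun ξ => f (t⁻¹ • ξ)) ξ‖ ≤ B * (t ^ k)⁻¹ := by
  rw [iteratedFDeriv_comp_const_smul t⁻¹ (hf.of_le (mod_cast le_top)), norm_smul, norm_pow,
    norm_inv, Real.norm_of_nonneg ht.le, mul_comm, inv_pow]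
  gcongr
  exact hB k hk _

lemma iteratedFDeriv_eq_zero_of_support {f : Plane → ℂ} {S : Set Plane} (hS : IsClosed S)
    (h : ∀ ξ, f ξ ≠ 0 → ξ ∈ S) {k : ℕ} {ξ : Plane} (hξ : ξ ∉ S) :
    iteratedFDeriv ℝ k f ξ = 0 := by
  by_contra hne
  exact hξ (closure_minimal h hS (support_iteratedFDeriv_subset k hne))

lemma lowSymbol_ne_zero {k : ℕ} {ξ : Plane} (h : lowSymbol k ξ ≠ 0) : ‖ξ‖ ≤ 2 * 2 ^ k := by
  by_contra hlt
  exact h (lowSymbol_eq_zero (by rw [pow_succ]; linarith))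

/-- On the support 1 + |ξ| ≤ 3·2^k, so the scaling bound 2^{-ki} is also an order zero bound, with
loss at most 3⁴ = 81. -/
lemma exists_lowSymbol_bounds : ∃ B : ℝ, 0 < B ∧ ∀ k, OrderZeroSymbol B (lowSymbol k) ∧
    ∀ i ≤ 4, ∀ ξ, ‖iteratedFDeriv ℝ i (lowSymbol k) ξ‖ ≤ B * (((2 : ℝ) ^ k) ^ i)⁻¹ := by
  obtain ⟨B, hB0, hB⟩ := exists_iteratedFDeriv_bound
    (contDiff_ofReal_comp freqBump.contDiff) hasCompactSupport_freqBump
  have h2 : ∀ k, ∀ i ≤ 4, ∀ ξ, ‖iteratedFDeriv ℝ i (lowSymbol k) ξ‖ ≤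
      B * (((2 : ℝ) ^ k) ^ i)⁻¹ := fun k i hi ξ =>
    norm_iteratedFDeriv_dilate_le (contDiff_ofReal_comp freqBump.contDiff) hB ((2 : ℝ) ^ k)
      (by positivity) hi ξ
  refine ⟨81 * B, by positivity, fun k => ⟨⟨contDiff_lowSymbol k, fun i hi ξ => ?_⟩,
    fun i hi ξ => (h2 k i hi ξ).trans (by gcongr; linarith)⟩⟩
  by_cases hξ : ‖ξ‖ ≤ 2 * 2 ^ k
  · refine (h2 k i hi ξ).trans ?_
    have h1 : (1 : ℝ) ≤ 2 ^ k := one_le_pow₀ (by norm_num)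
    have h3 : (1 + ‖ξ‖) ^ i ≤ 81 * ((2 : ℝ) ^ k) ^ i := by
      calc (1 + ‖ξ‖) ^ i ≤ (3 * 2 ^ k) ^ i := by gcongr; linarith
        _ = 3 ^ i * (2 ^ k) ^ i := mul_pow _ _ _
        _ ≤ 81 * ((2 : ℝ) ^ k) ^ i := by
          gcongr
          calc (3 : ℝ) ^ i ≤ 3 ^ 4 := pow_le_pow_right₀ (by norm_num) hi
            _ = 81 := by norm_num
    rw [mul_comm 81 B, mul_assoc]
    gcongr
    rw [← div_eq_mul_inv, inv_eq_one_div, div_le_div_iff₀ (by positivity) (by positivity)]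
    linarith
  · have : iteratedFDeriv ℝ i (lowSymbol k) ξ = 0 := by
      refine iteratedFDeriv_eq_zero_of_support (S := Metric.closedBall (0 : Plane) (2 * 2 ^ k))
        Metric.isClosed_closedBall (fun ξ h => ?_) (by simpa using hξ)
      simpa using lowSymbol_ne_zero h
    rw [this, norm_zero]
    positivity

lemma lowSymbol_mul_lowSymbol {j k : ℕ} (h : j < k) (ξ : Plane) :
    lowSymbol k ξ * lowSymbol j ξ = lowSymbol j ξ := by
  by_cases hj : lowSymbol j ξ = 0
  · rw [hj, mul_zero]
  · have h1 := lowSymbol_ne_zero hj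
    have h2 : (2 : ℝ) * 2 ^ j ≤ 2 ^ k := by
      rw [← pow_succ']; exact pow_le_pow_right₀ (by norm_num) h
    rw [lowSymbol_eq_one (h1.trans h2), one_mul]

lemma fatSymbol_mul_bandSymbol (k : ℕ) (ξ : Plane) :
    fatSymbol k ξ * bandSymbol k ξ = bandSymbol k ξ := by
  match k with
  | 0 => exact lowSymbol_mul_lowSymbol (by norm_num) ξ
  | 1 =>
    simp only [fatSymbol, bandSymbol]
    rw [mul_sub, lowSymbol_mul_lowSymbol (by norm_num), lowSymbol_mul_lowSymbol (by norm_num)]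
  | k + 2 =>
    simp only [fatSymbol, bandSymbol]
    have h1 := lowSymbol_mul_lowSymbol (show k < k + 2 by omega) ξ
    have h2 := lowSymbol_mul_lowSymbol (show k < k + 1 by omega) ξ
    have h3 := lowSymbol_mul_lowSymbol (show k + 2 < k + 3 by omega) ξ
    have h4 := lowSymbol_mul_lowSymbol (show k + 1 < k + 3 by omega) ξ
    linear_combination h3 - h4 - h1 + h2

/-- A frequency cut-off at scale `2 ^ j`, annular unless `j` is small. -/
def IsBandCutoff (B : ℝ) (j : ℕ) (θ : Plane → ℂ) : Prop :=
  OrderZeroSymbol B θ ∧ ∀ ξ, θ ξ ≠ 0 → ‖ξ‖ ≤ 4 * 2 ^ j ∧ (2 : ℝ) ^ j / 4 ≤ 1 + ‖ξ‖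

lemma exists_isBandCutoff : ∃ B : ℝ, 0 < B ∧
    ∀ j, IsBandCutoff B j (bandSymbol j) ∧ IsBandCutoff B j (fatSymbol j) := by
  obtain ⟨B, hB0, hB⟩ := exists_lowSymbol_bounds
  refine ⟨B + B, by positivity, fun j => ⟨?_, ?_⟩⟩
  · match j with
    | 0 =>
      refine ⟨(hB 0).1.mono (by linarith), fun ξ h => ?_⟩
      have := lowSymbol_ne_zero (k := 0) h
      exact ⟨by linarith, by have := norm_nonneg ξ; norm_num; linarith⟩
    | k + 1 =>
      refine ⟨(hB (k + 1)).1.sub (hB k).1, fun ξ h => ⟨?_, ?_⟩⟩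
      · by_contra hlt
        rw [not_le] at hlt
        have hp : (0 : ℝ) < 2 ^ k := by positivity
        apply h
        simp only [bandSymbol]
        rw [lowSymbol_eq_zero (k := k + 1), lowSymbol_eq_zero (k := k), sub_zero] <;>
          · ring_nf at hlt ⊢; linarith
      · by_contra hlt
        rw [not_le] at hlt
        have hp : (0 : ℝ) < 2 ^ k := by positivity
        apply h
        simp only [bandSymbol]
        rw [lowSymbol_eq_one (k := k + 1), lowSymbol_eq_one (k := k), sub_self] <;>
          · ring_nf at hlt ⊢; linarith
  · match j with
    | 0 =>
      refine ⟨(hB 1).1.mono (by linarith), fun ξ h => ?_⟩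
      have h1 := lowSymbol_ne_zero (k := 1) h
      have h2 := norm_nonneg ξ
      constructor <;> linarith
    | 1 =>
      refine ⟨(hB 2).1.mono (by linarith), fun ξ h => ?_⟩
      have h1 := lowSymbol_ne_zero (k := 2) h
      have h2 := norm_nonneg ξ
      constructor <;> linarith
    | k + 2 =>
      refine ⟨(hB (k + 3)).1.sub (hB k).1, fun ξ h => ⟨?_, ?_⟩⟩
      · by_contra hlt
        rw [not_le] at hlt
        have hp : (0 : ℝ) < 2 ^ k := by positivity
        apply h
        simp only [fatSymbol]
        rw [lowSymbol_eq_zero (k := k + 3), lowSymbol_eq_zero (k := k), sub_zero] <;>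
          · ring_nf at hlt ⊢; linarith
      · by_contra hlt
        rw [not_le] at hlt
        have hp : (0 : ℝ) < 2 ^ k := by positivity
        apply h
        simp only [fatSymbol]
        rw [lowSymbol_eq_one (k := k + 3), lowSymbol_eq_one (k := k), sub_self] <;>
          · ring_nf at hlt ⊢; linarith

/-- The product of a symbol of order zero with a cut-off at scale `2 ^ j`. -/
lemma exists_symbolAtScale {B c : ℝ} {j : ℕ} {m θ : Plane → ℂ}
    (hm : OrderZeroSymbol c m) (hθ : IsBandCutoff B j θ) :
    ∃ s : 𝓢(Plane, ℂ), (s : Plane → ℂ) = (fun ξ => m ξ * θ ξ) ∧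
      SymbolAtScale (2 ^ j) (256 * (16 * c * B)) s := by
  have hp := hm.mul hθ.1
  have hsupp : ∀ ξ, m ξ * θ ξ ≠ 0 → ‖ξ‖ ≤ 4 * 2 ^ j ∧ (2 : ℝ) ^ j / 4 ≤ 1 + ‖ξ‖ := fun ξ h =>
    hθ.2 ξ (right_ne_zero_of_mul h)
  refine ⟨(hasCompactSupport_of_norm_le fun ξ h => (hsupp ξ h).1).toSchwartzMap hp.smooth, rfl,
    ⟨fun k hk ξ => ?_, fun ξ h => (hsupp ξ h).1⟩⟩
  change ‖iteratedFDeriv ℝ k (fun ξ => m ξ * θ ξ) ξ‖ ≤ _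
  have hcB := hp.nonneg
  -- Where 2^j ≤ 4(1 + |ξ|), decay in 1 + |ξ| is decay in 2^j up to 4⁴ = 256. The remaining set is
  -- open and the product vanishes on it, hence so do its derivatives.
  by_cases hξ : (2 : ℝ) ^ j / 4 ≤ 1 + ‖ξ‖
  · refine (hp.deriv_le k hk ξ).trans ?_
    rw [mul_comm 256, mul_assoc (16 * c * B)]
    refine mul_le_mul_of_nonneg_left ?_ hcB
    rw [← div_eq_mul_inv, inv_eq_one_div, div_le_div_iff₀ (by positivity) (by positivity)]
    calc 1 * ((2 : ℝ) ^ j) ^ k = 4 ^ k * (2 ^ j / 4) ^ k := by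
          rw [← mul_pow]; ring_nf
      _ ≤ 256 * (1 + ‖ξ‖) ^ k := by
          gcongr
          calc (4 : ℝ) ^ k ≤ 4 ^ 4 := pow_le_pow_right₀ (by norm_num) hk
            _ = 256 := by norm_num
  · rw [iteratedFDeriv_eq_zero_of_support (S := {ξ | (2 : ℝ) ^ j / 4 ≤ 1 + ‖ξ‖})
      (isClosed_le continuous_const (by fun_prop)) (fun ξ h => (hsupp ξ h).2) hξ, norm_zero]
    positivity

/-- Kernel bounds for a symbol of order zero localized in frequency. -/
theorem exists_localized_kernelBounds : ∃ C : ℝ, 0 < C ∧ ∀ (c : ℝ) (m : Plane → ℂ) (j : ℕ),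
    OrderZeroSymbol c m → ∀ θ, θ = bandSymbol j ∨ θ = fatSymbol j →
    ∃ s : 𝓢(Plane, ℂ), (s : Plane → ℂ) = (fun ξ => m ξ * θ ξ) ∧
      KernelBounds (2 ^ j) (C * c) (𝓕⁻ s : 𝓢(Plane, ℂ)) := by
  obtain ⟨C, hC, H⟩ := exists_kernelBounds
  obtain ⟨B, hB, HB⟩ := exists_isBandCutoff
  refine ⟨C * (256 * (16 * B)), by positivity, fun c m j hm θ hθ => ?_⟩
  have hθ' : IsBandCutoff B j θ := by
    rcases hθ with rfl | rfl
    · exact (HB j).1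
    · exact (HB j).2
  obtain ⟨s, hs1, hs2⟩ := exists_symbolAtScale hm hθ'
  refine ⟨s, hs1, ?_⟩
  have := H _ _ s (by positivity) hs2
  have e : C * (256 * (16 * c * B)) = C * (256 * (16 * B)) * c := by ring
  rwa [e] at this

theorem exists_lowSymbol_kernelBounds : ∃ C : ℝ, 0 < C ∧ ∀ k : ℕ,
    ∃ s : 𝓢(Plane, ℂ), (s : Plane → ℂ) = lowSymbol k ∧
      KernelBounds (2 ^ k) C (𝓕⁻ s : 𝓢(Plane, ℂ)) := by
  obtain ⟨C, hC, H⟩ := exists_kernelBounds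
  obtain ⟨B, hB, HB⟩ := exists_lowSymbol_bounds
  refine ⟨C * B, by positivity, fun k => ?_⟩
  refine ⟨(hasCompactSupport_of_norm_le fun ξ h =>
    lowSymbol_ne_zero h).toSchwartzMap (contDiff_lowSymbol k), rfl, H _ _ _ (by positivity)
    ⟨fun i hi ξ => (HB k).2 i hi ξ, fun ξ h => ?_⟩⟩
  have := lowSymbol_ne_zero (k := k) h
  have hp : (0 : ℝ) < 2 ^ k := by positivity
  linarith

/-! ### Commuting a multiplier with a coefficient -/

lemma norm_le_of_enorm_le {x : L2Plane} {r : ℝ} (hr : 0 ≤ r) (h : ‖x‖ₑ ≤ ENNReal.ofReal r) :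
    ‖x‖ ≤ r := by
  rwa [← ofReal_norm, ENNReal.ofReal_le_ofReal_iff hr] at h

lemma enorm_le_of_norm_le {x : L2Plane} {r : ℝ} (h : ‖x‖ ≤ r) : ‖x‖ₑ ≤ ENNReal.ofReal r := by
  rw [← ofReal_norm]; exact ENNReal.ofReal_le_ofReal h

lemma lintegral_mulOp_le {a : Plane → ℂ} (ha : MemLp a ∞ (volume : Measure Plane)) {β r : ℝ}
    (hβ0 : 0 ≤ β) (hβ : eLpNorm a 2 volume ≤ ENNReal.ofReal β) {h : L2Plane} (hr : ‖h‖ ≤ r) :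
    ∫⁻ x, ‖mulOp a h x‖ₑ ≤ ENNReal.ofReal (β * r) := by
  have e : ∫⁻ x, ‖mulOp a h x‖ₑ = ∫⁻ x, ‖a x * h x‖ₑ :=
    lintegral_congr_ae ((coeFn_mulOp ha h).mono fun x hx => by simp only [hx])
  rw [e, ENNReal.ofReal_mul hβ0]
  refine (lintegral_mul_enorm_le ⟨ha.1, hβ.trans_lt ENNReal.ofReal_lt_top⟩ h).trans ?_
  gcongr
  exact enorm_le_of_norm_le hr

lemma lintegral_mulOp_le' {a : Plane → ℂ} (hm : AEStronglyMeasurable a volume) {α B : ℝ}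
    (hα0 : 0 ≤ α) (hα : ∀ x, ‖a x‖ ≤ α) {h : L2Plane} (hB : ∫⁻ x, ‖h x‖ₑ ≤ ENNReal.ofReal B) :
    ∫⁻ x, ‖mulOp a h x‖ₑ ≤ ENNReal.ofReal (α * B) := by
  rw [ENNReal.ofReal_mul hα0]
  calc _ ≤ ∫⁻ x, ENNReal.ofReal α * ‖h x‖ₑ := by
        refine lintegral_mono_ae ?_
        filter_upwards [coeFn_mulOp (memLp_top_of_le hm hα) h] with x hx
        rw [hx, enorm_mul]
        gcongr
        rw [← ofReal_norm]
        exact ENNReal.ofReal_le_ofReal (hα x)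
    _ ≤ _ := by
        rw [lintegral_const_mul' _ _ ENNReal.ofReal_ne_top]
        gcongr

/-- With this symbol the kernel bounds for localized multipliers specialize to the cut-offs
themselves. -/
lemma orderZeroSymbol_one : OrderZeroSymbol 1 (fun _ => (1 : ℂ)) := by
  refine ⟨contDiff_const, fun k _ ξ => ?_⟩
  match k with
  | 0 => simp
  | k + 1 =>
    rw [iteratedFDeriv_const_of_ne (by omega)]
    simp only [Pi.zero_apply, norm_zero]
    positivity

lemma KernelBounds.lintegral_multOp_le {t D B : ℝ} (hD : 0 ≤ D) {s : 𝓢(Plane, ℂ)}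
    (hs : KernelBounds t D (𝓕⁻ s : 𝓢(Plane, ℂ))) {h : L2Plane}
    (hB : ∫⁻ x, ‖h x‖ₑ ≤ ENNReal.ofReal B) :
    ∫⁻ x, ‖multOp s h x‖ₑ ≤ ENNReal.ofReal (D * B) := by
  refine (L2Plane.lintegral_multOp_le s h).trans ?_
  rw [ENNReal.ofReal_mul hD]
  exact mul_le_mul' hs.l1 hB

lemma KernelBounds.norm_multOp_le {t D B : ℝ} (ht : 0 < t) (hD : 0 ≤ D) (hB0 : 0 ≤ B)
    {s : 𝓢(Plane, ℂ)} (hs : KernelBounds t D (𝓕⁻ s : 𝓢(Plane, ℂ))) {h : L2Plane}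
    (hB : ∫⁻ x, ‖h x‖ₑ ≤ ENNReal.ofReal B) :
    ‖multOp s h‖ ≤ D * t * B := by
  refine norm_le_of_enorm_le (by positivity) ?_
  rw [← ENNReal.pow_le_pow_left_iff two_ne_zero, ← ENNReal.ofReal_pow (by positivity), mul_pow,
    ENNReal.ofReal_mul (by positivity), ENNReal.ofReal_pow hB0]
  refine (enorm_multOp_sq_le s h).trans ?_
  gcongr
  exact hs.l2

/-- The gain D/t is what makes the sum over high frequencies converge when the coefficient
oscillates at a lower frequency. -/
lemma KernelBounds.commutator_l1 {t D B L : ℝ} (ht : 0 < t) (hD : 0 ≤ D) (hL0 : 0 ≤ L)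
    {s : 𝓢(Plane, ℂ)} (hs : KernelBounds t D (𝓕⁻ s : 𝓢(Plane, ℂ))) {a : Plane → ℂ}
    (ha : MemLp a ∞ (volume : Measure Plane))
    (hL : ∀ x y, ‖a x - a y‖ ≤ L * ‖x - y‖) {h : L2Plane}
    (hB : ∫⁻ x, ‖h x‖ₑ ≤ ENNReal.ofReal B) :
    ∫⁻ x, ‖(multOp s (mulOp a h) - mulOp a (multOp s h)) x‖ₑ ≤
      ENNReal.ofReal (L * (D / t) * B) := by
  refine (lintegral_commutator_le s ha hL h).trans ?_
  rw [ENNReal.ofReal_mul (by positivity), ENNReal.ofReal_mul hL0]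
  gcongr
  exact hs.moment

lemma KernelBounds.commutator_norm {t D L : ℝ} (ht : 0 < t) (hD : 0 ≤ D) (hL0 : 0 ≤ L)
    {s : 𝓢(Plane, ℂ)} (hs : KernelBounds t D (𝓕⁻ s : 𝓢(Plane, ℂ))) {a : Plane → ℂ}
    (ha : MemLp a ∞ (volume : Measure Plane))
    (hL : ∀ x y, ‖a x - a y‖ ≤ L * ‖x - y‖) {h : L2Plane} {r : ℝ} (hr0 : 0 ≤ r) (hr : ‖h‖ ≤ r) :
    ‖multOp s (mulOp a h) - mulOp a (multOp s h)‖ ≤ L * (D / t) * r := by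
  refine norm_le_of_enorm_le (by positivity) ?_
  refine (enorm_commutator_apply_le s ha hL h).trans ?_
  rw [ENNReal.ofReal_mul (by positivity), ENNReal.ofReal_mul hL0]
  gcongr
  · exact hs.moment
  · exact enorm_le_of_norm_le hr

lemma lowSymbol_measurable (k : ℕ) : AEStronglyMeasurable (lowSymbol k) volume :=
  (contDiff_lowSymbol k).continuous.aestronglyMeasurable

lemma memLp_lowSymbol (k : ℕ) : MemLp (lowSymbol k) ∞ (volume : Measure Plane) :=
  memLp_top_of_le (lowSymbol_measurable k) (norm_lowSymbol_le k)

lemma contDiff_bandSymbol (k : ℕ) : ContDiff ℝ ∞ (bandSymbol k) :=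
  match k with
  | 0 => contDiff_lowSymbol 0
  | k + 1 => (contDiff_lowSymbol (k + 1)).sub (contDiff_lowSymbol k)

lemma norm_bandSymbol_le (k : ℕ) (ξ : Plane) : ‖bandSymbol k ξ‖ ≤ 2 :=
  match k with
  | 0 => (norm_lowSymbol_le 0 ξ).trans (by norm_num)
  | k + 1 => (norm_sub_le _ _).trans
      (by linarith [norm_lowSymbol_le (k + 1) ξ, norm_lowSymbol_le k ξ])

lemma memLp_bandSymbol (k : ℕ) : MemLp (bandSymbol k) ∞ (volume : Measure Plane) :=
  memLp_top_of_le (contDiff_bandSymbol k).continuous.aestronglyMeasurable (norm_bandSymbol_le k)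

lemma memLp_fatSymbol (k : ℕ) : MemLp (fatSymbol k) ∞ (volume : Measure Plane) :=
  match k with
  | 0 => memLp_lowSymbol 1
  | 1 => memLp_lowSymbol 2
  | k + 2 => (memLp_lowSymbol (k + 3)).sub (memLp_lowSymbol k)

lemma multOp_fat_band (k : ℕ) (h : L2Plane) :
    multOp (fatSymbol k) (multOp (bandSymbol k) h) = multOp (bandSymbol k) h := by
  rw [← multOp_mul (memLp_fatSymbol k) (memLp_bandSymbol k)]
  simp only [fatSymbol_mul_bandSymbol]

lemma multOp_band_succ (k : ℕ) (h : L2Plane) :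
    multOp (bandSymbol (k + 1)) h = multOp (lowSymbol (k + 1)) h - multOp (lowSymbol k) h :=
  multOp_sub (memLp_lowSymbol (k + 1)) (memLp_lowSymbol k) h

lemma sum_band_range (k n : ℕ) (h : L2Plane) :
    ∑ i ∈ Finset.range n, multOp (bandSymbol (k + 1 + i)) h =
      multOp (lowSymbol (k + n)) h - multOp (lowSymbol k) h := by
  induction n with
  | zero => simp
  | succ n ih =>
    rw [Finset.sum_range_succ, ih, show k + 1 + n = k + n + 1 by ring, multOp_band_succ,
      show k + (n + 1) = k + n + 1 by ring]
    abel

lemma tendsto_low (k : ℕ) (h : L2Plane) :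
    Tendsto (fun n => multOp (lowSymbol (k + n)) h) atTop (𝓝 h) := by
  have := tendsto_multOp (c := 1) (a := fun n => lowSymbol (k + n)) (b := fun _ => 1)
    (fun n => lowSymbol_measurable _) (fun n x => norm_lowSymbol_le _ x) (fun x => ?_) h
  · rwa [multOp_one] at this
  · obtain ⟨N, hN⟩ := pow_unbounded_of_one_lt ‖x‖ (one_lt_two : (1 : ℝ) < 2)
    refine tendsto_const_nhds.congr' ?_
    filter_upwards [eventually_ge_atTop N] with n hn
    exact (lowSymbol_eq_one (hN.le.trans (pow_le_pow_right₀ one_le_two (by omega)))).symm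

/-! ### The norm sup_j ‖P_j h‖_{L¹} and commutation with one coefficient piece -/

/-- The Besov-type bound `sup_j ‖P_j h‖_{L¹} ≤ B`. -/
def BandBound (B : ℝ) (h : L2Plane) : Prop :=
  ∀ j, ∫⁻ x, ‖multOp (bandSymbol j) h x‖ₑ ≤ ENNReal.ofReal B

/-- The constant `C` controls the kernels of frequency-localized symbols of order zero. -/
def IsKernelConstant (C : ℝ) : Prop :=
  0 < C ∧ ∀ (c : ℝ) (m : Plane → ℂ) (j : ℕ),
    OrderZeroSymbol c m → ∀ θ, θ = bandSymbol j ∨ θ = fatSymbol j →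
    ∃ s : 𝓢(Plane, ℂ), (s : Plane → ℂ) = (fun ξ => m ξ * θ ξ) ∧
      KernelBounds (2 ^ j) (C * c) (𝓕⁻ s : 𝓢(Plane, ℂ))

lemma IsKernelConstant.fat {C : ℝ} (hC : IsKernelConstant C) (j : ℕ) :
    ∃ s : 𝓢(Plane, ℂ), (s : Plane → ℂ) = fatSymbol j ∧
      KernelBounds (2 ^ j) C (𝓕⁻ s : 𝓢(Plane, ℂ)) := by
  obtain ⟨s, hs1, hs2⟩ := hC.2 1 _ j orderZeroSymbol_one _ (Or.inr rfl)
  refine ⟨s, hs1.trans (by simp), by rwa [mul_one] at hs2⟩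

lemma IsKernelConstant.bandBound_of_l1 {C : ℝ} (hC : IsKernelConstant C) {B : ℝ} {h : L2Plane}
    (hB : ∫⁻ x, ‖h x‖ₑ ≤ ENNReal.ofReal B) : BandBound (C * B) h := by
  intro j
  obtain ⟨s, hs1, hs2⟩ := hC.2 1 _ j orderZeroSymbol_one _ (Or.inl rfl)
  have e : (s : Plane → ℂ) = bandSymbol j := hs1.trans (by simp)
  rw [mul_one] at hs2
  rw [← e]
  exact hs2.lintegral_multOp_le hC.1.le hB

/-- The multiplier commutes with the band projection, and inserting the fat projection for free
turns it into convolution with a kernel in `L¹`, uniformly in `j`. This is why the supremum over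
bands sees no logarithm. -/
lemma IsKernelConstant.bandBound_multOp {C : ℝ} (hC : IsKernelConstant C) {c : ℝ}
    {m : Plane → ℂ} (hm : OrderZeroSymbol c m) {B : ℝ} {h : L2Plane} (hB : BandBound B h) :
    BandBound (C * c * B) (multOp m h) := by
  intro j
  obtain ⟨s, hs1, hs2⟩ := hC.2 c m j hm _ (Or.inr rfl)
  rw [multOp_comm (memLp_bandSymbol j) hm.memLp_top, ← multOp_fat_band,
    ← multOp_mul hm.memLp_top (memLp_fatSymbol j), ← hs1]
  exact hs2.lintegral_multOp_le (mul_nonneg hC.1.le hm.nonneg) (hB j)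

lemma IsKernelConstant.norm_band_le {C : ℝ} (hC : IsKernelConstant C) {B : ℝ} (hB0 : 0 ≤ B)
    {h : L2Plane} (hB : BandBound B h) (j : ℕ) : ‖multOp (bandSymbol j) h‖ ≤ C * 2 ^ j * B := by
  obtain ⟨s, hs1, hs2⟩ := hC.fat j
  rw [← multOp_fat_band, ← hs1]
  exact hs2.norm_multOp_le (by positivity) hC.1.le hB0 (hB j)

/-- The bands have `L²` norms bounded by multiples of 2^j, a geometric sum dominated by its last
term. -/
lemma IsKernelConstant.norm_low_le {C : ℝ} (hC : IsKernelConstant C) {B : ℝ} (hB0 : 0 ≤ B)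
    {h : L2Plane} (hB : BandBound B h) (k : ℕ) :
    ‖multOp (lowSymbol k) h‖ ≤ 2 * C * 2 ^ k * B := by
  have hCp := hC.1
  induction k with
  | zero =>
    have h0 := hC.norm_band_le hB0 hB 0
    have h1 : bandSymbol 0 = lowSymbol 0 := rfl
    rw [h1] at h0
    have : 0 ≤ C * B := by positivity
    rw [pow_zero] at *
    linarith
  | succ k ih =>
    have h1 := hC.norm_band_le hB0 hB (k + 1)
    have h2 : multOp (lowSymbol (k + 1)) h =
        multOp (bandSymbol (k + 1)) h + multOp (lowSymbol k) h := by
      rw [multOp_band_succ]; abel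
    rw [h2]
    refine (norm_add_le _ _).trans ((add_le_add h1 ih).trans_eq ?_)
    ring

/-- Commuting an order zero multiplier past a bounded Lipschitz coefficient, with an error in `L¹`
and an error which is the multiplier of an `L¹` function. -/
theorem IsKernelConstant.commute_single {C : ℝ} (hC : IsKernelConstant C) {c : ℝ} {m : Plane → ℂ}
    (hm : OrderZeroSymbol c m) {a : Plane → ℂ} {α β L : ℝ} (hα0 : 0 ≤ α) (hβ0 : 0 ≤ β)
    (hL0 : 0 ≤ L) (hcont : AEStronglyMeasurable a volume) (hα : ∀ x, ‖a x‖ ≤ α)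
    (hβ : eLpNorm a 2 volume ≤ ENNReal.ofReal β) (hL : ∀ x y, ‖a x - a y‖ ≤ L * ‖x - y‖)
    {B : ℝ} (hB0 : 0 ≤ B) {h : L2Plane} (hB : BandBound B h) (k : ℕ) :
    ∃ U V : L2Plane, multOp m (mulOp a h) = mulOp a (multOp m h) + V + multOp m U ∧
      ∫⁻ x, ‖U x‖ₑ ≤ ENNReal.ofReal ((2 * C * β * 2 ^ k + C * L / 2 ^ k) * B) ∧
      ∫⁻ x, ‖V x‖ₑ ≤ ENNReal.ofReal (c * (2 * C * β * 2 ^ k + C * L / 2 ^ k) * B) ∧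
      ‖U‖ ≤ (α + 2 * C * L / 2 ^ k) * ‖h‖ ∧
      ‖V‖ ≤ c * (α + 2 * C * L / 2 ^ k) * ‖h‖ := by
  have hCp := hC.1
  have hc := hm.nonneg
  have haI := memLp_top_of_le hcont hα
  have hmI := hm.memLp_top
  -- The bands of `h` above frequency 2^k; what lies below is treated as a whole.
  set w : ℕ → L2Plane := fun i => multOp (bandSymbol (k + 1 + i)) h with hw
  have hwfat : ∀ i, multOp (fatSymbol (k + 1 + i)) (w i) = w i := fun i => multOp_fat_band _ _
  have hwn : ∀ i, ‖w i‖ ≤ 2 * ‖h‖ := fun i =>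
    norm_multOp_apply_le (memLp_bandSymbol _).1 (norm_bandSymbol_le _) h
  -- With P̃ the fat projection and P̃ w = w, one has M(a w) - a M w = M(a w - P̃ a w) + (M P̃ a w -
  -- a M P̃ w). Both brackets are, up to sign, commutators of `a` with a localized kernel, namely
  -- that of P̃ for `u` and of M P̃ for `v`.
  set u : ℕ → L2Plane := fun i =>
    mulOp a (w i) - multOp (fatSymbol (k + 1 + i)) (mulOp a (w i)) with hu
  set v : ℕ → L2Plane := fun i => multOp m (multOp (fatSymbol (k + 1 + i)) (mulOp a (w i))) -
    mulOp a (multOp m (w i)) with hv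
  have hpow : ∀ (x : ℝ) (i : ℕ), x / 2 ^ (k + 1 + i) = x / 2 ^ k / 2 / 2 ^ i := by
    intro x i
    rw [pow_add, pow_add, pow_one]
    field_simp
  have hu1 : ∀ i, ∫⁻ x, ‖u i x‖ₑ ≤ ENNReal.ofReal ((C * L * B) / 2 ^ k / 2 / 2 ^ i) ∧
      ‖u i‖ ≤ (2 * C * L * ‖h‖) / 2 ^ k / 2 / 2 ^ i := by
    intro i
    obtain ⟨s, hs1, hs2⟩ := hC.fat (k + 1 + i)
    have e : u i = -(multOp s (mulOp a (w i)) - mulOp a (multOp s (w i))) := by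
      rw [hs1, hwfat]; simp only [hu]; abel
    have en : ∫⁻ x, ‖u i x‖ₑ =
        ∫⁻ x, ‖(multOp s (mulOp a (w i)) - mulOp a (multOp s (w i))) x‖ₑ := by
      rw [e]
      refine lintegral_congr_ae ?_
      filter_upwards [Lp.coeFn_neg (multOp s (mulOp a (w i)) - mulOp a (multOp s (w i)))]
        with x hx
      rw [hx, Pi.neg_apply, enorm_neg]
    constructor
    · rw [en]
      refine (hs2.commutator_l1 (by positivity) hCp.le hL0 haI hL (hB _)).trans_eq ?_
      rw [← hpow]; congr 1; ring
    · rw [e, norm_neg]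
      refine (hs2.commutator_norm (by positivity) hCp.le hL0 haI hL (by positivity)
        (hwn i)).trans_eq ?_
      rw [← hpow]; ring
  have hv1 : ∀ i, ∫⁻ x, ‖v i x‖ₑ ≤ ENNReal.ofReal ((c * C * L * B) / 2 ^ k / 2 / 2 ^ i) ∧
      ‖v i‖ ≤ (2 * c * C * L * ‖h‖) / 2 ^ k / 2 / 2 ^ i := by
    intro i
    obtain ⟨s, hs1, hs2⟩ := hC.2 c m (k + 1 + i) hm _ (Or.inr rfl)
    have e : v i = multOp s (mulOp a (w i)) - mulOp a (multOp s (w i)) := by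
      rw [hs1, multOp_mul hmI (memLp_fatSymbol _), multOp_mul hmI (memLp_fatSymbol _), hwfat]
    rw [e]
    constructor
    · refine (hs2.commutator_l1 (by positivity) (by positivity) hL0 haI hL (hB _)).trans_eq ?_
      rw [← hpow]; congr 1; ring
    · refine (hs2.commutator_norm (by positivity) (by positivity) hL0 haI hL (by positivity)
        (hwn i)).trans_eq ?_
      rw [← hpow]; ring
  have hus := Summable.of_norm_bounded (hasSum_geometric_two' _).summable fun i => (hu1 i).2
  have hvs := Summable.of_norm_bounded (hasSum_geometric_two' _).summable fun i => (hv1 i).2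
  have huT1 := lintegral_enorm_tsum_le hus.hasSum (fun i => by positivity)
    (hasSum_geometric_two' _) fun i => (hu1 i).1
  have hvT1 := lintegral_enorm_tsum_le hvs.hasSum (fun i => by positivity)
    (hasSum_geometric_two' _) fun i => (hv1 i).1
  have huT2 := tsum_of_norm_bounded (hasSum_geometric_two' _) fun i => (hu1 i).2
  have hvT2 := tsum_of_norm_bounded (hasSum_geometric_two' _) fun i => (hv1 i).2
  set low := multOp (lowSymbol k) h with hlow
  have hlow1 := hC.norm_low_le hB0 hB k
  have hlow2 : ‖low‖ ≤ ‖h‖ := by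
    simpa using norm_multOp_apply_le (lowSymbol_measurable k) (norm_lowSymbol_le k) h
  have hMlow : ∀ g : L2Plane, ‖multOp m g‖ ≤ c * ‖g‖ := fun g =>
    norm_multOp_apply_le hm.measurable hm.norm_le g
  have hagn : ∀ g : L2Plane, ‖mulOp a g‖ ≤ α * ‖g‖ := fun g => norm_mulOp_apply_le hcont hα g
  have hident : multOp m (mulOp a (h - low)) =
      multOp m (∑' i, u i) + (∑' i, v i) + mulOp a (multOp m (h - low)) := by
    have hsumw : Tendsto (fun n => ∑ i ∈ Finset.range n, w i) atTop (𝓝 (h - low)) := by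
      simp only [hw, sum_band_range]
      exact (tendsto_low k h).sub_const _
    have h1 := (((multOp m).comp (mulOp a)).continuous.tendsto _).comp hsumw
    have h2 := (((multOp m).continuous.tendsto _).comp hus.hasSum.tendsto_sum_nat).add
      hvs.hasSum.tendsto_sum_nat |>.add
      ((((mulOp a).comp (multOp m)).continuous.tendsto _).comp hsumw)
    refine tendsto_nhds_unique h1 (h2.congr fun n => ?_)
    simp only [Function.comp_apply, map_sum, ContinuousLinearMap.comp_apply]
    rw [← Finset.sum_add_distrib, ← Finset.sum_add_distrib]
    refine Finset.sum_congr rfl fun i _ => ?_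
    simp only [hu, hv, map_sub]
    abel
  -- The low part is not commuted at all: `mulOp a low` and `mulOp a (multOp m low)` are separately
  -- in `L¹` by Cauchy–Schwarz. The first still has the multiplier in front of it, so it goes into
  -- `U`.
  refine ⟨mulOp a low + ∑' i, u i, (∑' i, v i) - mulOp a (multOp m low), ?_, ?_, ?_, ?_, ?_⟩
  · have : multOp m (mulOp a h) = multOp m (mulOp a low) + multOp m (mulOp a (h - low)) := by
      rw [← map_add, ← map_add, add_sub_cancel]
    rw [this, hident, map_sub, map_sub, map_add]
    abel
  · refine (lintegral_enorm_add_le _ _).trans ((add_le_add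
      (lintegral_mulOp_le haI hβ0 hβ hlow1) huT1).trans_eq ?_)
    rw [← ENNReal.ofReal_add (by positivity) (by positivity)]
    congr 1; ring
  · refine (lintegral_enorm_sub_le _ _).trans ((add_le_add hvT1
      (lintegral_mulOp_le haI hβ0 hβ ((hMlow low).trans
        (mul_le_mul_of_nonneg_left hlow1 hc)))).trans_eq ?_)
    rw [← ENNReal.ofReal_add (by positivity) (by positivity)]
    congr 1; ring
  · refine (norm_add_le _ _).trans ((add_le_add ((hagn low).trans
      (mul_le_mul_of_nonneg_left hlow2 hα0)) huT2).trans_eq ?_)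
    ring
  · refine (norm_sub_le _ _).trans ((add_le_add hvT2 ((hagn _).trans
      (mul_le_mul_of_nonneg_left ((hMlow low).trans
        (mul_le_mul_of_nonneg_left hlow2 hc)) hα0))).trans_eq ?_)
    ring

/-! ### Coefficients in `B^1_{2,1}` as sums of frequency pieces -/

/-- A decomposition of a coefficient into pieces at frequency scales `2 ^ k`, with summable
bounds as for functions in `B^1_{2,1}`. -/
structure CoeffDecomp (A : ℝ) (p : ℕ → Plane → ℂ) (α : ℕ → ℝ) : Prop where
  nonneg : ∀ k, 0 ≤ α k
  summable : Summable α
  tsum_le : ∑' k, α k ≤ A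
  continuous : ∀ k, Continuous (p k)
  bound : ∀ k x, ‖p k x‖ ≤ α k
  l2 : ∀ k, eLpNorm (p k) 2 volume ≤ ENNReal.ofReal (α k / 2 ^ k)
  lipschitz : ∀ k x y, ‖p k x - p k y‖ ≤ α k * 2 ^ k * ‖x - y‖

/-- The function with a given decomposition. -/
noncomputable def coeffSum (p : ℕ → Plane → ℂ) (x : Plane) : ℂ := ∑' k, p k x

namespace CoeffDecomp

variable {A : ℝ} {p : ℕ → Plane → ℂ} {α : ℕ → ℝ}

lemma nonneg_const (h : CoeffDecomp A p α) : 0 ≤ A := (tsum_nonneg h.nonneg).trans h.tsum_le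

lemma hasSum (h : CoeffDecomp A p α) (x : Plane) : HasSum (fun k => p k x) (coeffSum p x) :=
  (Summable.of_norm_bounded h.summable fun k => h.bound k x).hasSum

lemma norm_le (h : CoeffDecomp A p α) (x : Plane) : ‖coeffSum p x‖ ≤ A :=
  (tsum_of_norm_bounded h.summable.hasSum fun k => h.bound k x).trans h.tsum_le

lemma measurable (h : CoeffDecomp A p α) : AEStronglyMeasurable (coeffSum p) volume :=
  (continuous_tsum h.continuous h.summable h.bound).aestronglyMeasurable

lemma memLp_top (h : CoeffDecomp A p α) : MemLp (coeffSum p) ∞ (volume : Measure Plane) :=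
  memLp_top_of_le h.measurable h.norm_le

lemma memLp_top_piece (h : CoeffDecomp A p α) (k : ℕ) : MemLp (p k) ∞ (volume : Measure Plane) :=
  memLp_top_of_le (h.continuous k).aestronglyMeasurable (h.bound k)

lemma memLp_piece (h : CoeffDecomp A p α) (k : ℕ) : MemLp (p k) 2 (volume : Measure Plane) :=
  ⟨(h.continuous k).aestronglyMeasurable, (h.l2 k).trans_lt ENNReal.ofReal_lt_top⟩

lemma tsum_enorm_ne_top {F : ℕ → L2Plane} {b : ℕ → ℝ} (hb : Summable b)
    (hF : ∀ k, ‖F k‖ ≤ b k) : ∑' k, ‖F k‖ₑ ≠ (⊤ : ℝ≥0∞) := by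
  have hs : Summable fun k => ‖F k‖ := Summable.of_nonneg_of_le (fun k => norm_nonneg _) hF hb
  simp_rw [← ofReal_norm]
  rw [← ENNReal.ofReal_tsum_of_nonneg (fun k => norm_nonneg _) hs]
  exact ENNReal.ofReal_ne_top

/-- The series converges absolutely in `L²` because the sup bounds are summable; its almost
everywhere limit identifies the sum. -/
lemma hasSum_mulOp (hp : CoeffDecomp A p α) (h : L2Plane) :
    HasSum (fun k => mulOp (p k) h) (mulOp (coeffSum p) h) := by
  have hn : ∀ k, ‖mulOp (p k) h‖ ≤ α k * ‖h‖ := fun k =>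
    norm_mulOp_apply_le (hp.continuous k).aestronglyMeasurable (hp.bound k) h
  have hs := hp.summable.mul_right ‖h‖
  have hsum := (Summable.of_norm_bounded hs hn).hasSum
  have e : ∑' k, mulOp (p k) h = mulOp (coeffSum p) h := by
    refine Lp.ext ?_
    filter_upwards [Lp.hasSum_coeFn_tsum (tsum_enorm_ne_top hs hn),
      coeFn_mulOp hp.memLp_top h, ae_all_iff.2 fun k => coeFn_mulOp (hp.memLp_top_piece k) h]
      with x h1 h2 h3
    simp only [h3] at h1
    rw [h2]
    exact h1.unique ((hp.hasSum x).mul_right _)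
  rwa [e] at hsum

/-- Needed to apply the endpoint estimate with `coeffSum p` as the outer coefficient, and to keep
products of coefficients in `L²`. -/
lemma eLpNorm_le (hp : CoeffDecomp A p α) :
    eLpNorm (coeffSum p) 2 volume ≤ ENNReal.ofReal A := by
  set F : ℕ → L2Plane := fun k => (hp.memLp_piece k).toLp _ with hF
  have hn : ∀ k, ‖F k‖ ≤ α k := by
    intro k
    have hle : α k / 2 ^ k ≤ α k := div_le_self (hp.nonneg k) (one_le_pow₀ one_le_two)
    refine norm_le_of_enorm_le (hp.nonneg k) ?_
    rw [Lp.enorm_toLp]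
    exact (hp.l2 k).trans (ENNReal.ofReal_le_ofReal hle)
  have e : ⇑(∑' k, F k) =ᵐ[volume] coeffSum p := by
    filter_upwards [Lp.hasSum_coeFn_tsum (tsum_enorm_ne_top hp.summable hn),
      ae_all_iff.2 fun k => (hp.memLp_piece k).coeFn_toLp] with x h1 h2
    simp only [hF, h2] at h1
    exact h1.unique (hp.hasSum x)
  rw [← eLpNorm_congr_ae e, ← Lp.enorm_def]
  exact enorm_le_of_norm_le ((tsum_of_norm_bounded hp.summable.hasSum hn).trans hp.tsum_le)

/-- Commuting an order zero multiplier past a coefficient in `B^1_{2,1}`. -/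
theorem commute (hp : CoeffDecomp A p α) {C : ℝ} (hC : IsKernelConstant C) {c : ℝ}
    {m : Plane → ℂ} (hm : OrderZeroSymbol c m) {B : ℝ} (hB0 : 0 ≤ B) {h : L2Plane}
    (hB : BandBound B h) :
    ∃ U V : L2Plane,
      multOp m (mulOp (coeffSum p) h) = mulOp (coeffSum p) (multOp m h) + V + multOp m U ∧
      ∫⁻ x, ‖U x‖ₑ ≤ ENNReal.ofReal (3 * C * A * B) ∧
      ∫⁻ x, ‖V x‖ₑ ≤ ENNReal.ofReal (3 * C * c * A * B) ∧
      ‖U‖ ≤ (1 + 2 * C) * A * ‖h‖ := by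
  have hCp := hC.1
  have hc := hm.nonneg
  have hA := hp.nonneg_const
  have key := fun k => hC.commute_single hm (hp.nonneg k)
    (div_nonneg (hp.nonneg k) (by positivity : (0 : ℝ) ≤ 2 ^ k))
    (mul_nonneg (hp.nonneg k) (by positivity : (0 : ℝ) ≤ 2 ^ k))
    (hp.continuous k).aestronglyMeasurable (hp.bound k) (hp.l2 k) (hp.lipschitz k) hB0 hB k
  choose U V hUV hU1 hV1 hU2 hV2 using key
  -- The splitting frequency for the k-th piece is 2^k itself. This balances the low part, with `L²`
  -- norm α/2^k against 2^k, and the high part, with Lipschitz constant α 2^k against 2^{-k}.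
  have e1 : ∀ k, 2 * C * (α k / 2 ^ k) * 2 ^ k + C * (α k * 2 ^ k) / 2 ^ k = 3 * C * α k := by
    intro k; field_simp; ring
  have e2 : ∀ k, α k + 2 * C * (α k * 2 ^ k) / 2 ^ k = (1 + 2 * C) * α k := by
    intro k; field_simp
  simp only [e1, e2] at hU1 hV1 hU2 hV2
  have hsα : ∀ r s : ℝ, HasSum (fun k => r * α k * s) (r * (∑' k, α k) * s) := fun r s =>
    (hp.summable.hasSum.mul_left r).mul_right s
  have hUs : HasSum U (∑' k, U k) :=
    (Summable.of_norm_bounded (hsα (1 + 2 * C) ‖h‖).summable hU2).hasSum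
  have hVs : HasSum V (∑' k, V k) := by
    refine (Summable.of_norm_bounded (hsα (c * (1 + 2 * C)) ‖h‖).summable fun k => ?_).hasSum
    exact (hV2 k).trans_eq (by ring)
  refine ⟨∑' k, U k, ∑' k, V k, ?_, ?_, ?_, ?_⟩
  · have h1 := (hp.hasSum_mulOp h).mapL (multOp m)
    have h2 := ((hp.hasSum_mulOp (multOp m h)).add hVs).add (hUs.mapL (multOp m))
    refine h1.unique ?_
    simpa only [hUV] using h2
  · refine (lintegral_enorm_tsum_le hUs (fun k => ?_) (hsα (3 * C) B) hU1).trans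
      (ENNReal.ofReal_le_ofReal ?_)
    · have := hp.nonneg k
      positivity
    · have := hp.tsum_le
      gcongr
  · refine (lintegral_enorm_tsum_le hVs (fun k => ?_) (hsα (c * (3 * C)) B)
      fun k => (hV1 k).trans_eq (by congr 1; ring)).trans (ENNReal.ofReal_le_ofReal ?_)
    · have := hp.nonneg k
      positivity
    · have := hp.tsum_le
      calc c * (3 * C) * (∑' k, α k) * B ≤ c * (3 * C) * A * B := by gcongr
        _ = _ := by ring
  · refine (tsum_of_norm_bounded (hsα (1 + 2 * C) ‖h‖) hU2).trans ?_
    have := hp.tsum_le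
    gcongr

/-- Multiplication by a coefficient in `B^1_{2,1}` preserves `BandBound`. -/
theorem bandBound_mulOp (hp : CoeffDecomp A p α) {C : ℝ} (hC : IsKernelConstant C) {D : ℝ}
    (hD : ∀ j, OrderZeroSymbol D (bandSymbol j)) {B : ℝ} (hB0 : 0 ≤ B) {h : L2Plane}
    (hB : BandBound B h) :
    BandBound ((1 + 3 * C * D + 3 * C * C) * A * B) (mulOp (coeffSum p) h) := by
  intro j
  have hCp := hC.1
  have hA := hp.nonneg_const
  have hD0 := (hD j).nonneg
  -- The band projection is itself an order zero multiplier, so P_j(a h) = a P_j h + V + P_j U, and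
  -- every term is in `L¹`.
  obtain ⟨U, V, e, hU, hV, -⟩ := hp.commute hC (hD j) hB0 hB
  rw [e]
  refine (lintegral_enorm_add_le _ _).trans ((add_le_add ((lintegral_enorm_add_le _ _).trans
    (add_le_add (lintegral_mulOp_le' hp.measurable hA hp.norm_le (hB j)) hV))
    (hC.bandBound_of_l1 hU j)).trans_eq ?_)
  rw [← ENNReal.ofReal_add (by positivity) (by positivity),
    ← ENNReal.ofReal_add (by positivity) (by positivity)]
  congr 1; ring

end CoeffDecomp

/-! ### Calderón–Zygmund decomposition -/

/-- Sum of a two-sided geometric series. -/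
lemma sum_min_geometric_le {r : ℝ} (hr : 0 < r) (n : ℕ) :
    ∑ j ∈ Finset.range n, min (2 ^ j * r) (2 ^ j * r)⁻¹ ≤ 4 := by
  -- Induction needs a sharper bound in two regimes: while 2^n r ≤ 1 the sum is at most its next
  -- term, and afterwards the remaining tail 2(2^n r)⁻¹ is kept in reserve.
  have key : ∀ n : ℕ, (2 ^ n * r ≤ 1 →
      ∑ j ∈ Finset.range n, min (2 ^ j * r) (2 ^ j * r)⁻¹ ≤ 2 ^ n * r) ∧
      (1 ≤ 2 ^ n * r → ∑ j ∈ Finset.range n, min (2 ^ j * r) (2 ^ j * r)⁻¹ ≤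
        4 - 2 * (2 ^ n * r)⁻¹) := by
    intro n
    induction n with
    | zero =>
      simp only [pow_zero, one_mul, Finset.range_zero, Finset.sum_empty]
      refine ⟨fun _ => hr.le, fun h => ?_⟩
      have := inv_le_one_of_one_le₀ h
      linarith
    | succ n ih =>
      set t := (2 : ℝ) ^ n * r with ht
      have ht0 : 0 < t := by positivity
      have e : (2 : ℝ) ^ (n + 1) * r = 2 * t := by rw [ht]; ring
      rw [Finset.sum_range_succ, e]
      refine ⟨fun h => ?_, fun h => ?_⟩
      · have := ih.1 (by linarith)
        linarith [min_le_left t t⁻¹]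
      · have e2 : 2 * (2 * t)⁻¹ = t⁻¹ := by field_simp
        rw [e2]
        rcases le_total t 1 with h1 | h1
        · have h3 := ih.1 h1
          have h4 : t⁻¹ ≤ 2 := by
            rw [inv_le_comm₀ ht0 (by norm_num)]; linarith
          linarith [min_le_left t t⁻¹]
        · have h3 := ih.2 h1
          linarith [min_le_right t t⁻¹]
  rcases le_total (2 ^ n * r) 1 with h | h
  · exact ((key n).1 h).trans (by linarith)
  · have : 0 < (2 ^ n * r)⁻¹ := by positivity
    exact ((key n).2 h).trans (by linarith)

/-- Integrals against a kernel of a mean zero function on a small set, away from that set. -/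
lemma KernelBounds.atom_le {t D r : ℝ} (ht : 0 < t) (hD : 0 ≤ D) (hr : 0 < r) {K : 𝓢(Plane, ℂ)}
    (hK : KernelBounds t D K) {Q S : Set Plane} {c : Plane} (hQ : MeasurableSet Q)
    (hQc : Q ⊆ Metric.closedBall c (2 * r)) (hS : Disjoint S (Metric.ball c (4 * r)))
    (hSm : MeasurableSet S) {b : L2Plane} (hb1 : IntegrableOn b Q) (hb0 : ∫ y in Q, b y = 0) :
    ∫⁻ x in S, ‖∫ y in Q, K (x - y) * b y‖ₑ ≤
      ENNReal.ofReal (2 * D * min (t * r) (t * r)⁻¹) * ∫⁻ y in Q, ‖b y‖ₑ := by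
  have hKm : Measurable fun x => K x := K.continuous.measurable
  have hbm : Measurable fun y => ‖b y‖ₑ := (Lp.stronglyMeasurable b).measurable.enorm
  rcases min_cases (t * r) (t * r)⁻¹ with ⟨hmin, -⟩ | ⟨hmin, -⟩ <;> rw [hmin]
  -- The set is small compared with the wavelength: mean zero allows subtracting K(x - c), and the
  -- shift bound gives t r.
  · have hpt : ∀ x, ‖∫ y in Q, K (x - y) * b y‖ₑ ≤
        ∫⁻ y in Q, ‖K (x - y) - K (x - c)‖ₑ * ‖b y‖ₑ := by
      intro x
      have e : ∫ y in Q, K (x - y) * b y = ∫ y in Q, (K (x - y) - K (x - c)) * b y := by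
        simp_rw [sub_mul]
        rw [integral_sub (integrable_kernel_mul K x b).integrableOn (hb1.const_mul _),
          integral_const_mul, hb0, mul_zero, sub_zero]
      rw [e]
      refine (enorm_integral_le_lintegral_enorm _).trans_eq ?_
      simp_rw [enorm_mul]
    calc _ ≤ ∫⁻ x, ∫⁻ y in Q, ‖K (x - y) - K (x - c)‖ₑ * ‖b y‖ₑ :=
          (setLIntegral_le_lintegral _ _).trans (lintegral_mono hpt)
      _ = ∫⁻ y in Q, ∫⁻ x, ‖K (x - y) - K (x - c)‖ₑ * ‖b y‖ₑ := by
          refine lintegral_lintegral_swap (Measurable.aemeasurable ?_)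
          refine Measurable.mul ?_ (hbm.comp measurable_snd)
          exact ((hKm.comp (measurable_fst.sub measurable_snd)).sub
            (hKm.comp (measurable_fst.sub measurable_const))).enorm
      _ ≤ ∫⁻ y in Q, ENNReal.ofReal (2 * D * (t * r)) * ‖b y‖ₑ := by
          refine setLIntegral_mono' hQ fun y hy => ?_
          rw [lintegral_mul_const']
          · gcongr
            have e : ∀ x, ‖K (x - y) - K (x - c)‖ₑ =
                (fun z => ‖K (z - (y - c)) - K z‖ₑ) (x - c) := by
              intro x; simp only; congr 3; abel
            rw [lintegral_congr e, lintegral_sub_const (fun z => ‖K (z - (y - c)) - K z‖ₑ)]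
            refine (hK.shift _).trans (ENNReal.ofReal_le_ofReal ?_)
            have h1 : ‖y - c‖ ≤ 2 * r := by simpa [dist_eq_norm] using hQc hy
            calc D * t * ‖y - c‖ ≤ D * t * (2 * r) := by gcongr
              _ = _ := by ring
          · finiteness
      _ = _ := lintegral_const_mul _ hbm
  -- The set is large compared with the wavelength: no cancellation is needed, since |x - y| ≥ r off
  -- the dilated ball and the first moment gives (t r)⁻¹.
  · have hpt : ∀ x, ‖∫ y in Q, K (x - y) * b y‖ₑ ≤ ∫⁻ y in Q, ‖K (x - y)‖ₑ * ‖b y‖ₑ := by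
      intro x
      refine (enorm_integral_le_lintegral_enorm _).trans_eq ?_
      simp_rw [enorm_mul]
    calc _ ≤ ∫⁻ x in S, ∫⁻ y in Q, ‖K (x - y)‖ₑ * ‖b y‖ₑ := lintegral_mono hpt
      _ = ∫⁻ y in Q, ∫⁻ x in S, ‖K (x - y)‖ₑ * ‖b y‖ₑ := by
          refine lintegral_lintegral_swap (Measurable.aemeasurable ?_)
          exact Measurable.mul (hKm.comp (measurable_fst.sub measurable_snd)).enorm
            (hbm.comp measurable_snd)
      _ ≤ ∫⁻ y in Q, ENNReal.ofReal (2 * D * (t * r)⁻¹) * ‖b y‖ₑ := by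
          refine setLIntegral_mono' hQ fun y hy => ?_
          rw [lintegral_mul_const']
          · gcongr
            have hyc : dist y c ≤ 2 * r := hQc hy
            calc ∫⁻ x in S, ‖K (x - y)‖ₑ
                ≤ ∫⁻ x in S, ENNReal.ofReal r⁻¹ * (‖x - y‖ₑ * ‖K (x - y)‖ₑ) := by
                  refine setLIntegral_mono' hSm fun x hx => ?_
                  have hxc : 4 * r ≤ dist x c := by
                    by_contra hlt
                    exact Set.disjoint_left.1 hS hx (by simpa using hlt)
                  have hxy : r ≤ ‖x - y‖ := by
                    rw [← dist_eq_norm]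
                    linarith [dist_triangle x y c]
                  rw [← mul_assoc]
                  refine le_mul_of_one_le_left zero_le ?_
                  rw [← ofReal_norm, ← ENNReal.ofReal_mul (by positivity), ENNReal.one_le_ofReal,
                    inv_mul_eq_div, one_le_div hr]
                  exact hxy
              _ ≤ ∫⁻ x, ENNReal.ofReal r⁻¹ * (‖x - y‖ₑ * ‖K (x - y)‖ₑ) :=
                  setLIntegral_le_lintegral _ _
              _ = ENNReal.ofReal r⁻¹ * ∫⁻ x, ‖x‖ₑ * ‖K x‖ₑ := by
                  rw [lintegral_const_mul' _ _ ENNReal.ofReal_ne_top,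
                    lintegral_sub_const (fun x => ‖x‖ₑ * ‖K x‖ₑ)]
              _ ≤ ENNReal.ofReal r⁻¹ * ENNReal.ofReal (D / t) := by
                  gcongr
                  exact hK.moment
              _ ≤ _ := by
                  rw [← ENNReal.ofReal_mul (by positivity)]
                  refine ENNReal.ofReal_le_ofReal ?_
                  have e : r⁻¹ * (D / t) = D * (t * r)⁻¹ := by field_simp
                  rw [e]
                  have : 0 ≤ D * (t * r)⁻¹ := by positivity
                  linarith
          · finiteness
      _ = _ := lintegral_const_mul _ hbm

/-! ### Stopping families, good parts and bad parts -/

/-- A disjoint family of sets comparable to squares on which the averages of `|u|` are comparable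
to `l`, with `|u| ≤ l` elsewhere. -/
structure StoppingFamily {ι : Type} (u : Plane → ℂ) (l : ℝ) (Q : ι → Set Plane) (c : ι → Plane)
    (r : ι → ℝ) : Prop where
  meas : ∀ i, MeasurableSet (Q i)
  disj : Pairwise (Function.onFun Disjoint Q)
  pos : ∀ i, 0 < r i
  subset : ∀ i, Q i ⊆ Metric.closedBall (c i) (2 * r i)
  vol : ∀ i, volume (Q i) = ENNReal.ofReal (r i ^ 2)
  lower : ∀ i, ENNReal.ofReal l * volume (Q i) ≤ ∫⁻ x in Q i, ‖u x‖ₑ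
  upper : ∀ i, ∫⁻ x in Q i, ‖u x‖ₑ ≤ ENNReal.ofReal (4 * l) * volume (Q i)
  off : ∀ᵐ x, x ∉ (⋃ i, Q i) → ‖u x‖ₑ ≤ ENNReal.ofReal (4 * l)

namespace StoppingFamily

variable {ι : Type} [Countable ι] {l : ℝ} {Q : ι → Set Plane} {c : ι → Plane} {r : ι → ℝ}

/-- The exceptional set: the union of the dilated squares. -/
def excSet (c : ι → Plane) (r : ι → ℝ) : Set Plane := ⋃ i, Metric.ball (c i) (4 * r i)

lemma measurableSet_excSet : MeasurableSet (excSet c r) :=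
  MeasurableSet.iUnion fun _ => measurableSet_ball

/-- A ball of radius 4r has 16π times the area of its square, and the squares are disjoint with
average of |u| at least `l`: Chebyshev's inequality. -/
lemma volume_excSet_le {u : Plane → ℂ} (hF : StoppingFamily u l Q c r) :
    ENNReal.ofReal l * volume (excSet c r) ≤ ENNReal.ofReal (16 * Real.pi) * ∫⁻ x, ‖u x‖ₑ := by
  have hball : ∀ i, volume (Metric.ball (c i) (4 * r i)) =
      ENNReal.ofReal (16 * Real.pi) * volume (Q i) := by
    intro i
    have := hF.pos i
    rw [hF.vol, EuclideanSpace.volume_ball_fin_two, ← ENNReal.ofReal_mul (by positivity),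
      ← ENNReal.ofReal_pow (by positivity), ← ENNReal.ofReal_mul (by positivity)]
    congr 1
    ring
  calc _ ≤ ENNReal.ofReal l * ∑' i, volume (Metric.ball (c i) (4 * r i)) := by
        gcongr; exact measure_iUnion_le _
    _ = ENNReal.ofReal (16 * Real.pi) * ∑' i, ENNReal.ofReal l * volume (Q i) := by
        simp_rw [hball]
        rw [ENNReal.tsum_mul_left, ENNReal.tsum_mul_left, mul_left_comm]
    _ ≤ ENNReal.ofReal (16 * Real.pi) * ∑' i, ∫⁻ x in Q i, ‖u x‖ₑ := by
        gcongr with i; exact hF.lower i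
    _ = ENNReal.ofReal (16 * Real.pi) * ∫⁻ x in ⋃ i, Q i, ‖u x‖ₑ := by
        rw [lintegral_iUnion hF.meas hF.disj]
    _ ≤ _ := by gcongr; exact Measure.restrict_le_self

/-- The good part of `u`: its averages on the sets of the family, and `u` elsewhere. -/
lemma exists_good {u : L2Plane} (hF : StoppingFamily u l Q c r) :
    ∃ g : Plane → ℂ, Measurable g ∧ (∀ i, ∀ x ∈ Q i, g x = ⨍ y in Q i, u y) ∧
      (∀ x ∉ ⋃ i, Q i, g x = u x) ∧ (∀ᵐ x, ‖g x‖ₑ ≤ ENNReal.ofReal (4 * l)) ∧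
      ∫⁻ x, ‖g x‖ₑ ≤ ∫⁻ x, ‖u x‖ₑ := by
  set t : Option ι → Set Plane := fun o => o.elim (⋃ i, Q i)ᶜ Q with ht
  set G : Option ι → Plane → ℂ := fun o => o.elim u fun i _ => ⨍ y in Q i, u y with hG
  have hEm : MeasurableSet (⋃ i, Q i) := MeasurableSet.iUnion hF.meas
  obtain ⟨g, hgm, hg⟩ := exists_measurable_piecewise t
    (fun o => by
      cases o with
      | none => exact hEm.compl
      | some i => exact hF.meas i) G
    (fun o => by
      cases o with
      | none => exact (Lp.stronglyMeasurable u).measurable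
      | some i => exact measurable_const)
    (fun o o' hne x hx => by
      cases o with
      | none =>
        cases o' with
        | none => exact absurd rfl hne
        | some i => exact absurd (Set.mem_iUnion_of_mem i hx.2) hx.1
      | some i =>
        cases o' with
        | none => exact absurd (Set.mem_iUnion_of_mem i hx.1) hx.2
        | some j =>
          exact absurd hx.2 (Set.disjoint_left.1 (hF.disj fun h => hne (by rw [h])) hx.1))
  have hgQ : ∀ i, ∀ x ∈ Q i, g x = ⨍ y in Q i, u y := fun i x hx => hg (some i) hx
  have hgE : ∀ x ∉ ⋃ i, Q i, g x = u x := fun x hx => hg none hx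
  have hvpos : ∀ i, volume (Q i) ≠ 0 := fun i => by
    rw [hF.vol]
    have := hF.pos i
    simpa using this.ne'
  have hvfin : ∀ i, volume (Q i) ≠ (⊤ : ℝ≥0∞) := fun i => by rw [hF.vol]; exact ENNReal.ofReal_ne_top
  have havg : ∀ i, ‖⨍ y in Q i, u y‖ₑ * volume (Q i) ≤ ∫⁻ x in Q i, ‖u x‖ₑ := by
    intro i
    rw [setAverage_eq, enorm_smul, mul_right_comm]
    have e : ‖(volume.real (Q i))⁻¹‖ₑ * volume (Q i) = 1 := by
      rw [← ofReal_norm, norm_inv, Real.norm_of_nonneg measureReal_nonneg, measureReal_def,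
        ENNReal.ofReal_inv_of_pos (ENNReal.toReal_pos (hvpos i) (hvfin i)), ENNReal.ofReal_toReal (hvfin i), ENNReal.inv_mul_cancel (hvpos i) (hvfin i)]
    rw [e, one_mul]
    exact enorm_integral_le_lintegral_enorm _
  refine ⟨g, hgm, hgQ, hgE, ?_, ?_⟩
  · filter_upwards [hF.off] with x hx
    by_cases hxE : x ∈ ⋃ i, Q i
    · obtain ⟨i, hi⟩ := Set.mem_iUnion.1 hxE
      rw [hgQ i x hi]
      have := (havg i).trans (hF.upper i)
      exact (ENNReal.mul_le_mul_iff_left (hvpos i) (hvfin i)).1 this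
    · rw [hgE x hxE]; exact hx hxE
  · rw [← lintegral_add_compl _ hEm, ← lintegral_add_compl (fun x => ‖u x‖ₑ) hEm]
    refine add_le_add ?_ (le_of_eq (setLIntegral_congr_fun hEm.compl fun x hx => ?_))
    · rw [lintegral_iUnion hF.meas hF.disj, lintegral_iUnion hF.meas hF.disj]
      refine ENNReal.tsum_le_tsum fun i => ?_
      rw [setLIntegral_congr_fun (g := fun _ => ‖⨍ y in Q i, u y‖ₑ) (hF.meas i)
        fun x hx => by simp only [hgQ i x hx], setLIntegral_const]
      exact havg i
    · simp only [hgE x hx]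

/-- Bound away from the exceptional set for a convolution operator applied to the bad part. -/
lemma setLIntegral_multOp_le {u : Plane → ℂ} (hF : StoppingFamily u l Q c r) {b : L2Plane}
    (hb1 : Integrable b) (hb0 : ∀ i, ∫ y in Q i, b y = 0) (hbE : ∀ᵐ x, x ∉ ⋃ i, Q i → b x = 0)
    {t D : ℝ} (ht : 0 < t) (hD : 0 ≤ D) {s : 𝓢(Plane, ℂ)}
    (hs : KernelBounds t D (𝓕⁻ s : 𝓢(Plane, ℂ))) :
    ∫⁻ x in (excSet c r)ᶜ, ‖multOp s b x‖ₑ ≤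
      ∑' i, ENNReal.ofReal (2 * D * min (t * r i) (t * r i)⁻¹) * ∫⁻ y in Q i, ‖b y‖ₑ := by
  set K : 𝓢(Plane, ℂ) := 𝓕⁻ s with hKdef
  have hEm : MeasurableSet (⋃ i, Q i) := MeasurableSet.iUnion hF.meas
  have hpt : ∀ᵐ x, ‖multOp s b x‖ₑ ≤ ∑' i, ‖∫ y in Q i, K (x - y) * b y‖ₑ := by
    filter_upwards [multOp_eq_convolution s b] with x hx
    have hint := integrable_kernel_mul K x b
    have e1 : ∫ y, K (x - y) * b y = ∫ y in ⋃ i, Q i, K (x - y) * b y := by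
      rw [← integral_indicator hEm]
      refine integral_congr_ae ?_
      filter_upwards [hbE] with y hy
      by_cases hyE : y ∈ ⋃ i, Q i
      · rw [Set.indicator_of_mem hyE]
      · rw [Set.indicator_of_notMem hyE, hy hyE, mul_zero]
    have e2 := hasSum_integral_iUnion hF.meas hF.disj (hint.integrableOn (s := ⋃ i, Q i))
    rw [hx, e1, ← e2.tsum_eq]
    exact enorm_tsum_le_tsum_enorm
  have hmeas : ∀ i, Measurable fun x => ‖∫ y in Q i, K (x - y) * b y‖ₑ := by
    intro i
    have h1 : StronglyMeasurable (Function.uncurry fun x y : Plane => K (x - y) * b y) :=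
      (K.continuous.comp (continuous_fst.sub continuous_snd)).stronglyMeasurable.mul
        ((Lp.stronglyMeasurable b).comp_measurable measurable_snd)
    exact (h1.integral_prod_right (ν := volume.restrict (Q i))).measurable.enorm
  calc _ ≤ ∫⁻ x in (excSet c r)ᶜ, ∑' i, ‖∫ y in Q i, K (x - y) * b y‖ₑ :=
        lintegral_mono_ae (ae_restrict_of_ae hpt)
    _ = ∑' i, ∫⁻ x in (excSet c r)ᶜ, ‖∫ y in Q i, K (x - y) * b y‖ₑ :=
        lintegral_tsum fun i => (hmeas i).aemeasurable
    _ ≤ _ := by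
        refine ENNReal.tsum_le_tsum fun i => ?_
        refine hs.atom_le ht hD (hF.pos i) (hF.meas i) (hF.subset i) ?_
          measurableSet_excSet.compl hb1.integrableOn (hb0 i)
        exact Set.disjoint_left.2 fun x hx hxb => hx (Set.mem_iUnion_of_mem i hxb)

end StoppingFamily

/-- The Calderón–Zygmund estimate for an order zero multiplier, given stopping squares. -/
theorem IsKernelConstant.exists_good_bad {C : ℝ} (hC : IsKernelConstant C) {ι : Type} [Countable ι]
    {l : ℝ} (hl : 0 < l) {Q : ι → Set Plane} {c : ι → Plane} {r : ι → ℝ} {u : L2Plane} {W : ℝ}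
    (hW0 : 0 ≤ W) (hW : ∫⁻ x, ‖u x‖ₑ ≤ ENNReal.ofReal W) (hF : StoppingFamily u l Q c r) :
    ∃ (g : L2Plane) (O : Set Plane), MeasurableSet O ∧ ‖g‖ ^ 2 ≤ 4 * l * W ∧
      volume O ≤ ENNReal.ofReal (16 * Real.pi * W / l) ∧
      ∀ (a : ℝ) (m : Plane → ℂ), OrderZeroSymbol a m →
        ∫⁻ x in Oᶜ, ‖multOp m (u - g) x‖ₑ ≤ ENNReal.ofReal (16 * C * a * W) := by
  have hufin : ∫⁻ x, ‖u x‖ₑ ≠ (⊤ : ℝ≥0∞) := (hW.trans_lt ENNReal.ofReal_lt_top).ne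
  obtain ⟨g₀, hgm, hgQ, hgE, hgb, hg1⟩ := hF.exists_good
  have hEm : MeasurableSet (⋃ i, Q i) := MeasurableSet.iUnion hF.meas
  have hsq : ∫⁻ x, ‖g₀ x‖ₑ ^ 2 ≤ ENNReal.ofReal (4 * l * W) := by
    calc _ ≤ ∫⁻ x, ENNReal.ofReal (4 * l) * ‖g₀ x‖ₑ := by
          refine lintegral_mono_ae ?_
          filter_upwards [hgb] with x hx
          rw [sq]; gcongr
      _ = ENNReal.ofReal (4 * l) * ∫⁻ x, ‖g₀ x‖ₑ :=
          lintegral_const_mul' _ _ ENNReal.ofReal_ne_top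
      _ ≤ ENNReal.ofReal (4 * l) * ENNReal.ofReal W := by gcongr; exact hg1.trans hW
      _ = _ := by rw [← ENNReal.ofReal_mul (by positivity)]
  have hgL2 : MemLp g₀ 2 (volume : Measure Plane) := by
    refine ⟨hgm.aestronglyMeasurable, ?_⟩
    rw [eLpNorm_lt_top_iff_lintegral_rpow_enorm_lt_top (by norm_num) (by norm_num)]
    refine lt_of_le_of_lt (le_of_eq ?_) (hsq.trans_lt ENNReal.ofReal_lt_top)
    simp
  set g : L2Plane := hgL2.toLp g₀ with hg
  have hgg : g =ᵐ[volume] g₀ := hgL2.coeFn_toLp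
  have hu1 : Integrable u := ⟨Lp.aestronglyMeasurable u, by
    rw [HasFiniteIntegral]; exact hufin.lt_top⟩
  have hg₀1 : Integrable g₀ := ⟨hgm.aestronglyMeasurable, by
    rw [HasFiniteIntegral]; exact (hg1.trans hW).trans_lt ENNReal.ofReal_lt_top⟩
  have hb : (u - g : L2Plane) =ᵐ[volume] fun x => u x - g₀ x := by
    filter_upwards [Lp.coeFn_sub u g, hgg] with x h1 h2
    rw [h1, Pi.sub_apply, h2]
  have hb1 : Integrable (u - g : L2Plane) := (hu1.sub hg₀1).congr hb.symm
  have hvpos : ∀ i, volume (Q i) ≠ 0 := fun i => by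
    rw [hF.vol]
    have := hF.pos i
    simpa using this.ne'
  have hvfin : ∀ i, volume (Q i) ≠ (⊤ : ℝ≥0∞) := fun i => by rw [hF.vol]; exact ENNReal.ofReal_ne_top
  have hb0 : ∀ i, ∫ y in Q i, (u - g : L2Plane) y = 0 := by
    intro i
    rw [integral_congr_ae (ae_restrict_of_ae hb), integral_sub hu1.integrableOn hg₀1.integrableOn,
      setIntegral_congr_fun (hF.meas i) (fun x hx => hgQ i x hx), setIntegral_const,
      setAverage_eq, smul_smul, mul_inv_cancel₀, one_smul, sub_self]
    exact (ENNReal.toReal_pos (hvpos i) (hvfin i)).ne'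
  have hbE : ∀ᵐ x, x ∉ ⋃ i, Q i → (u - g : L2Plane) x = 0 := by
    filter_upwards [hb] with x hx hxE
    rw [hx, hgE x hxE, sub_self]
  have hbL1 : ∫⁻ x, ‖(u - g : L2Plane) x‖ₑ ≤ ENNReal.ofReal (2 * W) := by
    refine (lintegral_enorm_sub_le u g).trans ?_
    have : ∫⁻ x, ‖g x‖ₑ ≤ ENNReal.ofReal W := by
      rw [lintegral_congr_ae (g := fun x => ‖g₀ x‖ₑ) (hgg.mono fun x hx => by simp only [hx])]
      exact hg1.trans hW
    refine (add_le_add hW this).trans_eq ?_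
    rw [← ENNReal.ofReal_add hW0 hW0]; congr 1; ring
  refine ⟨g, StoppingFamily.excSet c r, StoppingFamily.measurableSet_excSet, ?_, ?_, ?_⟩
  · have h1 : ‖g‖ₑ ^ 2 ≤ ENNReal.ofReal (4 * l * W) := by
      rw [enorm_sq_eq_lintegral, lintegral_congr_ae (g := fun x => ‖g₀ x‖ₑ ^ 2)
        (hgg.mono fun x hx => by simp only [hx])]
      exact hsq
    rw [← ofReal_norm, ← ENNReal.ofReal_pow (norm_nonneg _)] at h1
    exact (ENNReal.ofReal_le_ofReal_iff (by positivity)).1 h1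
  · have h1 := hF.volume_excSet_le
    have h2 : ENNReal.ofReal l * volume (StoppingFamily.excSet c r) ≤
        ENNReal.ofReal l * ENNReal.ofReal (16 * Real.pi * W / l) := by
      refine h1.trans ((mul_le_mul_right hW _).trans_eq ?_)
      rw [← ENNReal.ofReal_mul (by positivity), ← ENNReal.ofReal_mul hl.le]
      congr 1; field_simp
    exact (ENNReal.mul_le_mul_iff_right (by simpa using hl) ENNReal.ofReal_ne_top).1 h2
  · intro a m hm
    have ha := hm.nonneg
    have hCp := hC.1
    have hpiece : ∀ j, ∫⁻ x in (StoppingFamily.excSet c r)ᶜ,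
        ‖multOp m (multOp (bandSymbol j) (u - g)) x‖ₑ ≤
        ∑' i, ENNReal.ofReal (2 * (C * a) * min (2 ^ j * r i) (2 ^ j * r i)⁻¹) *
          ∫⁻ y in Q i, ‖(u - g : L2Plane) y‖ₑ := by
      intro j
      obtain ⟨s, hs1, hs2⟩ := hC.2 a m j hm _ (Or.inl rfl)
      rw [← multOp_mul hm.memLp_top (memLp_bandSymbol j), ← hs1]
      exact hF.setLIntegral_multOp_le hb1 hb0 hbE (by positivity) (by positivity) hs2
    -- The full multiplier has no integrable kernel, so it is reached as the `L²` limit of its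
    -- localized sums; Fatou carries the uniform `L¹` bound to the limit.
    have hlim : Tendsto (fun n => ∑ j ∈ Finset.range (n + 1),
        multOp m (multOp (bandSymbol j) (u - g))) atTop (𝓝 (multOp m (u - g))) := by
      have h1 := ((multOp m).continuous.tendsto _).comp (tendsto_low 0 (u - g))
      refine h1.congr fun n => ?_
      have h2 := sum_band_range 0 n (u - g)
      rw [Finset.sum_range_succ', ← map_sum, ← map_add, Function.comp_apply]
      congr 1
      have h3 : ∑ i ∈ Finset.range n, multOp (bandSymbol (i + 1)) (u - g) =
          ∑ i ∈ Finset.range n, multOp (bandSymbol (0 + 1 + i)) (u - g) :=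
        Finset.sum_congr rfl fun i _ => by rw [show 0 + 1 + i = i + 1 by ring]
      rw [h3, h2, bandSymbol]
      abel
    refine setLIntegral_enorm_le_of_tendsto hlim fun n => ?_
    have hsum : ∀ (s : Finset ℕ) (F : ℕ → L2Plane) (S : Set Plane),
        ∫⁻ x in S, ‖(∑ i ∈ s, F i : L2Plane) x‖ₑ ≤ ∑ i ∈ s, ∫⁻ x in S, ‖F i x‖ₑ := by
      intro s F S
      rw [← lintegral_finsetSum' _ fun i _ => (Lp.aestronglyMeasurable (F i)).enorm.restrict]
      refine lintegral_mono_ae (ae_restrict_of_ae ?_)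
      filter_upwards [Lp.coeFn_fun_finsetSum s F] with x hx
      rw [hx]
      exact enorm_sum_le _ _
    refine (hsum _ _ _).trans ((Finset.sum_le_sum fun j _ => hpiece j).trans ?_)
    -- Summing over bands first leaves, for each square, a two-sided geometric series in 2^j r,
    -- bounded independently of the square.
    rw [← Summable.tsum_finsetSum fun _ _ => ENNReal.summable]
    simp_rw [← Finset.sum_mul]
    calc _ ≤ ∑' i, ENNReal.ofReal (8 * C * a) * ∫⁻ y in Q i, ‖(u - g : L2Plane) y‖ₑ := by
          refine ENNReal.tsum_le_tsum fun i => ?_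
          gcongr
          have hr := hF.pos i
          rw [← ENNReal.ofReal_sum_of_nonneg fun j _ => by positivity, ← Finset.mul_sum]
          refine ENNReal.ofReal_le_ofReal ?_
          calc 2 * (C * a) * _ ≤ 2 * (C * a) * 4 := by
                gcongr; exact sum_min_geometric_le hr _
            _ = _ := by ring
      _ = ENNReal.ofReal (8 * C * a) * ∫⁻ y in ⋃ i, Q i, ‖(u - g : L2Plane) y‖ₑ := by
          rw [ENNReal.tsum_mul_left, lintegral_iUnion hF.meas hF.disj]
      _ ≤ ENNReal.ofReal (8 * C * a) * ENNReal.ofReal (2 * W) := by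
          gcongr
          exact (setLIntegral_le_lintegral _ _).trans hbL1
      _ = _ := by
          rw [← ENNReal.ofReal_mul (by positivity)]; congr 1; ring

/-! ### Dyadic stopping squares -/

/-- Index of the dyadic square of side `2⁻ᵏ` containing a point. -/
noncomputable def dyadicIndex (k : ℤ) (x : Plane) : Fin 2 → ℤ := fun i => ⌊(2 : ℝ) ^ k * x i⌋

/-- The dyadic square of side `2⁻ᵏ` with a given index. -/
def dyadicSquare (k : ℤ) (n : Fin 2 → ℤ) : Set Plane := {x | dyadicIndex k x = n}

/-- Coarser indices are obtained from finer ones by integer division by a power of two, so dyadic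
squares are nested. -/
lemma dyadicIndex_eq_of_le {k k' : ℤ} (h : k' ≤ k) {x y : Plane}
    (hxy : dyadicIndex k x = dyadicIndex k y) : dyadicIndex k' x = dyadicIndex k' y := by
  obtain ⟨j, rfl⟩ := Int.exists_add_of_le h
  have e : ∀ z : Plane, dyadicIndex k' z = fun i => dyadicIndex (k' + j) z i / ((2 ^ j : ℕ) : ℤ) := by
    intro z
    funext i
    rw [dyadicIndex, dyadicIndex, ← Int.floor_div_natCast]
    congr 1
    rw [zpow_add₀ two_ne_zero, zpow_natCast]
    push_cast
    field_simp
  rw [e, e, hxy]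

lemma dyadicSquare_eq (k : ℤ) (n : Fin 2 → ℤ) :
    dyadicSquare k n = (WithLp.ofLp : Plane → Fin 2 → ℝ) ⁻¹' Set.univ.pi fun i =>
      Set.Ico (n i * (2 : ℝ) ^ (-k)) (n i * (2 : ℝ) ^ (-k) + (2 : ℝ) ^ (-k)) := by
  ext x
  have h2 : (0 : ℝ) < 2 ^ k := by positivity
  simp only [dyadicSquare, Set.mem_ofPred_eq, funext_iff, dyadicIndex, Int.floor_eq_iff,
    Set.mem_preimage, Set.mem_pi, Set.mem_univ, true_implies, Set.mem_Ico, zpow_neg]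
  refine forall_congr' fun i => and_congr ?_ ?_
  · rw [← div_eq_mul_inv, div_le_iff₀ h2, mul_comm]
  · rw [← add_one_mul, ← div_eq_mul_inv, lt_div_iff₀ h2, mul_comm]

lemma measurableSet_dyadicSquare (k : ℤ) (n : Fin 2 → ℤ) : MeasurableSet (dyadicSquare k n) := by
  rw [dyadicSquare_eq]
  exact (PiLp.volume_preserving_ofLp (Fin 2)).measurable
    (MeasurableSet.univ_pi fun _ => measurableSet_Ico)

lemma volume_dyadicSquare (k : ℤ) (n : Fin 2 → ℤ) :
    volume (dyadicSquare k n) = ENNReal.ofReal (((2 : ℝ) ^ (-k)) ^ 2) := by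
  rw [dyadicSquare_eq, (PiLp.volume_preserving_ofLp (Fin 2)).measure_preimage
    (MeasurableSet.univ_pi fun _ => measurableSet_Ico).nullMeasurableSet, Real.volume_pi_Ico]
  simp only [add_sub_cancel_left, Finset.prod_const, Finset.card_univ, Fintype.card_fin]
  rw [ENNReal.ofReal_pow (by positivity)]

lemma dist_le_of_coord {x y : Plane} {r : ℝ} (hr : 0 ≤ r) (h : ∀ i, |x i - y i| ≤ r) :
    dist x y ≤ 2 * r := by
  rw [EuclideanSpace.dist_eq, Fin.sum_univ_two]
  refine Real.sqrt_le_iff.2 ⟨by positivity, ?_⟩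
  simp only [Real.dist_eq]
  have h0 := pow_le_pow_left₀ (abs_nonneg _) (h 0) 2
  have h1 := pow_le_pow_left₀ (abs_nonneg _) (h 1) 2
  nlinarith

lemma dyadicSquare_subset_corner (k : ℤ) (n : Fin 2 → ℤ) :
    dyadicSquare k n ⊆
      Metric.closedBall (WithLp.toLp 2 fun i => n i * (2 : ℝ) ^ (-k)) (2 * (2 : ℝ) ^ (-k)) := by
  intro x hx
  rw [dyadicSquare_eq] at hx
  refine dist_le_of_coord (by positivity) fun i => ?_
  have := hx i (Set.mem_univ i)
  simp only [Set.mem_Ico] at this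
  rw [abs_le]
  have h2 : (0 : ℝ) < 2 ^ (-k) := by positivity
  constructor <;> simp only <;> linarith

lemma dyadicSquare_subset_closedBall {k : ℤ} {n : Fin 2 → ℤ} {x : Plane}
    (hx : x ∈ dyadicSquare k n) :
    dyadicSquare k n ⊆ Metric.closedBall x (2 * (2 : ℝ) ^ (-k)) := by
  intro y hy
  rw [dyadicSquare_eq] at hx hy
  refine dist_le_of_coord (by positivity) fun i => ?_
  have h1 := hx i (Set.mem_univ i)
  have h2 := hy i (Set.mem_univ i)
  simp only [Set.mem_Ico] at h1 h2
  rw [abs_le]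
  constructor <;> linarith

/-- The dyadic square has an average of `|u|` exceeding `l`. -/
def IsHeavy (u : Plane → ℂ) (l : ℝ) (k : ℤ) (n : Fin 2 → ℤ) : Prop :=
  ENNReal.ofReal l * volume (dyadicSquare k n) < ∫⁻ x in dyadicSquare k n, ‖u x‖ₑ

/-- The maximal heavy dyadic squares. -/
def IsStopping (u : Plane → ℂ) (l : ℝ) (p : ℤ × (Fin 2 → ℤ)) : Prop :=
  IsHeavy u l p.1 p.2 ∧
    ∀ k < p.1, ∀ x ∈ dyadicSquare p.1 p.2, ¬ IsHeavy u l k (dyadicIndex k x)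

/-- A heavy square has area less than ‖u‖_{L¹}/l, so among the heavy squares containing `x` there is
a coarsest one. -/
lemma exists_stopping {u : Plane → ℂ} {l : ℝ} (hl : 0 < l)
    (hu : ∫⁻ x, ‖u x‖ₑ ≠ (⊤ : ℝ≥0∞)) {x : Plane} {k : ℤ} (hk : IsHeavy u l k (dyadicIndex k x)) :
    ∃ p, IsStopping u l p ∧ x ∈ dyadicSquare p.1 p.2 := by
  have hbdd : ∃ b : ℤ, ∀ k : ℤ, IsHeavy u l k (dyadicIndex k x) → b ≤ k := by
    obtain ⟨N, hN⟩ := pow_unbounded_of_one_lt ((∫⁻ x, ‖u x‖ₑ).toReal / l) one_lt_two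
    refine ⟨-N, fun k hk => ?_⟩
    by_contra! hlt
    have h1 : ENNReal.ofReal l * ENNReal.ofReal (((2 : ℝ) ^ (-k)) ^ 2) < ∫⁻ x, ‖u x‖ₑ := by
      rw [← volume_dyadicSquare k (dyadicIndex k x)]
      exact hk.trans_le (setLIntegral_le_lintegral _ _)
    rw [← ENNReal.ofReal_mul hl.le, ENNReal.ofReal_lt_iff_lt_toReal (by positivity) hu] at h1
    rw [div_lt_iff₀ hl] at hN
    have h2 : (2 : ℝ) ^ N ≤ 2 ^ (-k) := by
      rw [← zpow_natCast]
      exact zpow_le_zpow_right₀ one_le_two (by omega)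
    have h3 : (1 : ℝ) ≤ 2 ^ N := one_le_pow₀ one_le_two
    nlinarith [mul_le_mul_of_nonneg_left (h3.trans h2) (zero_le_one.trans (h3.trans h2))]
  obtain ⟨k₀, hk₀, hmin⟩ := Int.exists_least_of_bdd hbdd ⟨k, hk⟩
  refine ⟨(k₀, dyadicIndex k₀ x), ⟨hk₀, fun k' hk' y hy hheavy => ?_⟩, rfl⟩
  rw [dyadicIndex_eq_of_le hk'.le hy] at hheavy
  exact absurd (hmin k' hheavy) (not_le.2 hk')

/-- Lebesgue differentiation along dyadic squares. -/
lemma ae_le_of_not_heavy {u : Plane → ℂ} {l : ℝ} (hl : 0 < l) (hu : LocallyIntegrable u) :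
    ∀ᵐ x, (∀ k : ℤ, ¬ IsHeavy u l k (dyadicIndex k x)) → ‖u x‖ ≤ l := by
  filter_upwards [IsUnifLocDoublingMeasure.ae_tendsto_average_norm_sub
    (volume : Measure Plane) hu 1] with x hx hlight
  have hr : Tendsto (fun k : ℕ => 2 * (2 : ℝ) ^ (-(k : ℤ))) atTop (𝓝[>] 0) := by
    refine tendsto_nhdsWithin_iff.2 ⟨?_, Eventually.of_forall fun k => by
      simp only [Set.mem_Ioi]; positivity⟩
    have := (tendsto_pow_atTop_nhds_zero_of_lt_one (r := (1 / 2 : ℝ)) (by norm_num)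
      (by norm_num)).const_mul 2
    rw [mul_zero] at this
    refine this.congr fun k => ?_
    rw [zpow_neg, zpow_natCast, one_div, inv_pow]
  have h1 := hx (fun _ : ℕ => x) _ hr (Eventually.of_forall fun k => by
    refine Metric.mem_closedBall_self ?_
    positivity)
  -- The factor 4π is the ratio of the areas of the disc of radius 2ρ and of the square of side ρ.
  have h2 := (h1.const_mul (4 * Real.pi)).const_add l
  rw [mul_zero, add_zero] at h2
  refine ge_of_tendsto' h2 fun k => ?_
  set ρ : ℝ := 2 ^ (-(k : ℤ)) with hρ
  have hρ0 : 0 < ρ := by positivity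
  set Q := dyadicSquare k (dyadicIndex k x) with hQ
  set B := Metric.closedBall x (2 * ρ) with hB
  have hQB : Q ⊆ B := dyadicSquare_subset_closedBall rfl
  have hQm : MeasurableSet Q := measurableSet_dyadicSquare _ _
  have hQv : volume Q = ENNReal.ofReal (ρ ^ 2) := volume_dyadicSquare _ _
  have hQr : volume.real Q = ρ ^ 2 := by
    rw [measureReal_def, hQv, ENNReal.toReal_ofReal (by positivity)]
  have hBr : volume.real B = 4 * Real.pi * ρ ^ 2 := by
    rw [measureReal_def, hB, EuclideanSpace.volume_closedBall_fin_two,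
      ← ENNReal.ofReal_pow (by positivity), ← ENNReal.ofReal_mul (by positivity),
      ENNReal.toReal_ofReal (by positivity)]
    ring
  have huB : IntegrableOn u B := hu.integrableOn_isCompact (isCompact_closedBall _ _)
  have hcB : IntegrableOn (fun y => ‖u y - u x‖) B :=
    (huB.sub (integrableOn_const (isCompact_closedBall x _).measure_lt_top.ne)).norm
  have hcQ := hcB.mono_set hQB
  have huQ := (huB.mono_set hQB).norm
  have h3 : ∫ y in Q, ‖u y‖ ≤ l * ρ ^ 2 := by
    have := hlight k
    rw [IsHeavy, not_lt, ← hQ, hQv, ← ENNReal.ofReal_mul hl.le] at this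
    rw [integral_norm_eq_lintegral_enorm (huB.mono_set hQB).aestronglyMeasurable]
    exact ENNReal.toReal_le_of_le_ofReal (by positivity) this
  have h4 : ∫ y in Q, ‖u y - u x‖ ≤ 4 * Real.pi * ρ ^ 2 * ⨍ y in B, ‖u y - u x‖ := by
    rw [setAverage_eq, hBr, smul_eq_mul, mul_inv_cancel_left₀ (by positivity)]
    exact setIntegral_mono_set hcB (Eventually.of_forall fun _ => norm_nonneg _)
      hQB.eventuallyLE
  have h5 : ρ ^ 2 * ‖u x‖ ≤ ∫ y in Q, (‖u y‖ + ‖u y - u x‖) := by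
    rw [← hQr, ← smul_eq_mul, ← setIntegral_const]
    refine setIntegral_mono (integrableOn_const (by rw [hQv]; exact ENNReal.ofReal_ne_top))
      (huQ.add hcQ) fun y => ?_
    have := norm_sub_le (u y) (u y - u x)
    rwa [sub_sub_cancel] at this
  rw [integral_add huQ hcQ] at h5
  have h6 : ρ ^ 2 * ‖u x‖ ≤ ρ ^ 2 * (l + 4 * Real.pi * ⨍ y in B, ‖u y - u x‖) := by
    linarith
  exact le_of_mul_le_mul_left h6 (by positivity)

/-- The maximal heavy dyadic squares form a stopping family. -/
theorem stoppingFamily_dyadic {u : L2Plane} {l : ℝ} (hl : 0 < l)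
    (hu : ∫⁻ x, ‖u x‖ₑ ≠ (⊤ : ℝ≥0∞)) :
    StoppingFamily u l (fun p : {p // IsStopping u l p} => dyadicSquare p.1.1 p.1.2)
      (fun p => WithLp.toLp 2 fun i => p.1.2 i * (2 : ℝ) ^ (-p.1.1))
      (fun p => (2 : ℝ) ^ (-p.1.1)) where
  meas p := measurableSet_dyadicSquare _ _
  disj := by
    rintro ⟨⟨k, n⟩, hp⟩ ⟨⟨k', n'⟩, hp'⟩ hne
    refine Set.disjoint_left.2 fun x hx hx' => ?_
    simp only at hx hx'
    rcases lt_trichotomy k k' with h | rfl | h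
    · refine hp'.2 k h x hx' ?_
      rw [show dyadicIndex k x = n from hx]
      exact hp.1
    · exact hne (by simp only [← show dyadicIndex k x = n from hx, ← show dyadicIndex k x = n' from hx'])
    · refine hp.2 k' h x hx ?_
      rw [show dyadicIndex k' x = n' from hx']
      exact hp'.1
  pos p := by positivity
  subset p := dyadicSquare_subset_corner _ _
  vol p := volume_dyadicSquare _ _
  lower p := p.2.1.le
  upper := by
    rintro ⟨⟨k, n⟩, hp⟩
    simp only
    rcases (dyadicSquare k n).eq_empty_or_nonempty with he | ⟨x, hx⟩
    · simp [he]
    -- Maximality makes the parent square light, and its area is four times larger.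
    · have h1 := hp.2 (k - 1) (sub_one_lt k) x hx
      rw [IsHeavy, not_lt, volume_dyadicSquare] at h1
      have h2 : dyadicSquare k n ⊆ dyadicSquare (k - 1) (dyadicIndex (k - 1) x) := fun y hy =>
        dyadicIndex_eq_of_le (sub_one_lt k).le
          ((show dyadicIndex k y = n from hy).trans (show dyadicIndex k x = n from hx).symm)
      refine (lintegral_mono_set h2).trans (h1.trans_eq ?_)
      rw [volume_dyadicSquare, ← ENNReal.ofReal_mul hl.le, ← ENNReal.ofReal_mul (by positivity),
        neg_sub, sub_eq_add_neg, zpow_add₀ two_ne_zero]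
      congr 1
      ring
  off := by
    have hloc : LocallyIntegrable u := (Lp.memLp u).locallyIntegrable (by norm_num)
    filter_upwards [ae_le_of_not_heavy hl hloc] with x hx hxE
    have h4 : l ≤ 4 * l := by linarith
    rw [← ofReal_norm]
    refine ENNReal.ofReal_le_ofReal ((hx fun k hk => hxE ?_).trans h4)
    obtain ⟨p, hp, hxp⟩ := exists_stopping hl hu hk
    exact Set.mem_iUnion_of_mem ⟨p, hp⟩ hxp

/-- **Calderón–Zygmund decomposition** adapted to order zero multipliers. -/
theorem IsKernelConstant.calderonZygmund {C : ℝ} (hC : IsKernelConstant C) {l : ℝ} (hl : 0 < l)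
    {u : L2Plane} {W : ℝ} (hW0 : 0 ≤ W) (hW : ∫⁻ x, ‖u x‖ₑ ≤ ENNReal.ofReal W) :
    ∃ (g : L2Plane) (O : Set Plane), MeasurableSet O ∧ ‖g‖ ^ 2 ≤ 4 * l * W ∧
      volume O ≤ ENNReal.ofReal (16 * Real.pi * W / l) ∧
      ∀ (a : ℝ) (m : Plane → ℂ), OrderZeroSymbol a m →
        ∫⁻ x in Oᶜ, ‖multOp m (u - g) x‖ₑ ≤ ENNReal.ofReal (16 * C * a * W) :=
  hC.exists_good_bad hl hW0 hW
    (stoppingFamily_dyadic hl (hW.trans_lt ENNReal.ofReal_lt_top).ne)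

/-! ### The logarithmic endpoint estimate -/

/-- Cauchy–Schwarz on a set of finite measure. -/
lemma setLIntegral_enorm_le_of_volume {v : L2Plane} {O : Set Plane} {τ s R : ℝ}
    (hτ0 : 0 ≤ τ) (hR : 0 ≤ R) (hτ : volume O ≤ ENNReal.ofReal τ) (hs : ‖v‖ ^ 2 ≤ s)
    (h : τ * s ≤ R ^ 2) : ∫⁻ x in O, ‖v x‖ₑ ≤ ENNReal.ofReal R := by
  have h1 := eLpNorm_le_eLpNorm_mul_rpow_measure_univ (μ := volume.restrict O) (p := 1) (q := 2)
    (by norm_num) (Lp.aestronglyMeasurable v).restrict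
  rw [eLpNorm_one_eq_lintegral_enorm, Measure.restrict_apply_univ] at h1
  have h2 : eLpNorm v 2 (volume.restrict O) ≤ ‖v‖ₑ := by
    rw [Lp.enorm_def]; exact eLpNorm_mono_measure _ Measure.restrict_le_self
  rw [← ENNReal.pow_le_pow_left_iff two_ne_zero]
  calc _ ≤ (‖v‖ₑ * volume O ^ (1 / 2 : ℝ)) ^ 2 := by
        gcongr
        refine h1.trans (le_trans (le_of_eq ?_) (mul_le_mul' h2 le_rfl))
        norm_num
    _ = volume O * ‖v‖ₑ ^ 2 := by
        rw [mul_pow, ← ENNReal.rpow_natCast (volume O ^ (1 / 2 : ℝ)), ← ENNReal.rpow_mul]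
        norm_num [mul_comm]
    _ ≤ ENNReal.ofReal τ * ENNReal.ofReal s := by
        gcongr
        rw [← ofReal_norm, ← ENNReal.ofReal_pow (norm_nonneg _)]
        exact ENNReal.ofReal_le_ofReal hs
    _ ≤ _ := by
        rw [← ENNReal.ofReal_mul hτ0, ← ENNReal.ofReal_pow hR]
        exact ENNReal.ofReal_le_ofReal h

lemma lintegral_enorm_le_of_split {v : L2Plane} {O : Set Plane} (hO : MeasurableSet O)
    {τ s R w : ℝ} (hτ0 : 0 ≤ τ) (hR : 0 ≤ R) (hw : 0 ≤ w) (hτ : volume O ≤ ENNReal.ofReal τ)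
    (hs : ‖v‖ ^ 2 ≤ s) (h : τ * s ≤ R ^ 2) (hout : ∫⁻ x in Oᶜ, ‖v x‖ₑ ≤ ENNReal.ofReal w) :
    ∫⁻ x, ‖v x‖ₑ ≤ ENNReal.ofReal (R + w) := by
  rw [← lintegral_add_compl _ hO, ENNReal.ofReal_add hR hw]
  exact add_le_add (setLIntegral_enorm_le_of_volume hτ0 hR hτ hs h) hout

lemma exists_height {G : ℝ} (hG : 0 ≤ G) :
    ∃ N : ℕ, G ^ 2 ≤ 2 ^ N ∧ (N : ℝ) ≤ 6 * Real.log (2 + G) := by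
  have h2 : (1 / 2 : ℝ) < Real.log 2 := by linarith [Real.log_two_gt_d9]
  have hL : Real.log 2 ≤ Real.log (2 + G) := Real.log_le_log (by norm_num) (by linarith)
  set L := Real.log (2 + G) with hLdef
  -- Since log 2 > 1/2, this gives 2^N ≥ e^{2L} = (2 + G)²; the rounding error 1 is at most 2L.
  refine ⟨⌈4 * L⌉₊, ?_, ?_⟩
  · calc G ^ 2 ≤ (2 + G) ^ 2 := by gcongr; linarith
      _ = Real.exp (2 * L) := by
          rw [hLdef, two_mul, Real.exp_add, Real.exp_log (by linarith), sq]
      _ ≤ Real.exp (Real.log 2 * ⌈4 * L⌉₊) := by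
          refine Real.exp_le_exp.2 ?_
          have := Nat.le_ceil (4 * L)
          nlinarith
      _ = 2 ^ ⌈4 * L⌉₊ := by
          rw [Real.exp_mul, Real.exp_log two_pos, Real.rpow_natCast]
  · have := (Nat.ceil_lt_add_one (by linarith : 0 ≤ 4 * L)).le
    linarith

/-- A logarithmic substitute for the failing `L¹` bound of an order zero multiplier, localized by a
coefficient which is bounded and square integrable. -/
theorem IsKernelConstant.endpoint {C : ℝ} (hC : IsKernelConstant C) {b : Plane → ℂ} {β : ℝ}
    (hbm : AEStronglyMeasurable b volume) (hβ0 : 0 ≤ β) (hb : ∀ x, ‖b x‖ ≤ β)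
    (hb2 : eLpNorm b 2 volume ≤ ENNReal.ofReal β) {μ : ℝ} {m : Plane → ℂ}
    (hm : OrderZeroSymbol μ m) {D F G : ℝ} (hD : 0 < D) (hF : 0 ≤ F) (hG : 0 ≤ G) {u : L2Plane}
    (hu1 : ∫⁻ x, ‖u x‖ₑ ≤ ENNReal.ofReal (D * F)) (hu2 : ‖u‖ ≤ D * G) :
    ∫⁻ x, ‖mulOp b (multOp m u) x‖ₑ ≤
      ENNReal.ofReal ((400 + 300 * C) * β * μ * D * (F * Real.log (2 + G) + 1)) := by
  have hCp := hC.1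
  have hμ := hm.nonneg
  have hπ : Real.pi ≤ 4 := Real.pi_le_four
  have hπ0 := Real.pi_pos
  -- Heights proportional to `D` make the exceptional sets of measure O(F/2^i), independent of `D`.
  -- The good parts and the sets are chosen before the multiplier, so they serve all heights and one
  -- fixed `m` consistently.
  have hl : ∀ i : ℕ, 0 < D * 2 ^ i := fun i => by positivity
  choose g O hO hg hvol hout using fun i : ℕ => hC.calderonZygmund (hl i) (by positivity) hu1
  have hvol' : ∀ i, volume (O i) ≤ ENNReal.ofReal (64 * F / 2 ^ i) := fun i => by
    refine (hvol i).trans (ENNReal.ofReal_le_ofReal ?_)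
    have e : 16 * Real.pi * (D * F) / (D * 2 ^ i) = Real.pi * (16 * (F / 2 ^ i)) := by field_simp
    have e' : 64 * F / 2 ^ i = 4 * (16 * (F / 2 ^ i)) := by ring
    rw [e, e']
    gcongr
  have hMn : ∀ h : L2Plane, ‖multOp m h‖ ≤ μ * ‖h‖ :=
    norm_multOp_apply_le hm.measurable hm.norm_le
  -- consecutive differences
  have hdiff : ∀ i, ∫⁻ x, ‖multOp m (g (i + 1) - g i) x‖ₑ ≤
      ENNReal.ofReal ((48 + 32 * C) * μ * (D * F)) := by
    intro i
    -- This 2^i cancels against the 2^{-i} in the measure of the exceptional sets under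
    -- Cauchy–Schwarz.
    have hnorm : ‖multOp m (g (i + 1) - g i)‖ ^ 2 ≤ μ ^ 2 * (24 * D ^ 2 * 2 ^ i * F) := by
      have h1 : ‖multOp m (g (i + 1) - g i)‖ ≤ μ * (‖g (i + 1)‖ + ‖g i‖) :=
        (hMn _).trans (by gcongr; exact norm_sub_le _ _)
      have h2 := hg i
      have h3 := hg (i + 1)
      rw [pow_succ (2 : ℝ) i] at h3
      calc _ ≤ (μ * (‖g (i + 1)‖ + ‖g i‖)) ^ 2 := by gcongr
        _ = μ ^ 2 * (‖g (i + 1)‖ + ‖g i‖) ^ 2 := mul_pow _ _ _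
        _ ≤ _ := by
            gcongr
            nlinarith [sq_nonneg (‖g (i + 1)‖ - ‖g i‖)]
    have hvolU : volume (O (i + 1) ∪ O i) ≤ ENNReal.ofReal (96 * F / 2 ^ i) := by
      refine (measure_union_le _ _).trans ((add_le_add (hvol' (i + 1)) (hvol' i)).trans_eq ?_)
      rw [← ENNReal.ofReal_add (by positivity) (by positivity), pow_succ (2 : ℝ) i]
      congr 1; field_simp; ring
    have hcompl : ∫⁻ x in (O (i + 1) ∪ O i)ᶜ, ‖multOp m (g (i + 1) - g i) x‖ₑ ≤
        ENNReal.ofReal (32 * C * μ * (D * F)) := by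
      -- Off the exceptional sets the difference of good parts is read as a difference of bad parts,
      -- each of which is controlled there.
      have e : multOp m (g (i + 1) - g i) = multOp m (u - g i) - multOp m (u - g (i + 1)) := by
        rw [← map_sub]; congr 1; abel
      rw [e]
      refine (setLIntegral_enorm_sub_le _ _ _).trans ?_
      refine (add_le_add ((lintegral_mono_set (Set.compl_subset_compl.2
        Set.subset_union_right)).trans (hout i μ m hm)) ((lintegral_mono_set
        (Set.compl_subset_compl.2 Set.subset_union_left)).trans (hout (i + 1) μ m hm))).trans_eq ?_
      rw [← ENNReal.ofReal_add (by positivity) (by positivity)]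
      congr 1; ring
    refine (lintegral_enorm_le_of_split ((hO _).union (hO _)) (R := 48 * μ * (D * F))
      (by positivity) (by positivity) (by positivity) hvolU hnorm ?_ hcompl).trans_eq ?_
    · have e : 96 * F / 2 ^ i * (μ ^ 2 * (24 * D ^ 2 * 2 ^ i * F)) =
        (48 * μ * (D * F)) ^ 2 := by
        field_simp; ring
      exact e.le
    · congr 1; ring
  obtain ⟨N, hN, hNL⟩ := exists_height hG
  set L := Real.log (2 + G) with hLdef
  have hL : 1 ≤ 2 * L := by
    have h2 : (1 / 2 : ℝ) < Real.log 2 := by linarith [Real.log_two_gt_d9]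
    have : Real.log 2 ≤ L := Real.log_le_log (by norm_num) (by linarith)
    linarith
  -- the last bad part
  have hlast : ∫⁻ x, ‖multOp m (u - g N) x‖ₑ ≤
      ENNReal.ofReal (40 * μ * (D * (F + 1)) + 16 * C * μ * (D * F)) := by
    have hnorm : ‖multOp m (u - g N)‖ ^ 2 ≤ μ ^ 2 * (2 * D ^ 2 * 2 ^ N * (1 + 4 * F)) := by
      have h1 : ‖multOp m (u - g N)‖ ≤ μ * (‖u‖ + ‖g N‖) :=
        (hMn _).trans (by gcongr; exact norm_sub_le _ _)
      have h2 := hg N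
      have h3 : ‖u‖ ^ 2 ≤ D ^ 2 * 2 ^ N :=
        calc _ ≤ (D * G) ^ 2 := by gcongr
          _ = D ^ 2 * G ^ 2 := mul_pow _ _ _
          _ ≤ _ := by gcongr
      calc _ ≤ (μ * (‖u‖ + ‖g N‖)) ^ 2 := by gcongr
        _ = μ ^ 2 * (‖u‖ + ‖g N‖) ^ 2 := mul_pow _ _ _
        _ ≤ _ := by
            gcongr
            nlinarith [sq_nonneg (‖u‖ - ‖g N‖)]
    refine lintegral_enorm_le_of_split (hO N) (by positivity) (by positivity) (by positivity)
      (hvol' N) hnorm ?_ ?_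
    · have e : 64 * F / 2 ^ N * (μ ^ 2 * (2 * D ^ 2 * 2 ^ N * (1 + 4 * F))) =
        (μ * D) ^ 2 * (128 * F * (1 + 4 * F)) := by field_simp; ring
      have e' : (40 * μ * (D * (F + 1))) ^ 2 = (μ * D) ^ 2 * (1600 * (F + 1) ^ 2) := by ring
      rw [e, e']
      refine mul_le_mul_of_nonneg_left ?_ (by positivity)
      nlinarith
    · exact hout N μ m hm
  -- Only here is the square integrability of `b` used: the lowest good part is merely in `L²`. All
  -- other pieces are already in `L¹` before multiplication by `b`.
  have hfirst : ∫⁻ x, ‖mulOp b (multOp m (g 0)) x‖ₑ ≤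
      ENNReal.ofReal (β * (μ * (2 * D * (F + 1)))) := by
    refine lintegral_mulOp_le (memLp_top_of_le hbm hb) hβ0 hb2 ((hMn _).trans ?_)
    gcongr
    have h0 := hg 0
    rw [pow_zero, mul_one] at h0
    refine (pow_le_pow_iff_left₀ (norm_nonneg _) (by positivity) two_ne_zero).1 (h0.trans ?_)
    have e : (2 * D * (F + 1)) ^ 2 = 4 * D * (D * F) + 4 * D ^ 2 * (F ^ 2 + F + 1) := by ring
    have : 0 ≤ 4 * D ^ 2 * (F ^ 2 + F + 1) := by positivity
    linarith
  have hsplit : mulOp b (multOp m u) = mulOp b (multOp m (g 0)) +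
      mulOp b (∑ i ∈ Finset.range N, multOp m (g (i + 1) - g i) + multOp m (u - g N)) := by
    rw [← map_sum, Finset.sum_range_sub, ← map_add, ← map_add, ← map_add]
    congr 2; abel
  have hrest : ∫⁻ x, ‖(∑ i ∈ Finset.range N, multOp m (g (i + 1) - g i) + multOp m (u - g N) :
      L2Plane) x‖ₑ ≤ ENNReal.ofReal (N * ((48 + 32 * C) * μ * (D * F)) +
        (40 * μ * (D * (F + 1)) + 16 * C * μ * (D * F))) := by
    rw [ENNReal.ofReal_add (by positivity) (by positivity)]
    refine (lintegral_enorm_add_le _ _).trans (add_le_add ?_ hlast)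
    refine (lintegral_enorm_sum_le _ _).trans ((Finset.sum_le_sum fun i _ => hdiff i).trans_eq ?_)
    rw [Finset.sum_const, Finset.card_range, nsmul_eq_mul,
      ENNReal.ofReal_mul (p := (N : ℝ)) (by positivity), ENNReal.ofReal_natCast]
  rw [hsplit]
  refine (lintegral_enorm_add_le _ _).trans
    ((add_le_add hfirst (lintegral_mulOp_le' hbm hβ0 hb hrest)).trans ?_)
  rw [← ENNReal.ofReal_add (by positivity) (by positivity)]
  refine ENNReal.ofReal_le_ofReal ?_
  have e1 : β * (μ * (2 * D * (F + 1))) + β * (N * ((48 + 32 * C) * μ * (D * F)) +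
      (40 * μ * (D * (F + 1)) + 16 * C * μ * (D * F))) =
      β * μ * D * (42 + F * (42 + 16 * C) + N * ((48 + 32 * C) * F)) := by ring
  have e2 : (400 + 300 * C) * β * μ * D * (F * L + 1) =
      β * μ * D * ((400 + 300 * C) * (F * L + 1)) := by ring
  rw [e1, e2]
  gcongr
  have h1 : F * (42 + 16 * C) ≤ F * (42 + 16 * C) * (2 * L) :=
    le_mul_of_one_le_right (by positivity) hL
  have h2 : (N : ℝ) * ((48 + 32 * C) * F) ≤ 6 * L * ((48 + 32 * C) * F) := by gcongr
  have h3 : 0 ≤ F * L := mul_nonneg hF (by linarith)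
  nlinarith [mul_nonneg hCp.le h3]

/-! ### Decomposition of Besov coefficients -/

lemma norm_integral_mul_le {k : Plane → ℂ} (hk : MemLp k 2 (volume : Measure Plane)) {R : ℝ}
    (hR : 0 ≤ R) (hkR : ∫⁻ y, ‖k y‖ₑ ^ 2 ≤ ENNReal.ofReal (R ^ 2)) (h : L2Plane) :
    ‖∫ y, k y * h y‖ ≤ R * ‖h‖ := by
  have h1 : eLpNorm k 2 volume ≤ ENNReal.ofReal R := by
    rw [← ENNReal.pow_le_pow_left_iff two_ne_zero, ← ENNReal.ofReal_pow hR]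
    rwa [← Lp.enorm_toLp hk, enorm_sq_eq_lintegral,
      lintegral_congr_ae (g := fun y => ‖k y‖ₑ ^ 2) (hk.coeFn_toLp.mono fun y hy => by
        simp only [hy])]
  rw [← ENNReal.ofReal_le_ofReal_iff (by positivity), ofReal_norm, ENNReal.ofReal_mul hR,
    ofReal_norm]
  exact (enorm_integral_le_lintegral_enorm _).trans
    ((lintegral_mul_enorm_le hk h).trans (mul_le_mul' h1 le_rfl))

/-- **Bernstein's inequality**: band-limited functions have bounded Lipschitz representatives. -/
lemma exists_bernstein : ∃ C : ℝ, 1 ≤ C ∧ ∀ (n : ℕ) (h : L2Plane),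
    multOp (lowSymbol n) h = h → ∃ p : Plane → ℂ, p =ᵐ[volume] h ∧
      (∀ x, ‖p x‖ ≤ C * 2 ^ n * ‖h‖) ∧
      ∀ x y, ‖p x - p y‖ ≤ C * (2 ^ n) ^ 2 * ‖h‖ * ‖x - y‖ := by
  obtain ⟨C₀, hC₀, H⟩ := exists_lowSymbol_kernelBounds
  have hle : C₀ ≤ max C₀ 1 := le_max_left _ _
  refine ⟨max C₀ 1, le_max_right _ _, fun n h hh => ?_⟩
  obtain ⟨s, hs, hK⟩ := H n
  set K : 𝓢(Plane, ℂ) := 𝓕⁻ s with hKdef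
  refine ⟨fun x => ∫ y, K (x - y) * h y, ?_, fun x => ?_, fun x z => ?_⟩
  · have := multOp_eq_convolution s h
    rw [hs, hh] at this
    exact this.symm
  · refine (norm_integral_mul_le (memLp_kernel K x) (R := C₀ * 2 ^ n) (by positivity) ?_ h).trans
      (by gcongr)
    rw [lintegral_sub_left_eq_self (fun y => ‖K y‖ₑ ^ 2) x]
    exact hK.l2
  · rw [← integral_sub (integrable_kernel_mul K x h) (integrable_kernel_mul K z h)]
    simp_rw [← sub_mul]
    have hxz : ‖z - x‖ = ‖x - z‖ := norm_sub_rev _ _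
    refine (norm_integral_mul_le ((memLp_kernel K x).sub (memLp_kernel K z))
      (R := C₀ * (2 ^ n) ^ 2 * ‖z - x‖) (by positivity) ?_ h).trans ?_
    · have e : ∀ y, ‖K (x - y) - K (z - y)‖ₑ ^ 2 =
          (fun w => ‖K (w - (z - x)) - K w‖ₑ ^ 2) (z - y) := fun y => by
        simp only; congr 4; abel
      simp only [Pi.sub_apply]
      rw [lintegral_congr e,
        lintegral_sub_left_eq_self (fun w => ‖K (w - (z - x)) - K w‖ₑ ^ 2) z]
      exact hK.shift_l2 _
    · rw [hxz, mul_right_comm]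
      gcongr

/-! ### The given Littlewood–Paley symbols and their partial sums -/

section Cutoff

variable {χ : Plane → ℝ}

/-- The symbol of `P_{≤ 0}`. -/
noncomputable def lpLowSymbol (χ : Plane → ℝ) (ξ : Plane) : ℝ :=
  1 - ∑' k : ℕ, χ ((2 : ℝ) ^ (-((k : ℤ) + 1)) • ξ)

lemma norm_zpow_smul (k : ℤ) (ξ : Plane) : ‖(2 : ℝ) ^ k • ξ‖ = 2 ^ k * ‖ξ‖ := by
  rw [norm_smul, Real.norm_of_nonneg (by positivity)]

lemma cutoff_zero (hχ : IsLittlewoodPaleyCutoff χ) : χ 0 = 0 := by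
  by_contra h
  have := (hχ.support 0 h).1
  rw [norm_zero] at this
  norm_num at this

lemma exists_cutoff_bound (hχ : IsLittlewoodPaleyCutoff χ) : ∃ B : ℝ, 0 ≤ B ∧ ∀ ξ, |χ ξ| ≤ B := by
  have hc : HasCompactSupport χ :=
    HasCompactSupport.intro (isCompact_closedBall (0 : Plane) 2) fun ξ hξ => by
      by_contra hne
      exact hξ (by simpa using (hχ.support ξ hne).2)
  obtain ⟨B, hB⟩ := hχ.smooth.continuous.bounded_above_of_compact_support hc
  exact ⟨B, (norm_nonneg _).trans (hB 0), hB⟩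

lemma summable_cutoff (hχ : IsLittlewoodPaleyCutoff χ) (ξ : Plane) :
    Summable fun k : ℕ => χ ((2 : ℝ) ^ (-((k : ℤ) + 1)) • ξ) := by
  rcases eq_or_ne ξ 0 with rfl | hξ
  · simp only [smul_zero, cutoff_zero hχ]
    exact summable_zero
  · exact (hχ.partition ξ hξ).summable.comp_injective
      (i := fun k : ℕ => (k : ℤ) + 1) fun a b h => by simpa using h

lemma lpLowSymbol_eq_one (hχ : IsLittlewoodPaleyCutoff χ) {ξ : Plane} (h : ‖ξ‖ < 1) :
    lpLowSymbol χ ξ = 1 := by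
  have : ∀ k : ℕ, χ ((2 : ℝ) ^ (-((k : ℤ) + 1)) • ξ) = 0 := by
    intro k
    by_contra hne
    have h1 := (hχ.support _ hne).1
    rw [norm_zpow_smul] at h1
    have h2 : (2 : ℝ) ^ (-((k : ℤ) + 1)) ≤ 1 / 2 :=
      (zpow_le_zpow_right₀ one_le_two (by omega : -((k : ℤ) + 1) ≤ -1)).trans_eq (by norm_num)
    have h3 : (0 : ℝ) < 2 ^ (-((k : ℤ) + 1)) := by positivity
    nlinarith [norm_nonneg ξ]
  rw [lpLowSymbol, tsum_congr this, tsum_zero, sub_zero]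

/-- When |ξ| > 2 the terms with k ≤ 0 of the partition of unity vanish, so those with k ≥ 1 already
add up to 1. -/
lemma lpLowSymbol_eq_zero (hχ : IsLittlewoodPaleyCutoff χ) {ξ : Plane} (h : 2 < ‖ξ‖) :
    lpLowSymbol χ ξ = 0 := by
  have hξ : ξ ≠ 0 := by
    rintro rfl
    rw [norm_zero] at h
    linarith
  have hinj : Function.Injective fun k : ℕ => (k : ℤ) + 1 := fun a b h => by simpa using h
  have h1 := hinj.hasSum_iff (f := fun k : ℤ => χ ((2 : ℝ) ^ (-k) • ξ)) (a := 1)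
    (fun k hk => by
      by_contra hne
      have hk0 : k ≤ 0 := by
        by_contra! hlt
        exact hk ⟨(k - 1).toNat, by simp only; omega⟩
      have h1 := (hχ.support _ hne).2
      rw [norm_zpow_smul] at h1
      have h2 : (2 : ℝ) ^ (0 : ℤ) ≤ 2 ^ (-k) := zpow_le_zpow_right₀ one_le_two (by omega)
      rw [zpow_zero] at h2
      nlinarith)
  have h2 := (h1.2 (hχ.partition ξ hξ)).tsum_eq
  simp only [Function.comp_def] at h2
  rw [lpLowSymbol, h2, sub_self]

/-- Together with the vanishing outside the ball of radius 2, this finite formula yields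
measurability and boundedness of the symbol. -/
lemma lpLowSymbol_eq_of_le (hχ : IsLittlewoodPaleyCutoff χ) {ξ : Plane} (h : ‖ξ‖ ≤ 2) :
    lpLowSymbol χ ξ = 1 - (χ ((2 : ℝ) ^ (-1 : ℤ) • ξ) + χ ((2 : ℝ) ^ (-2 : ℤ) • ξ)) := by
  rw [lpLowSymbol, tsum_eq_sum (s := Finset.range 2), Finset.sum_range_succ,
    Finset.sum_range_succ, Finset.sum_range_zero]
  · norm_num
  · intro k hk
    have hk2 : 2 ≤ k := not_lt.1 fun h => hk (Finset.mem_range.2 h)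
    by_contra hne
    have h1 := (hχ.support _ hne).1
    rw [norm_zpow_smul] at h1
    have h2 : (2 : ℝ) ^ (-((k : ℤ) + 1)) ≤ 1 / 8 :=
      (zpow_le_zpow_right₀ one_le_two (by omega : -((k : ℤ) + 1) ≤ -3)).trans_eq (by norm_num)
    have h3 : (0 : ℝ) < 2 ^ (-((k : ℤ) + 1)) := by positivity
    nlinarith [norm_nonneg ξ]

lemma measurable_lpLowSymbol (hχ : IsLittlewoodPaleyCutoff χ) : Measurable (lpLowSymbol χ) := by
  have e : lpLowSymbol χ = (Metric.closedBall (0 : Plane) 2).indicator fun ξ =>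
      1 - (χ ((2 : ℝ) ^ (-1 : ℤ) • ξ) + χ ((2 : ℝ) ^ (-2 : ℤ) • ξ)) := by
    funext ξ
    by_cases h : ‖ξ‖ ≤ 2
    · rw [Set.indicator_of_mem (by simpa using h), lpLowSymbol_eq_of_le hχ h]
    · rw [Set.indicator_of_notMem (by simpa using h), lpLowSymbol_eq_zero hχ (not_le.1 h)]
  rw [e]
  have hc := hχ.smooth.continuous
  exact Measurable.indicator (Continuous.measurable (by fun_prop)) measurableSet_closedBall

lemma abs_lpLowSymbol_le (hχ : IsLittlewoodPaleyCutoff χ) {B : ℝ} (hB0 : 0 ≤ B)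
    (hB : ∀ ξ, |χ ξ| ≤ B) (ξ : Plane) : |lpLowSymbol χ ξ| ≤ 1 + 2 * B := by
  by_cases h : ‖ξ‖ ≤ 2
  · rw [lpLowSymbol_eq_of_le hχ h]
    have h1 := abs_le.1 (hB ((2 : ℝ) ^ (-1 : ℤ) • ξ))
    have h2 := abs_le.1 (hB ((2 : ℝ) ^ (-2 : ℤ) • ξ))
    rw [abs_le]
    constructor <;> linarith
  · rw [lpLowSymbol_eq_zero hχ (not_le.1 h), abs_zero]
    linarith

/-- The symbols of `P_{≤ 0}` and of `P_k`, `k ≥ 1`. -/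
noncomputable def lpSymbol (χ : Plane → ℝ) : ℕ → Plane → ℂ
  | 0 => fun ξ => ((lpLowSymbol χ ξ : ℝ) : ℂ)
  | k + 1 => fun ξ => ((χ ((2 : ℝ) ^ (-((k + 1 : ℕ) : ℤ)) • ξ) : ℝ) : ℂ)

/-- The partial sums telescope to dilates of one bounded function, so they are bounded uniformly in
`n` without any sign condition on `χ`. -/
lemma sum_lpSymbol (hχ : IsLittlewoodPaleyCutoff χ) (n : ℕ) (ξ : Plane) :
    ∑ k ∈ Finset.range (n + 1), lpSymbol χ k ξ =
      ((lpLowSymbol χ ((2 : ℝ) ^ (-(n : ℤ)) • ξ) : ℝ) : ℂ) := by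
  rw [Finset.sum_range_succ']
  simp only [lpSymbol]
  rw [← Complex.ofReal_sum, ← Complex.ofReal_add]
  congr 1
  have h1 := (summable_cutoff hχ ξ).sum_add_tsum_nat_add n
  simp only [lpLowSymbol]
  rw [← h1]
  have h2 : ∀ k : ℕ, (2 : ℝ) ^ (-((k : ℤ) + 1)) • (2 : ℝ) ^ (-(n : ℤ)) • ξ =
      (2 : ℝ) ^ (-(((k + n : ℕ) : ℤ) + 1)) • ξ := fun k => by
    rw [smul_smul, ← zpow_add₀ two_ne_zero]
    congr 2
    push_cast
    ring
  simp only [h2, Nat.cast_add, Nat.cast_one]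
  ring

lemma exists_lpSymbol_bound (hχ : IsLittlewoodPaleyCutoff χ) : ∃ B : ℝ, 0 ≤ B ∧
    (∀ ξ, |lpLowSymbol χ ξ| ≤ B) ∧ ∀ k ξ, ‖lpSymbol χ k ξ‖ ≤ B := by
  obtain ⟨B, hB0, hB⟩ := exists_cutoff_bound hχ
  have h := abs_lpLowSymbol_le hχ hB0 hB
  refine ⟨1 + 2 * B, by positivity, h, fun k ξ => ?_⟩
  match k with
  | 0 => rw [lpSymbol, Complex.norm_real]; exact h ξ
  | k + 1 =>
    rw [lpSymbol, Complex.norm_real]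
    exact (hB _).trans (by linarith)

lemma measurable_lpSymbol (hχ : IsLittlewoodPaleyCutoff χ) (k : ℕ) :
    AEStronglyMeasurable (lpSymbol χ k) volume :=
  match k with
  | 0 => (Complex.measurable_ofReal.comp (measurable_lpLowSymbol hχ)).aestronglyMeasurable
  | _ + 1 => (Complex.continuous_ofReal.comp
      (hχ.smooth.continuous.comp (continuous_const_smul _))).aestronglyMeasurable

lemma memLp_lpSymbol (hχ : IsLittlewoodPaleyCutoff χ) (k : ℕ) :
    MemLp (lpSymbol χ k) ∞ (volume : Measure Plane) := by
  obtain ⟨B, -, -, hB⟩ := exists_lpSymbol_bound hχ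
  exact memLp_top_of_le (measurable_lpSymbol hχ k) (hB k)

lemma lowSymbol_mul_lpSymbol (hχ : IsLittlewoodPaleyCutoff χ) (k : ℕ) (ξ : Plane) :
    lowSymbol (k + 1) ξ * lpSymbol χ k ξ = lpSymbol χ k ξ := by
  by_cases h0 : lpSymbol χ k ξ = 0
  · rw [h0, mul_zero]
  · rw [lowSymbol_eq_one, one_mul]
    match k with
    | 0 =>
      by_contra hlt
      rw [zero_add, pow_one, not_le] at hlt
      exact h0 (by simp only [lpSymbol, lpLowSymbol_eq_zero hχ hlt, Complex.ofReal_zero])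
    | k + 1 =>
      have h1 := (hχ.support _ (Complex.ofReal_ne_zero.1 h0)).2
      rw [norm_zpow_smul, zpow_neg, zpow_natCast, inv_mul_le_iff₀ (by positivity)] at h1
      rw [pow_succ]
      linarith

lemma tendsto_sum_lpSymbol (hχ : IsLittlewoodPaleyCutoff χ) (h : L2Plane) :
    Tendsto (fun n => ∑ k ∈ Finset.range (n + 1), multOp (lpSymbol χ k) h) atTop (𝓝 h) := by
  obtain ⟨B, -, hB, -⟩ := exists_lpSymbol_bound hχ
  set s : ℕ → Plane → ℂ := fun n ξ => ∑ k ∈ Finset.range (n + 1), lpSymbol χ k ξ with hs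
  have hm : ∀ n, AEStronglyMeasurable (s n) volume := fun n => by
    have := Finset.aestronglyMeasurable_sum (Finset.range (n + 1))
      fun k _ => measurable_lpSymbol hχ k
    refine this.congr (ae_of_all _ fun ξ => ?_)
    rw [Finset.sum_apply]
  have hb : ∀ n ξ, ‖s n ξ‖ ≤ B := fun n ξ => by
    simp only [hs]
    rw [sum_lpSymbol hχ, Complex.norm_real]
    exact hB _
  have hlim : ∀ ξ, Tendsto (fun n => s n ξ) atTop (𝓝 1) := fun ξ => by
    obtain ⟨N, hN⟩ := pow_unbounded_of_one_lt ‖ξ‖ (one_lt_two : (1 : ℝ) < 2)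
    refine tendsto_const_nhds.congr' ?_
    filter_upwards [eventually_ge_atTop N] with n hn
    simp only [hs]
    rw [sum_lpSymbol hχ, lpLowSymbol_eq_one hχ, Complex.ofReal_one]
    rw [norm_zpow_smul, zpow_neg, zpow_natCast, inv_mul_lt_iff₀ (by positivity), mul_one]
    exact hN.trans_le (pow_le_pow_right₀ one_le_two hn)
  have h1 := tendsto_multOp (b := fun _ => 1) hm hb hlim h
  rw [multOp_one] at h1
  refine h1.congr fun n => ?_
  have hsum : ∀ n, multOp (s n) h = ∑ k ∈ Finset.range (n + 1), multOp (lpSymbol χ k) h := by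
    intro n
    induction n with
    | zero => simp [hs]
    | succ n ih =>
      rw [Finset.sum_range_succ, ← ih, ← sub_eq_iff_eq_add',
        ← multOp_sub (memLp_top_of_le (hm _) (hb _)) (memLp_top_of_le (hm _) (hb _))]
      congr 2
      funext ξ
      simp only [hs]
      rw [Finset.sum_range_succ, add_sub_cancel_left]
  exact hsum n

end Cutoff

/-- Functions in the Besov space `B^1_{2,1}` decompose into frequency-localized pieces. -/
theorem exists_coeffDecomp {χ : Plane → ℝ} (hχ : IsLittlewoodPaleyCutoff χ) :
    ∃ C : ℝ, 0 < C ∧ ∀ (a : Plane → ℂ) (A : ℝ), 0 ≤ A → besovNorm χ a ≤ ENNReal.ofReal A →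
      ∃ p α, CoeffDecomp (C * A) p α ∧ a =ᵐ[volume] coeffSum p := by
  obtain ⟨C, hC, H⟩ := exists_bernstein
  have hC0 : 0 < C := by linarith
  -- The k-th piece lives below 2^{k+1}, so its Lipschitz constant contains (2^{k+1})² = 4·4^k; this
  -- dictates the factor 4.
  refine ⟨4 * C, by positivity, fun a A hA hbes => ?_⟩
  have ha : MemLp a 2 (volume : Measure Plane) := by
    by_contra hna
    rw [besovNorm, if_neg hna] at hbes
    exact absurd hbes (not_le.2 ENNReal.ofReal_lt_top)
  rw [besovNorm, if_pos ha] at hbes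
  set q : ℕ → L2Plane := fun k => multOp (lpSymbol χ k) (ha.toLp a) with hq
  have hlow : eLpNorm (lpLow χ a) 2 volume = ‖q 0‖ₑ := by
    have e : lpLow χ a = q 0 := fourierMultiplier_eq (memLp_lpSymbol hχ 0) ha
    rw [e, Lp.enorm_def]
  have hproj : ∀ k, eLpNorm (lpProj χ (k + 1) a) 2 volume = ‖q (k + 1)‖ₑ := fun k => by
    have e : lpProj χ (k + 1) a = q (k + 1) := fourierMultiplier_eq (memLp_lpSymbol hχ (k + 1)) ha
    rw [e, Lp.enorm_def]
  have hsum : ∑' k, ENNReal.ofReal (2 ^ k * ‖q k‖) ≤ ENNReal.ofReal A := by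
    refine le_trans (le_of_eq ?_) hbes
    rw [tsum_eq_zero_add' ENNReal.summable, hlow]
    congr 1
    · rw [pow_zero, one_mul, ofReal_norm]
    · refine tsum_congr fun k => ?_
      rw [hproj, ENNReal.ofReal_mul (by positivity), ENNReal.ofReal_pow zero_le_two,
        ENNReal.ofReal_ofNat, ofReal_norm]
  have hsummable : Summable fun k => 2 ^ k * ‖q k‖ := by
    have := ENNReal.summable_toReal (hsum.trans_lt ENNReal.ofReal_lt_top).ne
    refine this.congr fun k => ?_
    rw [ENNReal.toReal_ofReal (by positivity)]
  have htsum : ∑' k, 2 ^ k * ‖q k‖ ≤ A := by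
    rwa [← ENNReal.ofReal_tsum_of_nonneg (fun k => by positivity) hsummable,
      ENNReal.ofReal_le_ofReal_iff hA] at hsum
  have hloc : ∀ k, multOp (lowSymbol (k + 1)) (q k) = q k := fun k => by
    simp only [hq]
    rw [← multOp_mul (memLp_lowSymbol _) (memLp_lpSymbol hχ k)]
    simp only [lowSymbol_mul_lpSymbol hχ]
  choose p hpq hpb hpl using fun k => H (k + 1) (q k) (hloc k)
  refine ⟨p, fun k => 4 * C * (2 ^ k * ‖q k‖), ?_, ?_⟩
  · refine ⟨fun k => by positivity, hsummable.mul_left _, ?_, fun k => ?_, fun k x => ?_,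
      fun k => ?_, fun k x y => ?_⟩
    · rw [tsum_mul_left]
      gcongr
    · refine LipschitzWith.continuous (K := (C * (2 ^ (k + 1)) ^ 2 * ‖q k‖).toNNReal)
        (LipschitzWith.of_dist_le_mul fun x y => ?_)
      rw [dist_eq_norm, dist_eq_norm, Real.coe_toNNReal _ (by positivity)]
      exact hpl k x y
    · refine (hpb k x).trans ?_
      have : 0 ≤ C * (2 ^ k * ‖q k‖) := by positivity
      rw [pow_succ]
      linarith
    · rw [eLpNorm_congr_ae (hpq k), ← Lp.enorm_def]
      refine enorm_le_of_norm_le ?_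
      have e : 4 * C * (2 ^ k * ‖q k‖) / 2 ^ k = 4 * C * ‖q k‖ := by field_simp
      rw [e]
      exact le_mul_of_one_le_left (norm_nonneg _) (by linarith)
    · refine (hpl k x y).trans (le_of_eq ?_)
      rw [pow_succ]
      ring
  · have hqs : Summable fun k => ‖q k‖ :=
      Summable.of_nonneg_of_le (fun k => norm_nonneg _) (fun k =>
        le_mul_of_one_le_left (norm_nonneg _) (one_le_pow₀ one_le_two)) hsummable
    have e : ∑' k, q k = ha.toLp a :=
      tendsto_nhds_unique ((hqs.of_norm.hasSum.tendsto_sum_nat).comp (tendsto_add_atTop_nat 1))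
        (tendsto_sum_lpSymbol hχ _)
    filter_upwards [Lp.hasSum_coeFn_tsum (CoeffDecomp.tsum_enorm_ne_top hqs fun k => le_rfl),
      ae_all_iff.2 hpq, ha.coeFn_toLp] with x h1 h2 h3
    rw [e, h3] at h1
    simp only [← h2] at h1
    exact h1.tsum_eq.symm

/-! ### Iteration -/

/-- The operator `a₁ M₁ ⋯ aₙ Mₙ` on `L²`, given the list of the pairs `(aᵢ, mᵢ)`. -/
noncomputable def chain (L : List ((Plane → ℂ) × (Plane → ℂ))) (f : L2Plane) : L2Plane :=
  L.foldr (fun q h => mulOp q.1 (multOp q.2 h)) f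

@[simp] lemma chain_nil (f : L2Plane) : chain [] f = f := rfl

@[simp] lemma chain_cons (q : (Plane → ℂ) × (Plane → ℂ)) (L : List ((Plane → ℂ) × (Plane → ℂ)))
    (f : L2Plane) : chain (q :: L) f = mulOp q.1 (multOp q.2 (chain L f)) := rfl

/-- A pair of a coefficient with a Besov decomposition and an order zero symbol. -/
def AdmissiblePair (A c : ℝ) (q : (Plane → ℂ) × (Plane → ℂ)) : Prop :=
  (∃ p α, CoeffDecomp A p α ∧ q.1 =ᵐ[volume] coeffSum p) ∧ OrderZeroSymbol c q.2

lemma norm_chain_le {A c : ℝ} {L : List ((Plane → ℂ) × (Plane → ℂ))}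
    (hL : ∀ q ∈ L, AdmissiblePair A c q) (f : L2Plane) :
    ‖chain L f‖ ≤ (c * A) ^ L.length * ‖f‖ := by
  induction L with
  | nil => simp
  | cons q L ih =>
    obtain ⟨⟨p, α, hp, hqp⟩, hm⟩ := hL q List.mem_cons_self
    have h1 := ih fun q' hq' => hL q' (List.mem_cons_of_mem _ hq')
    have hA := hp.nonneg_const
    have hc := hm.nonneg
    rw [chain_cons, mulOp_congr hqp, List.length_cons]
    calc _ ≤ A * ‖multOp q.2 (chain L f)‖ := norm_mulOp_apply_le hp.measurable hp.norm_le _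
      _ ≤ A * (c * ‖chain L f‖) := by
          gcongr; exact norm_multOp_apply_le hm.measurable hm.norm_le _
      _ ≤ A * (c * ((c * A) ^ L.length * ‖f‖)) := by gcongr
      _ = _ := by ring

/-- Each factor costs a constant multiple of `A` and no logarithm, so the errors produced deep
inside the composition stay geometric. -/
lemma IsKernelConstant.bandBound_chain {C : ℝ} (hC : IsKernelConstant C) {D : ℝ}
    (hD : ∀ j, OrderZeroSymbol D (bandSymbol j)) {A c : ℝ}
    {L : List ((Plane → ℂ) × (Plane → ℂ))} (hL : ∀ q ∈ L, AdmissiblePair A c q) {B : ℝ}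
    (hB0 : 0 ≤ B) {f : L2Plane} (hB : BandBound B f) :
    BandBound (((1 + 3 * C * D + 3 * C * C) * (C * c) * A) ^ L.length * B) (chain L f) := by
  have hCp := hC.1
  have hD0 := (hD 0).nonneg
  induction L with
  | nil => simpa using hB
  | cons q L ih =>
    obtain ⟨⟨p, α, hp, hqp⟩, hm⟩ := hL q List.mem_cons_self
    have h1 := ih fun q' hq' => hL q' (List.mem_cons_of_mem _ hq')
    have hA := hp.nonneg_const
    have hc := hm.nonneg
    rw [chain_cons, mulOp_congr hqp, List.length_cons]
    have h2 := hp.bandBound_mulOp hC hD (by positivity) (hC.bandBound_multOp hm h1)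
    convert h2 using 1
    ring

/-- The estimate for `b M a₁ M₁ ⋯ aₙ Mₙ f`: each further factor `aᵢ` is commuted to the left. -/
theorem IsKernelConstant.chain_endpoint {C : ℝ} (hC : IsKernelConstant C) {D : ℝ}
    (hD : ∀ j, OrderZeroSymbol D (bandSymbol j)) {A c : ℝ} (hA : 0 < A) (hc : 0 < c)
    {F G : ℝ} (hF : 0 ≤ F) (hG : 0 ≤ G) {f : L2Plane}
    (hf1 : ∫⁻ x, ‖f x‖ₑ ≤ ENNReal.ofReal F) (hf2 : ‖f‖ ≤ G) {K : ℝ}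
    (hK : K = c * (17 + 2 * C + 9 * C ^ 3 + (1 + 3 * C * D + 3 * C * C) * C))
    {L : List ((Plane → ℂ) × (Plane → ℂ))} (hL : ∀ q ∈ L, AdmissiblePair A c q) :
    ∀ {b : Plane → ℂ} {β : ℝ}, AEStronglyMeasurable b volume → 0 ≤ β → (∀ x, ‖b x‖ ≤ β) →
    eLpNorm b 2 volume ≤ ENNReal.ofReal β → ∀ {μ : ℝ} {m : Plane → ℂ}, OrderZeroSymbol μ m →
    ∫⁻ x, ‖mulOp b (multOp m (chain L f)) x‖ₑ ≤ ENNReal.ofReal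
      ((400 + 300 * C) * β * μ * (K * A) ^ L.length * (F * Real.log (2 + G) + 1)) := by
  have hCp := hC.1
  have hD0 := (hD 0).nonneg
  have hlog : 1 ≤ 2 * Real.log (2 + G) := by
    have h2 : (1 / 2 : ℝ) < Real.log 2 := by linarith [Real.log_two_gt_d9]
    have : Real.log 2 ≤ Real.log (2 + G) := Real.log_le_log (by norm_num) (by linarith)
    linarith
  set N := F * Real.log (2 + G) + 1 with hN
  have hFN : F ≤ 2 * N := by
    have : F * 1 ≤ F * (2 * Real.log (2 + G)) := by gcongr
    linarith
  have hN0 : 0 < N := by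
    have : 0 ≤ F * Real.log (2 + G) := mul_nonneg hF (by linarith)
    linarith
  have hcK : c ≤ K := by
    rw [hK]
    refine le_mul_of_one_le_right hc.le ?_
    have : 0 ≤ 2 * C + 9 * C ^ 3 + (1 + 3 * C * D + 3 * C * C) * C := by positivity
    linarith
  have hK0 : 0 < K := hc.trans_le hcK
  have hbK : (1 + 3 * C * D + 3 * C * C) * (C * c) ≤ K := by
    have : 0 ≤ c * (17 + 2 * C + 9 * C ^ 3) := by positivity
    rw [hK]
    linarith
  -- The coefficient `b` and the symbol `m` stay arbitrary: the inductive step replaces them by `b`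
  -- times the new coefficient and `m` times the new symbol.
  induction L with
  | nil =>
    intro b β hbm hβ0 hb hb2 μ m hm
    refine (hC.endpoint hbm hβ0 hb hb2 hm one_pos hF hG (u := f) (by simpa using hf1)
      (by simpa using hf2)).trans (le_of_eq ?_)
    simp only [List.length_nil, pow_zero, mul_one, hN]
  | cons q L ih =>
    intro b β hbm hβ0 hb hb2 μ m hm
    have hL' : ∀ q' ∈ L, AdmissiblePair A c q' := fun q' hq' => hL q' (List.mem_cons_of_mem _ hq')
    obtain ⟨⟨p, α, hp, hqp⟩, hq⟩ := hL q List.mem_cons_self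
    have hμ := hm.nonneg
    have hbtop := memLp_top_of_le hbm hb
    set P := (K * A) ^ L.length with hP
    have hP0 : 0 < P := by positivity
    set h := multOp q.2 (chain L f) with hh
    have hband : BandBound (C * c * (P * (C * F))) h := by
      have h1 := hC.bandBound_chain hD hL' (by positivity) (hC.bandBound_of_l1 hf1)
      have h2 := hC.bandBound_multOp hq h1
      intro j
      refine (h2 j).trans (ENNReal.ofReal_le_ofReal ?_)
      rw [hP]
      gcongr
    have hnorm : ‖h‖ ≤ c * (P * G) := by
      refine (norm_multOp_apply_le hq.measurable hq.norm_le _).trans ?_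
      have h1 := norm_chain_le hL' f
      rw [hP]
      calc _ ≤ c * ((c * A) ^ L.length * ‖f‖) := by gcongr
        _ ≤ _ := by gcongr
    obtain ⟨U, V, hUV, hU1, hV1, hU2⟩ := hp.commute hC hm (by positivity) hband
    have hsplit : mulOp b (multOp m (chain (q :: L) f)) =
        mulOp (fun x => b x * coeffSum p x) (multOp (fun ξ => m ξ * q.2 ξ) (chain L f)) +
          mulOp b V + mulOp b (multOp m U) := by
      rw [chain_cons, mulOp_congr hqp, hUV, map_add, map_add,
        mulOp_mul hbtop hp.memLp_top, multOp_mul hm.memLp_top hq.memLp_top]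
    have hmain := ih hL' (hbm.mul hp.measurable) (β := β * A) (by positivity)
      (fun x => by
        rw [Pi.mul_apply, norm_mul]
        exact mul_le_mul (hb x) (hp.norm_le x) (norm_nonneg _) hβ0)
      (by
        rw [ENNReal.ofReal_mul hβ0]
        refine (eLpNorm_le_mul_eLpNorm_of_ae_le_mul (c := β) (g := coeffSum p)
          (ae_of_all _ fun x => ?_) 2).trans (mul_le_mul' le_rfl hp.eLpNorm_le)
        rw [Pi.mul_apply, norm_mul]
        exact mul_le_mul_of_nonneg_right (hb x) (norm_nonneg _))
      (hm.mul hq)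
    have hVb := lintegral_mulOp_le' hbm hβ0 hb hV1
    -- The parameter `D` dominates both the `L¹` bound of `U` relative to `F` and its `L²` bound
    -- relative to `G`; hence the logarithm is again log(2 + G), whatever the length of the chain.
    have hUb := hC.endpoint hbm hβ0 hb hb2 hm (D := (3 * C ^ 3 + 1 + 2 * C) * c * A * P)
      (by positivity) hF hG (u := U)
      (hU1.trans (ENNReal.ofReal_le_ofReal (by
        have : 0 ≤ (1 + 2 * C) * c * A * P * F := by positivity
        linarith)))
      (hU2.trans (by
        have h1 : (1 + 2 * C) * A * ‖h‖ ≤ (1 + 2 * C) * A * (c * (P * G)) := by gcongr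
        have : 0 ≤ 3 * C ^ 3 * c * A * P * G := by positivity
        linarith))
    rw [hsplit]
    refine (lintegral_enorm_add_le _ _).trans ((add_le_add ((lintegral_enorm_add_le _ _).trans
      (add_le_add hmain hVb)) hUb).trans ?_)
    rw [← ENNReal.ofReal_add (by positivity) (by positivity),
      ← ENNReal.ofReal_add (by positivity) (by positivity)]
    refine ENNReal.ofReal_le_ofReal ?_
    rw [List.length_cons, pow_succ (K * A), ← hP, ← hN]
    -- The 17 in `K` is 16 from the product of symbols plus 1 from the `L²` bound of `U`, which also
    -- gives 2C. The 9C³ is 3C³ from the `L¹` bound of `U` and 6C³ from `V`, using F ≤ 2N. The last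
    -- summand of `K` covers the growth in `bandBound_chain`.
    have e1 : (400 + 300 * C) * (β * A) * (16 * μ * c) * P * N +
        β * (3 * C * μ * A * (C * c * (P * (C * F)))) +
        (400 + 300 * C) * β * μ * ((3 * C ^ 3 + 1 + 2 * C) * c * A * P) * N =
        β * μ * A * P * c * ((400 + 300 * C) * (17 + 2 * C + 3 * C ^ 3) * N + 3 * C ^ 3 * F) := by
      ring
    have e2 : (400 + 300 * C) * β * μ * (P * (K * A)) * N =
        β * μ * A * P * c * ((400 + 300 * C) *
          (17 + 2 * C + 9 * C ^ 3 + (1 + 3 * C * D + 3 * C * C) * C) * N) := by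
      rw [hK]; ring
    rw [e1, e2]
    gcongr
    have h1 : 3 * C ^ 3 * F ≤ 3 * C ^ 3 * (2 * N) := by gcongr
    have h2 : 0 ≤ (400 + 300 * C) * ((1 + 3 * C * D + 3 * C * C) * C) * N := by positivity
    have h3 : 1 * (6 * C ^ 3 * N) ≤ (400 + 300 * C) * (6 * C ^ 3 * N) := by
      gcongr; linarith
    linarith

/-! ### Weighted functions and compositions of functions -/

lemma foldr_const_eq_iterate {α : Type*} (g : α → α) (n : ℕ) (x : α) :
    Fin.foldr n (fun _ y => g y) x = g^[n] x := by
  induction n with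
  | zero => simp
  | succ n ih => rw [Fin.foldr_succ, ih, Function.iterate_succ_apply']

/-- Membership in `L²` and the identification with `chain` are proved together, since each stage of
`fourierMultiplier` is meaningful only once the previous one is known to be in `L²`. -/
lemma exists_toLp_foldr {n : ℕ} {a m : Fin n → Plane → ℂ}
    (ha : ∀ i, MemLp (a i) ∞ (volume : Measure Plane))
    (hm : ∀ i, MemLp (m i) ∞ (volume : Measure Plane)) {f : Plane → ℂ}
    (hf : MemLp f 2 (volume : Measure Plane)) :
    ∃ h : MemLp (Fin.foldr n (fun i g => coeffMultiplier (a i) (m i) g) f) 2 volume,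
      h.toLp _ = chain (List.ofFn fun i => (a i, m i)) (hf.toLp f) := by
  induction n with
  | zero => exact ⟨by simpa using hf, by simp⟩
  | succ n ih =>
    obtain ⟨h, hh⟩ := ih (fun i => ha i.succ) (fun i => hm i.succ)
    rw [List.ofFn_succ, chain_cons, ← hh, ← toLp_coeffMultiplier (ha 0) (hm 0) h]
    simp only [Fin.foldr_succ]
    exact ⟨memLp_coeffMultiplier (ha 0) (hm 0) h, trivial⟩

/-- The weight `<x>⁻³`. -/
noncomputable def decayWeight (x : Plane) : ℝ := (√(1 + ‖x‖ ^ 2) ^ 3)⁻¹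

lemma decayWeight_pos (x : Plane) : 0 < decayWeight x := by
  unfold decayWeight; positivity

lemma continuous_decayWeight : Continuous decayWeight := by
  unfold decayWeight
  refine Continuous.inv₀ (by fun_prop) fun x => ?_
  positivity

lemma integrable_decayWeight : Integrable decayWeight (volume : Measure Plane) := by
  have h := integrable_rpow_neg_one_add_norm_sq (E := Plane) (μ := volume) (r := 3)
    (by rw [finrank_euclideanSpace_fin]; norm_num)
  refine h.congr (ae_of_all _ fun x => ?_)
  have h0 : 0 ≤ 1 + ‖x‖ ^ 2 := by positivity
  simp only [decayWeight]
  rw [Real.sqrt_eq_rpow, ← Real.rpow_natCast (_ ^ (1 / 2 : ℝ)) 3, ← Real.rpow_mul h0, ← Real.rpow_neg h0]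
  norm_num

lemma decayWeight_le_one (x : Plane) : decayWeight x ≤ 1 := by
  refine inv_le_one_of_one_le₀ (one_le_pow₀ (Real.one_le_sqrt.2 ?_))
  linarith [sq_nonneg ‖x‖]

lemma memLp_decayWeight : MemLp decayWeight 2 (volume : Measure Plane) := by
  rw [memLp_two_iff_integrable_sq continuous_decayWeight.aestronglyMeasurable]
  refine integrable_decayWeight.mono' (continuous_decayWeight.pow 2).aestronglyMeasurable
    (ae_of_all _ fun x => ?_)
  have := decayWeight_pos x
  rw [Real.norm_of_nonneg (by positivity), sq]
  exact mul_le_of_le_one_left this.le (decayWeight_le_one x)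

lemma eq_decayWeight_mul (f : Plane → ℂ) :
    f = fun x => ((decayWeight x : ℝ) : ℂ) * cubicWeight f x := by
  funext x
  have h : (((√(1 + ‖x‖ ^ 2) ^ 3 : ℝ)) : ℂ) ≠ 0 := by
    rw [Complex.ofReal_ne_zero]; positivity
  rw [decayWeight, cubicWeight, Complex.ofReal_inv, inv_mul_cancel_left₀ h]

lemma aestronglyMeasurable_of_cubicWeight {f : Plane → ℂ}
    (hf : MemLp (cubicWeight f) ∞ (volume : Measure Plane)) : AEStronglyMeasurable f volume := by
  rw [eq_decayWeight_mul f]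
  exact (Complex.continuous_ofReal.comp continuous_decayWeight).aestronglyMeasurable.mul hf.1

lemma norm_le_decayWeight_mul {f : Plane → ℂ}
    (hf : MemLp (cubicWeight f) ∞ (volume : Measure Plane)) :
    ∀ᵐ x, ‖f x‖ ≤ (eLpNorm (cubicWeight f) ∞ volume).toReal * ‖decayWeight x‖ := by
  filter_upwards [ae_le_eLpNormEssSup (f := cubicWeight f) (μ := volume)] with x hx
  rw [← eLpNorm_exponent_top] at hx
  have e := congrFun (eq_decayWeight_mul f) x
  rw [e, norm_mul, Complex.norm_real, mul_comm]
  gcongr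
  rw [← toReal_enorm]
  exact ENNReal.toReal_mono hf.2.ne hx

lemma memLp_of_cubicWeight {f : Plane → ℂ}
    (hf : MemLp (cubicWeight f) ∞ (volume : Measure Plane)) :
    MemLp f 1 (volume : Measure Plane) ∧ MemLp f 2 (volume : Measure Plane) :=
  ⟨(memLp_one_iff_integrable.2 integrable_decayWeight).of_le_mul
      (aestronglyMeasurable_of_cubicWeight hf) (norm_le_decayWeight_mul hf),
    memLp_decayWeight.of_le_mul (aestronglyMeasurable_of_cubicWeight hf)
      (norm_le_decayWeight_mul hf)⟩

/-- The `L²` norm enters the logarithm only through the weighted supremum. -/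
lemma exists_logLossNorm_bound : ∃ C : ℝ, 1 ≤ C ∧ ∀ (f : Plane → ℂ)
    (hf : MemLp (cubicWeight f) ∞ (volume : Measure Plane)), ∃ G : ℝ, 0 ≤ G ∧
      ‖(memLp_of_cubicWeight hf).2.toLp f‖ ≤ G ∧
      (eLpNorm f 1 volume).toReal * Real.log (2 + G) + 1 ≤ C * logLossNorm f := by
  set R := ‖memLp_decayWeight.toLp decayWeight‖ with hR
  have hR0 : 0 ≤ R := norm_nonneg _
  have hlogR : 0 ≤ Real.log (1 + R) := Real.log_nonneg (by linarith)
  refine ⟨1 + 2 * Real.log (1 + R), by linarith, fun f hf => ?_⟩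
  set Y := (eLpNorm (cubicWeight f) ∞ volume).toReal with hY
  have hY0 : 0 ≤ Y := ENNReal.toReal_nonneg
  refine ⟨Y * R, by positivity, ?_, ?_⟩
  · refine Lp.norm_le_mul_norm_of_ae_le_mul ?_
    filter_upwards [norm_le_decayWeight_mul hf, (memLp_of_cubicWeight hf).2.coeFn_toLp,
      memLp_decayWeight.coeFn_toLp] with x h1 h2 h3
    rwa [h2, h3]
  · rw [logLossNorm, ← hY, abs_of_nonneg hY0]
    set F := (eLpNorm f 1 volume).toReal
    have hF0 : 0 ≤ F := ENNReal.toReal_nonneg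
    have hlog2 : (1 / 2 : ℝ) < Real.log 2 := by linarith [Real.log_two_gt_d9]
    have hL : Real.log 2 ≤ Real.log (2 + Y) := Real.log_le_log (by norm_num) (by linarith)
    -- This is 2 + YR ≤ (1 + R)(2 + Y); the additive constant log(1 + R) is then absorbed because 2
    -- log(2 + Y) ≥ 1.
    have h1 : Real.log (2 + Y * R) ≤ Real.log (1 + R) + Real.log (2 + Y) := by
      rw [← Real.log_mul (by positivity) (by positivity)]
      exact Real.log_le_log (by positivity) (by nlinarith)
    have h2 : Real.log (1 + R) * 1 ≤ Real.log (1 + R) * (2 * Real.log (2 + Y)) := by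
      gcongr; linarith
    have h3 : F * Real.log (2 + Y * R) ≤
        F * (Real.log (1 + R) * (2 * Real.log (2 + Y)) + Real.log (2 + Y)) := by
      gcongr; linarith
    linarith

/-! ### Assembly of the final estimate -/

/-- The estimate for compositions, for positive bounds on the coefficients. -/
theorem exists_composition_bound {χ : Plane → ℝ} (hχ : IsLittlewoodPaleyCutoff χ) {c : ℝ}
    (hc : 0 < c) :
    ∃ C : ℝ, 0 < C ∧ ∀ (n : ℕ), 1 ≤ n → ∀ (m a : Fin n → Plane → ℂ) (A : ℝ), 0 < A →
      (∀ i, IsCZSymbol c (m i)) → (∀ i, besovNorm χ (a i) ≤ ENNReal.ofReal A) →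
      ∀ f : Plane → ℂ, MemLp (cubicWeight f) ∞ volume →
        MemLp (Fin.foldr n (fun i g => coeffMultiplier (a i) (m i) g) f) 2 volume ∧
        eLpNorm (Fin.foldr n (fun i g => coeffMultiplier (a i) (m i) g) f) 1 volume
          ≤ ENNReal.ofReal (C ^ n * A ^ n * logLossNorm f) := by
  obtain ⟨C, hCp, hC'⟩ := exists_localized_kernelBounds
  have hC : IsKernelConstant C := ⟨hCp, hC'⟩
  obtain ⟨D, hD0, hD'⟩ := exists_isBandCutoff
  have hD : ∀ j, OrderZeroSymbol D (bandSymbol j) := fun j => (hD' j).1.1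
  obtain ⟨CB, hCB, hdec⟩ := exists_coeffDecomp hχ
  obtain ⟨CN, hCN, hN⟩ := exists_logLossNorm_bound
  obtain ⟨K, hK⟩ : ∃ K, K = 16 * c *
    (17 + 2 * C + 9 * C ^ 3 + (1 + 3 * C * D + 3 * C * C) * C) := ⟨_, rfl⟩
  have hK0 : 0 < K := by rw [hK]; positivity
  refine ⟨CB * ((400 + 300 * C) * (16 * c) * CN + K), by positivity, ?_⟩
  intro n hn m a A hA hm ha f hf
  have hadm : ∀ i, AdmissiblePair (CB * A) (16 * c) (a i, m i) := fun i => by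
    obtain ⟨p, α, hp, hap⟩ := hdec (a i) A hA.le (ha i)
    exact ⟨⟨p, α, hp, hap⟩, .of_isCZSymbol hc.le (hm i)⟩
  have hatop : ∀ i, MemLp (a i) ∞ (volume : Measure Plane) := fun i => by
    obtain ⟨⟨p, α, hp, hap⟩, -⟩ := hadm i
    exact (memLp_congr_ae hap).2 hp.memLp_top
  obtain ⟨hf1, hf2⟩ := memLp_of_cubicWeight hf
  obtain ⟨h, hh⟩ := exists_toLp_foldr hatop (m := m) (fun i => (hadm i).2.memLp_top) hf2
  refine ⟨h, ?_⟩
  obtain ⟨G, hG0, hG, hGN⟩ := hN f hf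
  obtain ⟨k, rfl⟩ : ∃ k, n = k + 1 := ⟨n - 1, by omega⟩
  -- The first pair plays the role of `b` and M in `chain_endpoint`, and the remaining `k` pairs
  -- form the chain; this is where n ≥ 1 is needed.
  obtain ⟨⟨p, α, hp, hap⟩, hm0⟩ := hadm 0
  have hint : ∫⁻ x, ‖(hf2.toLp f) x‖ₑ ≤ ENNReal.ofReal (eLpNorm f 1 volume).toReal := by
    rw [ENNReal.ofReal_toReal hf1.2.ne, eLpNorm_one_eq_lintegral_enorm,
      lintegral_congr_ae (g := fun x => ‖f x‖ₑ) (hf2.coeFn_toLp.mono fun x hx => by simp only [hx])]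
  have key := hC.chain_endpoint hD (A := CB * A) (c := 16 * c) (by positivity) (by positivity)
    ENNReal.toReal_nonneg hG0 hint hG hK (L := List.ofFn fun i : Fin k => (a i.succ, m i.succ))
    (fun q hq => by
      obtain ⟨i, rfl⟩ := List.mem_ofFn.1 hq
      exact hadm i.succ)
    hp.measurable hp.nonneg_const hp.norm_le hp.eLpNorm_le hm0
  rw [List.length_ofFn] at key
  rw [eLpNorm_one_eq_lintegral_enorm,
    ← lintegral_congr_ae (f := fun x => ‖h.toLp _ x‖ₑ) (h.coeFn_toLp.mono fun x hx => by
      simp only [hx]), hh, List.ofFn_succ, chain_cons]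
  simp only
  rw [mulOp_congr hap]
  refine key.trans (ENNReal.ofReal_le_ofReal ?_)
  have hlog0 : 0 ≤ logLossNorm f := by
    have : 0 ≤ Real.log (2 + |(eLpNorm (cubicWeight f) ∞ volume).toReal|) :=
      Real.log_nonneg (by linarith [abs_nonneg (eLpNorm (cubicWeight f) ∞ volume).toReal])
    unfold logLossNorm
    positivity
  set T := (400 + 300 * C) * (16 * c) * CN with hT
  have hT0 : 0 < T := by positivity
  calc _ ≤ (400 + 300 * C) * (CB * A) * (16 * c) * (K * (CB * A)) ^ k * (CN * logLossNorm f) := by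
        gcongr
    _ = T * K ^ k * ((CB * A) ^ (k + 1) * logLossNorm f) := by rw [hT]; ring
    _ ≤ (T + K) * (T + K) ^ k * ((CB * A) ^ (k + 1) * logLossNorm f) := by
        gcongr <;> linarith
    _ = _ := by rw [mul_pow CB, mul_pow CB]; ring

end L2Plane

open Filter Topology L2Plane

theorem mainTheorem2 (χ : Plane → ℝ) (hχ : IsLittlewoodPaleyCutoff χ) (c : ℝ) (hc : 0 < c) :
    ∃ C : ℝ, 0 < C ∧
      (∀ (m a : Plane → ℂ) (A : ℝ), 0 ≤ A → IsCZSymbol c m → ContDiff ℝ ∞ a →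
        besovNorm χ a ≤ ENNReal.ofReal A →
        ∀ f : Plane → ℂ, MemLp (cubicWeight f) ∞ volume →
        ∀ n : ℕ, 1 ≤ n →
          MemLp ((coeffMultiplier a m)^[n] f) 2 volume ∧
          eLpNorm ((coeffMultiplier a m)^[n] f) 1 volume
            ≤ ENNReal.ofReal (C ^ n * A ^ n * logLossNorm f)) ∧
      (∀ (n : ℕ), 1 ≤ n → ∀ (m a : Fin n → Plane → ℂ) (A : ℝ), 0 ≤ A →
        (∀ i, IsCZSymbol c (m i)) → (∀ i, ContDiff ℝ ∞ (a i)) →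
        (∀ i, besovNorm χ (a i) ≤ ENNReal.ofReal A) →
        ∀ f : Plane → ℂ, MemLp (cubicWeight f) ∞ volume →
          MemLp (Fin.foldr n (fun i g => coeffMultiplier (a i) (m i) g) f) 2 volume ∧
          eLpNorm (Fin.foldr n (fun i g => coeffMultiplier (a i) (m i) g) f) 1 volume
            ≤ ENNReal.ofReal (C ^ n * A ^ n * logLossNorm f)) := by
  obtain ⟨C, hC, H⟩ := exists_composition_bound hχ hc
  have H' : ∀ (n : ℕ), 1 ≤ n → ∀ (m a : Fin n → Plane → ℂ) (A : ℝ), 0 ≤ A →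
      (∀ i, IsCZSymbol c (m i)) → (∀ i, besovNorm χ (a i) ≤ ENNReal.ofReal A) →
      ∀ f : Plane → ℂ, MemLp (cubicWeight f) ∞ volume →
        MemLp (Fin.foldr n (fun i g => coeffMultiplier (a i) (m i) g) f) 2 volume ∧
        eLpNorm (Fin.foldr n (fun i g => coeffMultiplier (a i) (m i) g) f) 1 volume
          ≤ ENNReal.ofReal (C ^ n * A ^ n * logLossNorm f) := by
    intro n hn m a A hA hm ha f hf
    -- To include A = 0, the estimate is applied to every A' > A and then A' tends to A; the
    -- constant does not depend on A'.
    have hlt : ∀ A' : ℝ, A < A' → _ := fun A' hA' => H n hn m a A' (hA.trans_lt hA') hm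
      (fun i => (ha i).trans (ENNReal.ofReal_le_ofReal hA'.le)) f hf
    refine ⟨(hlt (A + 1) (by linarith)).1, ?_⟩
    have hcont : Continuous fun A' : ℝ => ENNReal.ofReal (C ^ n * A' ^ n * logLossNorm f) :=
      ENNReal.continuous_ofReal.comp (by fun_prop)
    exact ge_of_tendsto ((hcont.tendsto A).mono_left (nhdsWithin_le_nhds (s := Set.Ioi A)))
      (eventually_mem_nhdsWithin.mono fun A' hA' => (hlt A' hA').2)
  refine ⟨C, hC, fun m a A hA hm _ ha f hf n hn => ?_, fun n hn m a A hA hm _ ha f hf =>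
    H' n hn m a A hA hm ha f hf⟩
  -- The power of a single operator is the composition with constant families.
  have h := H' n hn (fun _ => m) (fun _ => a) A hA (fun _ => hm) (fun _ => ha) f hf
  rwa [foldr_const_eq_iterate] at h
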